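/- **Notation.** Let $Z$ be the set of finitely supported integer vectors $l=(l_1,l_2,\dots)$ and $Z_\star=Z\setminus\{0\}$; put $\|l\|=\sum_{i\ge1}|l_i|\,i$ and, for $\omega\in\mathbb R^{\mathbb N^+}$, $(\omega,l)=\sum_i l_i\omega_i$. For $r>0$, $AP_r(\omega)$ is the set of functions $f:\{|\operatorname{Im}z|<r\}\to\mathbb C$ of the form $f(z)=\sum_{l\in Z}f_l\,e^{i(\omega,l)z}$ with $f_l\in\mathbb C$ and $\|f\|_r:=\sum_l|f_l|e^{r\|l\|}<\infty$. For $r,s>0$ and a real $\alpha$, $AP_{r,s}(\omega)$ is the set of functions $f:\{|\operatorname{Im}x|<r\}\times\{|y-\alpha|<s\}\to\mathbb C$ of the form $f(x,y)=\sum_{l\in Z}f_l(y)\,e^{i(\omega,l)x}$ with $f_l$ analytic on $\{y\in\mathbb C:|y-\alpha|<s\}$ and $\|f\|_{r,s}:=\sum_l\big(\sup_{|y-\alpha|<s}|f_l(y)|\big)e^{r\|l\|}<\infty$. **Theorem.** Let $r_0,s_0,\gamma,\mu,\varepsilon>0$. There is $\delta=\delta(\varepsilon,r_0,s_0,\gamma,\mu)>0$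 such that the following holds. Let $\omega=(\omega_1,\omega_2,\dots)$ be a real vector with $|\omega_i|\le1$ for all $i$ which, for some $\gamma_0>0$, satisfies $$|(\omega,l)|>\frac{\gamma_0}{\prod_{i\ge1}\big(1+i^{1+\mu}|l_i|^{1+\mu}\big)}\qquad\text{for all } l\in Z_\star,$$ and let $\alpha\in\mathbb R$ satisfy $$\Big|(\omega,l)\frac{\alpha}{2\pi}-n\Big|>\gamma\prod_{i\ge1}\frac1{1+i^{2+2\mu}|l_i|^{2+2\mu}}\qquad\text{for all } l\in Z_\star,\ n\in\mathbb Z.$$ Let $f,g\in AP_{r_0,s_0}(\omega)$ be real-valued at real points, and consider the map $$\mathfrak M:\quad x_1=x+y+f(x,y),\quad y_1=y+g(x,y),\qquad x\in\mathbb R,\ y\in(\alpha-s_0,\alpha+s_0).$$ Assume that $\mathfrak M$ has the intersection property: $\mathfrak M(\Gamma)\cap\Gamma\neq\emptyset$ for every curve $\Gamma=\{(x,\phi(x)):x\in\mathbb R\}$ contained in $\mathbb R\times(\alpha-s_0,\alpha+s_0)$, where $\phi\in\bigcup_{\rho>0}AP_\rho(\omega)$ is real-valued on $\mathbb R$. If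 $$\|f\|_{r_0,s_0}+\|g\|_{r_0,s_0}<\delta,$$ then there are $u,v\in AP_{r_0/2}(\omega)$, real-valued on $\mathbb R$, with $$\|u\|_{r_0/2}+\|v-\alpha\|_{r_0/2}<\varepsilon,$$ such that the curve $\Gamma=\{(\xi+u(\xi),v(\xi)):\xi\in\mathbb R\}$ lies in $\mathbb R\times(\alpha-s_0,\alpha+s_0)$, is invariant, $\mathfrak M(\Gamma)=\Gamma$, and $\mathfrak M$ acts on it as the rotation $\xi\mapsto\xi+\alpha$, that is, $$\mathfrak M\big(\xi+u(\xi),v(\xi)\big)=\big(\xi+\alpha+u(\xi+\alpha),\,v(\xi+\alpha)\big)\qquad\text{for all }\xi\in\mathbb R.$$ -/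

import Mathlib

open scoped ENNReal

noncomputable section

/-- The pairing `(ω, l) = ∑ i, l i * ω i` of a frequency vector with a finitely supported
integer vector. -/
def freqPairing (ω : ℕ+ → ℝ) (l : ℕ+ →₀ ℤ) : ℝ :=
  l.sum fun i k => (k : ℝ) * ω i

/-- The weight `‖l‖ = ∑ i, |l i| * i`. -/
def indexWeight (l : ℕ+ →₀ ℤ) : ℝ :=
  l.sum fun i k => |(k : ℝ)| * ((i : ℕ) : ℝ)

/-- The product `∏ i, (1 + i ^ p * |l i| ^ p)`; for `0 < p` the factors with `l i = 0` are `1`,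
so that the product over the support is the product over all `i`. -/
def divisorProd (p : ℝ) (l : ℕ+ →₀ ℤ) : ℝ :=
  l.prod fun i k => 1 + ((i : ℕ) : ℝ) ^ p * |(k : ℝ)| ^ p

/-- The Diophantine condition on an infinite dimensional frequency vector. -/
structure IsDiophantine (ω : ℕ+ → ℝ) (γ₀ μ : ℝ) : Prop where
  abs_le_one : ∀ i, |ω i| ≤ 1
  lower_bound : ∀ l : ℕ+ →₀ ℤ, l ≠ 0 → γ₀ / divisorProd (1 + μ) l < |freqPairing ω l|

/-- The nonresonance condition on the rotation number `α` relative to `ω`. -/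
def IsNonresonant (ω : ℕ+ → ℝ) (γ μ α : ℝ) : Prop :=
  ∀ l : ℕ+ →₀ ℤ, l ≠ 0 → ∀ n : ℤ,
    γ * (1 / divisorProd (2 + 2 * μ) l) < |freqPairing ω l * (α / (2 * Real.pi)) - n|

/-- `f z = ∑ l, c l * e ^ (i (ω, l) z)` on the strip `|Im z| < r`. -/
def HasFourierSeries (ω : ℕ+ → ℝ) (r : ℝ) (c : (ℕ+ →₀ ℤ) → ℂ) (f : ℂ → ℂ) : Prop :=
  ∀ z : ℂ, |z.im| < r →
    HasSum (fun l => c l * Complex.exp (Complex.I * (freqPairing ω l : ℂ) * z)) (f z)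

/-- The weighted sum `∑ l, |c l| * e ^ (r ‖l‖)`, possibly infinite. -/
def coeffNorm (r : ℝ) (c : (ℕ+ →₀ ℤ) → ℂ) : ℝ≥0∞ :=
  ∑' l, ‖c l‖ₑ * ENNReal.ofReal (Real.exp (r * indexWeight l))

/-- The space `AP_r(ω)`; a function is only looked at on the strip `|Im z| < r`. -/
def AP (ω : ℕ+ → ℝ) (r : ℝ) : Set (ℂ → ℂ) :=
  {f | ∃ c, HasFourierSeries ω r c f ∧ coeffNorm r c < ⊤}

/-- The norm `‖f‖_r`. When the numbers `(ω, l)` are pairwise distinct (in particular for a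
Diophantine `ω`) and `0 < r`, the coefficients of `f` are unique, so that the infimum runs over a
single family; it is `⊤` if `f` has no such expansion. -/
def apNorm (ω : ℕ+ → ℝ) (r : ℝ) (f : ℂ → ℂ) : ℝ≥0∞ :=
  ⨅ (c : (ℕ+ →₀ ℤ) → ℂ) (_ : HasFourierSeries ω r c f), coeffNorm r c

/-- `f x y = ∑ l, c l y * e ^ (i (ω, l) x)` for `|Im x| < r`, `|y - y₀| < s`, with coefficients
`c l` analytic on the disc `|y - y₀| < s`. -/
structure HasFourierSeries₂ (ω : ℕ+ → ℝ) (y₀ r s : ℝ) (c : (ℕ+ →₀ ℤ) → ℂ → ℂ)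
    (f : ℂ → ℂ → ℂ) : Prop where
  analytic : ∀ l, AnalyticOnNhd ℂ (c l) (Metric.ball (y₀ : ℂ) s)
  hasSum : ∀ x : ℂ, |x.im| < r → ∀ y ∈ Metric.ball (y₀ : ℂ) s,
    HasSum (fun l => c l y * Complex.exp (Complex.I * (freqPairing ω l : ℂ) * x)) (f x y)

/-- The weighted sum `∑ l, |c l|_s * e ^ (r ‖l‖)`, where `|c l|_s` is the sup-norm on the disc
`|y - y₀| < s`; possibly infinite. -/
def coeffNorm₂ (y₀ r s : ℝ) (c : (ℕ+ →₀ ℤ) → ℂ → ℂ) : ℝ≥0∞ :=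
  ∑' l, (⨆ y ∈ Metric.ball (y₀ : ℂ) s, ‖c l y‖ₑ) * ENNReal.ofReal (Real.exp (r * indexWeight l))

/-- The space `AP_{r,s}(ω)` of functions on `|Im x| < r`, `|y - y₀| < s`. -/
def AP₂ (ω : ℕ+ → ℝ) (y₀ r s : ℝ) : Set (ℂ → ℂ → ℂ) :=
  {f | ∃ c, HasFourierSeries₂ ω y₀ r s c f ∧ coeffNorm₂ y₀ r s c < ⊤}

/-- The norm `‖f‖_{r,s}`; as in the one-variable case the coefficients are unique on the disc. -/
def apNorm₂ (ω : ℕ+ → ℝ) (y₀ r s : ℝ) (f : ℂ → ℂ → ℂ) : ℝ≥0∞ :=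
  ⨅ (c : (ℕ+ →₀ ℤ) → ℂ → ℂ) (_ : HasFourierSeries₂ ω y₀ r s c f), coeffNorm₂ y₀ r s c

/-- Real-valued on the real axis. -/
def RealOnReals (φ : ℂ → ℂ) : Prop := ∀ x : ℝ, (φ x).im = 0

/-- Real-valued at the real points of `ℂ × {|y - y₀| < s}`. -/
def RealOnStrip (y₀ s : ℝ) (f : ℂ → ℂ → ℂ) : Prop :=
  ∀ x y : ℝ, |y - y₀| < s → (f x y).im = 0

/-- The twist map `(x, y) ↦ (x + y + f(x, y), y + g(x, y))`. If `f` and `g` are real at real points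
it sends real points to real points. -/
def twistMap (f g : ℂ → ℂ → ℂ) (p : ℂ × ℂ) : ℂ × ℂ :=
  (p.1 + p.2 + f p.1 p.2, p.2 + g p.1 p.2)

/-- The set of (real) points `(X ξ, Y ξ)`, `ξ` real. -/
def curveSet (X Y : ℂ → ℂ) : Set (ℂ × ℂ) :=
  Set.range fun ξ : ℝ => (X ξ, Y ξ)

/-- The intersection property of the twist map on the real strip `|y - y₀| < s`: every real
analytic almost periodic curve `y = φ x` lying in the strip meets its image, where `φ` belongs
to `AP_ρ(ω)` for some `ρ > 0`. -/
def HasIntersectionProperty (ω : ℕ+ → ℝ) (y₀ s : ℝ) (f g : ℂ → ℂ → ℂ) : Prop :=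
  ∀ φ : ℂ → ℂ, (∃ ρ : ℝ, 0 < ρ ∧ φ ∈ AP ω ρ) → RealOnReals φ →
    (∀ x : ℝ, φ x ∈ Metric.ball (y₀ : ℂ) s) →
    ((twistMap f g '' curveSet id φ) ∩ curveSet id φ).Nonempty

end

open scoped NNReal ComplexConjugate
open Complex (I)

/-! The curve is sought as ξ ↦ (ξ + u(ξ), α + w(ξ)). Invariance with rotation α means that two
functions vanish: err₁ = u + w + f − u(· + α) and err₂ = w + g − w(· + α), with f and g evaluated
along the curve. They are removed by a Newton iteration in the algebras `WA r` of Fourier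
coefficients with weighted ℓ¹ norm; every step gives up part of the strip width r.

The linearised equations become triangular in a frame moving with the curve. Put U = 1 + u' and W =
w'. Differentiating the errors shows that the differential of the map sends the tangent vector (U,
W) at ξ to the one at ξ + α, up to the derivative of the error. The second frame vector is (0, q/U),
where q and a constant κ near 1 approximately solve J q = κ q(· + α), J being the Jacobian
determinant along the curve. No area is preserved, so κ need not be 1; the defect err₃ of this
equation is reduced together with the other two. For a correction t (U, W) + n (0, q/U) there remain
the scalar equations κ n − n(· + α) = known + k and t − t(· + α) = known − g n, with g close to 1.
The identities `newton_first`, `newton_second` and `newton_third` express that the remaining errors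
are quadratic.

The t-equation is solvable only if its right side has mean zero. The twist makes the mean of g
nonzero, so a constant added to n achieves this. The price is the constant k in the n-equation,
which survives in the new err₂. Here the intersection property enters: where the image of the curve
meets the curve, |err₂| ≤ |err₁| (`crossing_of_intersection`). The new err₁ is already quadratic, so
evaluating at such a point forces k to be quadratic too (`exists_curve`).

Small divisors: for a loss ρ of width, the products in the nonresonance condition are at most
exp(K/ρ⁵) times e^(ρ‖l‖), and κ − e^(iθ) is no worse than 1 − e^(iθ) (`exists_smallDivisors`). With
Λ = exp(K/ρ⁵), one step turns an error e into Λ⁸e² (`exists_step`). Widths shrinking like (9/10)ⁿ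
keep e below Λ^(−40), and the curves converge on half of the original strip
(`exists_invariant_curve`). K depends only on the nonresonance exponent and γ, so the threshold δ is
uniform in ω and α. -/

noncomputable section

/-! ### Weights on the lattice of Fourier indices. -/

/-- Finitely supported integer vectors. -/
abbrev Idx : Type := ℕ+ →₀ ℤ

lemma indexWeight_nonneg (l : Idx) : 0 ≤ indexWeight l :=
  Finset.sum_nonneg fun i _ => by positivity

@[simp] lemma indexWeight_zero : indexWeight 0 = 0 := by simp [indexWeight]

@[simp] lemma indexWeight_neg (l : Idx) : indexWeight (-l) = indexWeight l := by
  unfold indexWeight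
  rw [Finsupp.sum_neg_index (by simp)]
  simp

lemma indexWeight_eq_sum (l : Idx) {s : Finset ℕ+} (hs : l.support ⊆ s) :
    indexWeight l = ∑ i ∈ s, |(l i : ℝ)| * ((i : ℕ) : ℝ) :=
  Finsupp.sum_of_support_subset l hs _ (by simp)

lemma indexWeight_add_le (l m : Idx) : indexWeight (l + m) ≤ indexWeight l + indexWeight m := by
  classical
  rw [indexWeight_eq_sum (l + m) (Finsupp.support_add),
    indexWeight_eq_sum l (Finset.subset_union_left (s₂ := m.support)),
    indexWeight_eq_sum m (Finset.subset_union_right (s₁ := l.support)),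
    ← Finset.sum_add_distrib]
  refine Finset.sum_le_sum fun i _ => ?_
  rw [← add_mul]
  refine mul_le_mul_of_nonneg_right ?_ (by positivity)
  rw [Finsupp.add_apply]
  push_cast
  exact abs_add_le _ _

lemma freqPairing_add (ω : ℕ+ → ℝ) (l m : Idx) :
    freqPairing ω (l + m) = freqPairing ω l + freqPairing ω m := by
  unfold freqPairing
  exact Finsupp.sum_add_index (by simp) (by intros; push_cast; ring)

@[simp] lemma freqPairing_zero (ω : ℕ+ → ℝ) : freqPairing ω 0 = 0 := by simp [freqPairing]

@[simp] lemma freqPairing_neg (ω : ℕ+ → ℝ) (l : Idx) : freqPairing ω (-l) = -freqPairing ω l := by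
  have := freqPairing_add ω (-l) l
  simp at this
  linarith

lemma abs_freqPairing_le {ω : ℕ+ → ℝ} (hω : ∀ i, |ω i| ≤ 1) (l : Idx) :
    |freqPairing ω l| ≤ indexWeight l := by
  unfold freqPairing indexWeight Finsupp.sum
  refine (Finset.abs_sum_le_sum_abs _ _).trans (Finset.sum_le_sum fun i _ => ?_)
  rw [abs_mul]
  refine mul_le_mul_of_nonneg_left ((hω i).trans ?_) (abs_nonneg _)
  exact_mod_cast i.pos

/-- The exponential weight `e ^ (r ‖l‖)`. -/
def wt (r : ℝ≥0) (l : Idx) : ℝ := Real.exp (r * indexWeight l)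

lemma wt_pos (r : ℝ≥0) (l : Idx) : 0 < wt r l := Real.exp_pos _

lemma one_le_wt (r : ℝ≥0) (l : Idx) : 1 ≤ wt r l :=
  Real.one_le_exp (mul_nonneg r.2 (indexWeight_nonneg l))

@[simp] lemma wt_zero (r : ℝ≥0) : wt r 0 = 1 := by simp [wt]

@[simp] lemma wt_neg (r : ℝ≥0) (l : Idx) : wt r (-l) = wt r l := by simp [wt]

lemma wt_add_le (r : ℝ≥0) (l m : Idx) : wt r (l + m) ≤ wt r l * wt r m := by
  unfold wt
  rw [← Real.exp_add, ← mul_add]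
  exact Real.exp_le_exp.2 (mul_le_mul_of_nonneg_left (indexWeight_add_le l m) r.2)

lemma wt_mono {r r' : ℝ≥0} (h : r' ≤ r) (l : Idx) : wt r' l ≤ wt r l :=
  Real.exp_le_exp.2 (mul_le_mul_of_nonneg_right (by exact_mod_cast h) (indexWeight_nonneg l))

/-! ### The weighted Wiener algebra. -/

/-- The coefficient families with finite weighted `ℓ¹` norm. -/
def weightedSubmodule (r : ℝ≥0) : Submodule ℂ (Idx → ℂ) where
  carrier := {c | Summable fun l => ‖c l‖ * wt r l}
  zero_mem' := by simp [summable_zero]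
  add_mem' := by
    intro a b ha hb
    refine Summable.of_nonneg_of_le (fun l => by have := wt_pos r l; positivity) (fun l => ?_)
      (ha.add hb)
    rw [← add_mul]
    exact mul_le_mul_of_nonneg_right (norm_add_le _ _) (wt_pos r l).le
  smul_mem' := by
    intro c a ha
    refine (ha.mul_left ‖c‖).congr fun l => ?_
    simp [mul_assoc]

/-- The weighted Wiener algebra: families `(c l)` with `∑ l, ‖c l‖ * e ^ (r ‖l‖) < ∞`. -/
def WA (r : ℝ≥0) : Type := weightedSubmodule r

namespace WA

variable {r r' : ℝ≥0}

instance : AddCommGroup (WA r) := inferInstanceAs (AddCommGroup (weightedSubmodule r))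
instance : Module ℂ (WA r) := inferInstanceAs (Module ℂ (weightedSubmodule r))
instance : FunLike (WA r) Idx ℂ := ⟨fun x => x.1, fun _ _ h => Subtype.ext h⟩

/-- The element with given coefficients. -/
def mk (c : Idx → ℂ) (hc : Summable fun l => ‖c l‖ * wt r l) : WA r := ⟨c, hc⟩

@[simp] lemma mk_apply (c : Idx → ℂ) (hc : Summable fun l => ‖c l‖ * wt r l) (l : Idx) :
    mk c hc l = c l := rfl
@[simp] lemma add_apply (x y : WA r) (l : Idx) : (x + y) l = x l + y l := rfl
@[simp] lemma sub_apply (x y : WA r) (l : Idx) : (x - y) l = x l - y l := rfl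
@[simp] lemma neg_apply (x : WA r) (l : Idx) : (-x) l = -x l := rfl
@[simp] lemma zero_apply (l : Idx) : (0 : WA r) l = 0 := rfl
@[simp] lemma smul_apply (c : ℂ) (x : WA r) (l : Idx) : (c • x) l = c * x l := rfl

lemma ext {x y : WA r} (h : ∀ l, x l = y l) : x = y := DFunLike.ext x y h

lemma summable (x : WA r) : Summable fun l => ‖x l‖ * wt r l := x.2

/-- The isometric identification with `ℓ¹`. -/
def toLp (r : ℝ≥0) : WA r →ₗ[ℂ] lp (fun _ : Idx => ℂ) 1 where
  toFun x := ⟨fun l => x l * (wt r l : ℂ), by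
    refine (memℓp_gen_iff (p := 1) (by simp)).2 ?_
    refine x.summable.congr fun l => ?_
    simp [abs_of_pos (wt_pos r l)]⟩
  map_add' x y := by ext l; exact add_mul _ _ _
  map_smul' c x := by ext l; exact mul_assoc _ _ _

lemma toLp_apply (x : WA r) (l : Idx) : toLp r x l = x l * (wt r l : ℂ) := rfl

lemma toLp_injective : Function.Injective (toLp r) := by
  intro x y h
  refine ext fun l => ?_
  have h1 : toLp r x l = toLp r y l := by rw [h]
  rw [toLp_apply, toLp_apply] at h1
  exact mul_right_cancel₀ (by exact_mod_cast (wt_pos r l).ne') h1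

lemma toLp_surjective : Function.Surjective (toLp r) := by
  intro y
  have h1 : ∀ l, (wt r l : ℂ) ≠ 0 := fun l => by exact_mod_cast (wt_pos r l).ne'
  have h2 := (memℓp_gen_iff (p := 1) (by simp)).1 y.2
  refine ⟨mk (fun l => y l / (wt r l : ℂ)) ?_, ?_⟩
  · refine h2.congr fun l => ?_
    have := (wt_pos r l).ne'
    simp [abs_of_pos (wt_pos r l)]
    field_simp
  · ext l
    rw [toLp_apply, mk_apply, div_mul_cancel₀ _ (h1 l)]

instance : NormedAddCommGroup (WA r) :=
  NormedAddCommGroup.induced (WA r) (lp (fun _ : Idx => ℂ) 1) (toLp r) toLp_injective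
instance : NormedSpace ℂ (WA r) := NormedSpace.induced ℂ (WA r) (lp (fun _ : Idx => ℂ) 1) (toLp r)

lemma norm_def (x : WA r) : ‖x‖ = ∑' l, ‖x l‖ * wt r l := by
  have h : ‖x‖ = ‖toLp r x‖ := rfl
  rw [h, lp.norm_eq_tsum_rpow (by simp)]
  simp [toLp_apply, abs_of_pos (wt_pos r _)]

instance : CompleteSpace (WA r) := by
  have h : Isometry (toLp r) := AddMonoidHomClass.isometry_of_norm _ fun _ => rfl
  exact (IsometryEquiv.mk' (toLp r) (Function.surjInv toLp_surjective)
    (Function.rightInverse_surjInv toLp_surjective) h).completeSpace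

lemma norm_coeff_mul_le (x : WA r) (l : Idx) : ‖x l‖ * wt r l ≤ ‖x‖ := by
  rw [norm_def]
  exact x.summable.le_tsum l fun m _ => by have := wt_pos r m; positivity

lemma norm_coeff_le (x : WA r) (l : Idx) : ‖x l‖ ≤ ‖x‖ :=
  (le_mul_of_one_le_right (norm_nonneg _) (one_le_wt r l)).trans (norm_coeff_mul_le x l)

lemma norm_le_of_coeff_le {x : WA r} {y : WA r'} {C : ℝ}
    (h : ∀ l, ‖x l‖ * wt r l ≤ C * (‖y l‖ * wt r' l)) : ‖x‖ ≤ C * ‖y‖ := by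
  rw [norm_def, norm_def, ← tsum_mul_left]
  exact x.summable.tsum_le_tsum h (y.summable.mul_left C)

/-- The basis element `e ^ (i (ω, l) x)`. -/
def e (r : ℝ≥0) (l : Idx) : WA r :=
  mk (Pi.single l 1) (summable_of_ne_finset_zero (s := {l}) fun m hm => by
    simp [Pi.single_eq_of_ne (Finset.notMem_singleton.1 hm)])

lemma e_apply (l m : Idx) : e r l m = (Pi.single l 1 : Idx → ℂ) m := rfl

lemma norm_e (l : Idx) : ‖e r l‖ = wt r l := by
  rw [norm_def, tsum_eq_single l]
  · simp [e_apply]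
  · intro m hm
    simp [e_apply, Pi.single_eq_of_ne hm]

/-- Absolute convergence is the finiteness of the norm, and the continuous coefficient functionals
identify the sum. Hence continuous linear and bilinear identities need checking only on basis
elements, which is how the whole algebra structure is obtained. -/
lemma hasSum_e (x : WA r) : HasSum (fun l => x l • e r l) x := by
  have hs : Summable fun l => x l • e r l := by
    refine Summable.of_norm (x.summable.congr fun l => ?_)
    rw [norm_smul, norm_e]
  have h2 : ∑' l, x l • e r l = x := by
    have hc : ∀ m, HasSum (fun l => (x l • e r l) m) ((∑' l, x l • e r l : WA r) m) := fun m => by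
      have hl : Continuous fun y : WA r => y m :=
        AddMonoidHomClass.continuous_of_bound
          (AddMonoidHom.mk' (fun y : WA r => y m) (fun _ _ => rfl)) 1
          (fun y => (norm_coeff_le y m).trans_eq (one_mul _).symm)
      exact hs.hasSum.map (AddMonoidHom.mk' (fun y : WA r => y m) (fun _ _ => rfl)) hl
    refine ext fun m => (hc m).unique ?_
    convert hasSum_ite_eq m (x m) using 2 with l
    by_cases h : l = m
    · subst h; simp [e_apply]
    · simp [e_apply, h]
  exact (Summable.hasSum_iff hs).2 h2

/-- Continuous additive maps are determined by their values on multiples of the basis. -/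
lemma addHom_ext {B : Type*} [AddCommMonoid B] [TopologicalSpace B] [T2Space B] {f g : WA r →+ B}
    (hf : Continuous f) (hg : Continuous g) (h : ∀ (c : ℂ) l, f (c • e r l) = g (c • e r l)) :
    f = g := by
  ext x
  have h1 := (hasSum_e x).map f hf
  have h2 := (hasSum_e x).map g hg
  refine h1.unique (h2.congr_fun fun l => ?_)
  simp [h]

section lin

variable {B : Type*} [NormedAddCommGroup B] [NormedSpace ℂ B]

lemma clm_ext {f g : WA r →L[ℂ] B} (h : ∀ l, f (e r l) = g (e r l)) : f = g := by
  have := addHom_ext (f := (f : WA r →+ B)) (g := (g : WA r →+ B)) f.continuous g.continuous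
    (fun c l => by simp [h])
  ext x
  exact DFunLike.congr_fun this x

variable [CompleteSpace B]

/-- The continuous linear map with prescribed values on the basis. -/
def lin (v : Idx → B) (C : ℝ) (hv : ∀ l, ‖v l‖ ≤ C * wt r l) : WA r →L[ℂ] B :=
  have hs : ∀ x : WA r, Summable fun l => x l • v l := fun x => by
    refine Summable.of_norm_bounded (x.summable.mul_left C) fun l => ?_
    rw [norm_smul]
    calc ‖x l‖ * ‖v l‖ ≤ ‖x l‖ * (C * wt r l) := by gcongr; exact hv l
      _ = _ := by ring
  LinearMap.mkContinuous
    { toFun := fun x => ∑' l, x l • v l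
      map_add' := fun x y => by
        rw [← (hs x).tsum_add (hs y)]
        exact tsum_congr fun l => by simp [add_smul]
      map_smul' := fun c x => by
        rw [RingHom.id_apply, ← (hs x).tsum_const_smul]
        exact tsum_congr fun l => by simp [mul_smul] } C (fun x => by
      rw [norm_def, ← tsum_mul_left]
      refine tsum_of_norm_bounded (x.summable.mul_left C).hasSum fun l => ?_
      rw [norm_smul]
      calc ‖x l‖ * ‖v l‖ ≤ ‖x l‖ * (C * wt r l) := by gcongr; exact hv l
        _ = _ := by ring)

lemma lin_apply (v : Idx → B) (C : ℝ) (hv : ∀ l, ‖v l‖ ≤ C * wt r l) (x : WA r) :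
    lin v C hv x = ∑' l, x l • v l := rfl

lemma lin_e (v : Idx → B) (C : ℝ) (hv : ∀ l, ‖v l‖ ≤ C * wt r l) (l : Idx) :
    lin v C hv (e r l) = v l := by
  rw [lin_apply, tsum_eq_single l]
  · simp [e_apply]
  · intro m hm
    simp [e_apply, Pi.single_eq_of_ne hm]

lemma norm_lin_apply_le (v : Idx → B) (C : ℝ) (hv : ∀ l, ‖v l‖ ≤ C * wt r l) (x : WA r) :
    ‖lin v C hv x‖ ≤ C * ‖x‖ := by
  rw [norm_def, ← tsum_mul_left, lin_apply]
  refine tsum_of_norm_bounded (x.summable.mul_left C).hasSum fun l => ?_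
  rw [norm_smul]
  calc ‖x l‖ * ‖v l‖ ≤ ‖x l‖ * (C * wt r l) := by gcongr; exact hv l
    _ = _ := by ring

end lin

/-- Multiplication by a basis element. -/
def shift (r : ℝ≥0) (l : Idx) : WA r →L[ℂ] WA r :=
  lin (fun m => e r (l + m)) (wt r l) fun m => by rw [norm_e]; exact wt_add_le r l m

/-- Convolution of coefficient families. -/
def conv (r : ℝ≥0) : WA r →L[ℂ] WA r →L[ℂ] WA r :=
  lin (shift r) 1 fun l => by
    rw [one_mul]
    exact ContinuousLinearMap.opNorm_le_bound _ (wt_pos r l).le (norm_lin_apply_le _ _ _)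

lemma conv_e_e (l m : Idx) : conv r (e r l) (e r m) = e r (l + m) := by
  rw [conv, lin_e, shift, lin_e]

lemma conv_comm (x y : WA r) : conv r x y = conv r y x := by
  have h : conv r = (conv r).flip := by
    refine clm_ext fun l => clm_ext fun m => ?_
    rw [ContinuousLinearMap.flip_apply, conv_e_e, conv_e_e, add_comm]
  exact DFunLike.congr_fun (DFunLike.congr_fun h x) y

/-- Both sides are continuous and trilinear, so one variable at a time is released from the basis,
where associativity is that of index addition. -/
lemma conv_assoc (x y z : WA r) : conv r (conv r x y) z = conv r x (conv r y z) := by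
  have h1 : ∀ l m, (conv r (conv r (e r l) (e r m))) = (conv r (e r l)).comp (conv r (e r m)) :=
    fun l m => clm_ext fun n => by
      simp only [ContinuousLinearMap.comp_apply, conv_e_e, add_assoc]
  have h2 : ∀ l y, (conv r (conv r (e r l) y)) = (conv r (e r l)).comp (conv r y) := fun l y => by
    have : (conv r).comp (conv r (e r l)) =
        (ContinuousLinearMap.compL ℂ (WA r) (WA r) (WA r) (conv r (e r l))).comp (conv r) :=
      clm_ext fun m => by simp [h1]
    exact DFunLike.congr_fun this y
  have h3 : (conv r).comp ((conv r).flip y) =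
      ((ContinuousLinearMap.compL ℂ (WA r) (WA r) (WA r)).flip (conv r y)).comp (conv r) :=
    clm_ext fun l => by simp [h2]
  have := DFunLike.congr_fun (DFunLike.congr_fun h3 x) z
  simpa using this

instance : Mul (WA r) := ⟨fun x y => conv r x y⟩
instance : One (WA r) := ⟨e r 0⟩

lemma mul_def (x y : WA r) : x * y = conv r x y := rfl
lemma one_def : (1 : WA r) = e r 0 := rfl

lemma conv_one (x : WA r) : conv r (e r 0) x = x := by
  have : conv r (e r 0) = ContinuousLinearMap.id ℂ (WA r) := clm_ext fun l => by simp [conv_e_e]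
  rw [this]; rfl

instance : CommRing (WA r) :=
  { (inferInstance : AddCommGroup (WA r)), (inferInstance : Mul (WA r)),
    (inferInstance : One (WA r)) with
    left_distrib := fun x y z => by simp [mul_def]
    right_distrib := fun x y z => by simp [mul_def]
    zero_mul := fun x => by simp [mul_def]
    mul_zero := fun x => by simp [mul_def]
    mul_assoc := conv_assoc
    mul_comm := conv_comm
    one_mul := conv_one
    mul_one := fun x => by rw [mul_def, conv_comm]; exact conv_one x }

instance : NormedCommRing (WA r) :=
  { (inferInstance : NormedAddCommGroup (WA r)), (inferInstance : CommRing (WA r)) with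
    norm_mul_le := fun x y => by
      rw [mul_def]
      refine (ContinuousLinearMap.le_opNorm _ _).trans ?_
      gcongr
      exact (norm_lin_apply_le (shift r) 1 _ x).trans_eq (one_mul _) }

instance : Algebra ℂ (WA r) :=
  Algebra.ofModule (fun c x y => by simp [mul_def]) (fun c x y => by simp [mul_def])

instance : NormedAlgebra ℂ (WA r) where
  norm_smul_le := norm_smul_le

instance : NormOneClass (WA r) := ⟨by rw [one_def, norm_e, wt_zero]⟩

lemma e_mul_e (l m : Idx) : e r l * e r m = e r (l + m) := conv_e_e l m

lemma one_apply (l : Idx) : (1 : WA r) l = if l = 0 then 1 else 0 := by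
  rw [one_def, e_apply, Pi.single_apply]

lemma one_apply_zero : (1 : WA r) 0 = 1 := by simp [one_apply]

lemma mul_ext {B : Type*} [NormedAddCommGroup B] [NormedSpace ℂ B] {f g : WA r →L[ℂ] WA r →L[ℂ] B}
    (h : ∀ l m, f (e r l) (e r m) = g (e r l) (e r m)) : f = g :=
  clm_ext fun l => clm_ext fun m => h l m

end WA

/-! ### Diagonal operators, translation, evaluation and conjugation. -/

namespace WA

variable {r r' r'' : ℝ≥0}

instance : NormedAlgebra ℚ (WA r) := NormedAlgebra.restrictScalars ℚ ℂ (WA r)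

lemma norm_exp_le (x : WA r) : ‖NormedSpace.exp x‖ ≤ Real.exp ‖x‖ := by
  rw [NormedSpace.exp_eq_tsum ℂ]
  refine tsum_of_norm_bounded (NormedSpace.expSeries_div_hasSum_exp (𝔸 := ℝ) ‖x‖ |>.congr_fun
    (fun _ => rfl) |> fun h => by rwa [← Real.exp_eq_exp_ℝ] at h) fun n => ?_
  rw [norm_smul, div_eq_inv_mul]
  simp only [norm_inv, RCLike.norm_natCast]
  gcongr
  exact norm_pow_le x n

/-- The coefficient functional. -/
def coeffL (r : ℝ≥0) (l : Idx) : WA r →L[ℂ] ℂ :=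
  LinearMap.mkContinuous ⟨⟨fun x => x l, fun _ _ => rfl⟩, fun _ _ => rfl⟩ 1
    fun x => (norm_coeff_le x l).trans_eq (one_mul _).symm

@[simp] lemma coeffL_apply (x : WA r) (l : Idx) : coeffL r l x = x l := rfl

/-- The diagonal operator with the given eigenvalues. -/
def diag (m : Idx → ℂ) (C : ℝ) (h : ∀ l, ‖m l‖ * wt r' l ≤ C * wt r l) : WA r →L[ℂ] WA r' :=
  lin (fun l => m l • e r' l) C fun l => by rw [norm_smul, norm_e]; exact h l

lemma diag_apply (m : Idx → ℂ) (C : ℝ) (h : ∀ l, ‖m l‖ * wt r' l ≤ C * wt r l) (x : WA r)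
    (l : Idx) : diag m C h x l = m l * x l := by
  have : (coeffL r' l).comp (diag m C h) = m l • coeffL r l := clm_ext fun k => by
    rw [ContinuousLinearMap.comp_apply, diag, lin_e, _root_.smul_apply]
    simp only [map_smul, coeffL_apply, e_apply, smul_eq_mul]
    by_cases hk : l = k
    · rw [hk]
    · simp [Pi.single_eq_of_ne hk]
  exact DFunLike.congr_fun this x

lemma norm_diag_le (m : Idx → ℂ) (C : ℝ) (h : ∀ l, ‖m l‖ * wt r' l ≤ C * wt r l) (x : WA r) :
    ‖diag m C h x‖ ≤ C * ‖x‖ := norm_lin_apply_le _ _ _ x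

section hom

variable {B : Type*} [NormedCommRing B] [NormedAlgebra ℂ B] [CompleteSpace B]

/-- The algebra homomorphism given by a character. -/
def hom (v : Idx → B) (hv : ∀ l, ‖v l‖ ≤ wt r l) (h0 : v 0 = 1)
    (hadd : ∀ l m, v (l + m) = v l * v m) : WA r →ₐ[ℂ] B :=
  AlgHom.ofLinearMap (lin v 1 fun l => (hv l).trans_eq (one_mul _).symm : WA r →ₗ[ℂ] B)
    (by simp [one_def, lin_e, h0]) fun x y => by
      have : (ContinuousLinearMap.compL ℂ (WA r) (WA r) B
          (lin v 1 fun l => (hv l).trans_eq (one_mul _).symm)).comp (conv r) =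
          (((ContinuousLinearMap.mul ℂ B).comp
            (lin v 1 fun l => (hv l).trans_eq (one_mul _).symm)).flip.comp
            (lin v 1 fun l => (hv l).trans_eq (one_mul _).symm)).flip := by
        refine mul_ext fun l m => ?_
        simp [conv_e_e, lin_e, hadd]
      exact DFunLike.congr_fun (DFunLike.congr_fun this x) y

lemma hom_apply (v : Idx → B) (hv : ∀ l, ‖v l‖ ≤ wt r l) (h0 hadd) (x : WA r) :
    hom v hv h0 hadd x = lin v 1 (fun l => (hv l).trans_eq (one_mul _).symm) x := rfl

lemma norm_hom_le (v : Idx → B) (hv : ∀ l, ‖v l‖ ≤ wt r l) (h0 hadd) (x : WA r) :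
    ‖hom v hv h0 hadd x‖ ≤ ‖x‖ := by
  rw [hom_apply]
  exact (norm_lin_apply_le _ _ _ x).trans_eq (one_mul _)

lemma continuous_hom (v : Idx → B) (hv : ∀ l, ‖v l‖ ≤ wt r l) (h0 hadd) :
    Continuous (hom v hv h0 hadd) :=
  (lin v 1 fun l => (hv l).trans_eq (one_mul _).symm).continuous

lemma hom_e (v : Idx → B) (hv : ∀ l, ‖v l‖ ≤ wt r l) (h0 hadd) (l : Idx) :
    hom v hv h0 hadd (e r l) = v l := by
  rw [hom_apply, lin_e]

end hom

/-- Inclusion into the algebra of a smaller strip. -/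
def incl (h : r' ≤ r) : WA r →ₐ[ℂ] WA r' :=
  hom (e r') (fun l => by rw [norm_e]; exact wt_mono h l) rfl fun l m => (e_mul_e l m).symm

@[simp] lemma incl_e (h : r' ≤ r) (l : Idx) : incl h (e r l) = e r' l := hom_e _ _ _ _ l

lemma norm_incl_le (h : r' ≤ r) (x : WA r) : ‖incl h x‖ ≤ ‖x‖ := norm_hom_le _ _ _ _ x

lemma continuous_incl (h : r' ≤ r) : Continuous (incl h) := continuous_hom _ _ _ _

@[simp] lemma incl_apply (h : r' ≤ r) (x : WA r) (l : Idx) : incl h x l = x l := by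
  have h1 := diag_apply (r := r) (r' := r') (fun _ => 1) 1 (fun l => by simpa using wt_mono h l) x l
  rw [one_mul] at h1
  rw [← h1]
  simp [diag, incl, hom_apply]

lemma incl_incl (h : r' ≤ r) (h' : r'' ≤ r') (x : WA r) :
    incl h' (incl h x) = incl (h'.trans h) x := ext fun l => by simp

section tau

variable (ω : ℕ+ → ℝ) (t : ℝ)

lemma norm_cexp_mul_I (a b : ℝ) : ‖Complex.exp (I * a * b)‖ = 1 := by
  rw [mul_assoc, ← Complex.ofReal_mul, mul_comm]
  exact Complex.norm_exp_ofReal_mul_I _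

/-- Translation of the argument by the real number `t`. -/
def tau (r : ℝ≥0) : WA r →ₐ[ℂ] WA r :=
  hom (fun l => Complex.exp (I * (freqPairing ω l : ℝ) * t) • e r l)
    (fun l => by rw [norm_smul, norm_e, norm_cexp_mul_I, one_mul])
    (by simp [one_def]) fun l m => by
      rw [smul_mul_smul_comm, e_mul_e, ← Complex.exp_add, freqPairing_add]
      congr 2
      push_cast
      ring

variable {ω t}

@[simp] lemma tau_apply (x : WA r) (l : Idx) :
    tau ω t r x l = Complex.exp (I * (freqPairing ω l : ℝ) * t) * x l := by
  rw [← diag_apply (r := r) (r' := r) (fun l => Complex.exp (I * (freqPairing ω l : ℝ) * t)) 1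
    (fun l => by rw [norm_cexp_mul_I])]
  rfl

lemma tau_e (l : Idx) :
    tau ω t r (e r l) = Complex.exp (I * (freqPairing ω l : ℝ) * t) • e r l := hom_e _ _ _ _ l

lemma norm_tau_le (x : WA r) : ‖tau ω t r x‖ ≤ ‖x‖ := norm_hom_le _ _ _ _ x

lemma continuous_tau : Continuous (tau ω t r) := continuous_hom _ _ _ _

lemma incl_tau (h : r' ≤ r) (x : WA r) : incl h (tau ω t r x) = tau ω t r' (incl h x) :=
  ext fun l => by simp

end tau

section ev

variable (ω : ℕ+ → ℝ)

/-- Evaluation at a real point. -/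
def ev (ξ : ℝ) (r : ℝ≥0) : WA r →ₐ[ℂ] ℂ :=
  hom (fun l => Complex.exp (I * (freqPairing ω l : ℝ) * ξ))
    (fun l => by rw [norm_cexp_mul_I]; exact one_le_wt r l) (by simp) fun l m => by
      rw [← Complex.exp_add, freqPairing_add]
      congr 1
      push_cast
      ring

variable {ω} {ξ : ℝ}

lemma ev_eq_tsum (x : WA r) :
    ev ω ξ r x = ∑' l, x l * Complex.exp (I * (freqPairing ω l : ℝ) * ξ) := rfl

lemma ev_e (l : Idx) : ev ω ξ r (e r l) = Complex.exp (I * (freqPairing ω l : ℝ) * ξ) :=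
  hom_e _ _ _ _ l

lemma norm_ev_le (x : WA r) : ‖ev ω ξ r x‖ ≤ ‖x‖ := norm_hom_le _ _ _ _ x

lemma continuous_ev : Continuous (ev ω ξ r) := continuous_hom _ _ _ _

lemma ev_tau (t : ℝ) (x : WA r) : ev ω ξ r (tau ω t r x) = ev ω (ξ + t) r x := by
  rw [ev_eq_tsum, ev_eq_tsum]
  refine tsum_congr fun l => ?_
  rw [tau_apply, mul_right_comm, ← Complex.exp_add, mul_comm]
  congr 2
  push_cast
  ring

end ev

/-- The family of coefficients of the complex conjugate function. -/
def conjHom (r : ℝ≥0) : WA r →+* WA r :=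
  let σ : WA r →+ WA r :=
    { toFun := fun x => mk (fun l => conj (x (-l))) (by
        refine ((Equiv.neg Idx).summable_iff.2 x.summable).congr fun l => ?_
        simp)
      map_zero' := ext fun l => by simp
      map_add' := fun x y => ext fun l => by simp }
  have hn : ∀ x, ‖σ x‖ = ‖x‖ := fun x => by
    rw [norm_def, norm_def, ← (Equiv.neg Idx).tsum_eq]
    simp [σ]
  have hc : Continuous σ := AddMonoidHomClass.continuous_of_bound σ 1 fun x => by simp [hn]
  have he : ∀ (c : ℂ) l, σ (c • e r l) = conj c • e r (-l) := fun c l => ext fun k => by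
    simp only [σ, AddMonoidHom.coe_mk, ZeroHom.coe_mk, mk_apply, smul_apply, map_mul, e_apply]
    congr 1
    by_cases h : k = -l
    · simp [h]
    · rw [Pi.single_eq_of_ne h, Pi.single_eq_of_ne (fun h' => h (by rw [← h', neg_neg])), map_zero]
  { σ with
    map_one' := by
      have := he 1 0
      simpa [one_def] using this
    -- Conjugation is only conjugate-linear, so extensionality for complex-linear maps does not
    -- apply. Additive maps are compared on all scalar multiples of basis elements, first in the
    -- right factor and then in the left.
    map_mul' := fun x y => by
      have h1 : ∀ (c : ℂ) l y, σ ((c • e r l) * y) = σ (c • e r l) * σ y := fun c l y => by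
        have : σ.comp (AddMonoidHom.mulLeft (c • e r l)) =
            (AddMonoidHom.mulLeft (σ (c • e r l))).comp σ := by
          refine addHom_ext (hc.comp (continuous_const.mul continuous_id))
            (continuous_const.mul hc) fun d m => ?_
          simp only [AddMonoidHom.comp_apply, AddMonoidHom.coe_mulLeft]
          rw [smul_mul_smul_comm, e_mul_e, he, he, he, smul_mul_smul_comm, e_mul_e, map_mul,
            neg_add]
        exact DFunLike.congr_fun this y
      have : σ.comp (AddMonoidHom.mulRight y) = (AddMonoidHom.mulRight (σ y)).comp σ := by
        refine addHom_ext (hc.comp (continuous_id.mul continuous_const))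
            (hc.mul continuous_const) fun d m => ?_
        simp only [AddMonoidHom.comp_apply, AddMonoidHom.coe_mulRight]
        exact h1 d m y
      exact DFunLike.congr_fun this x }

@[simp] lemma conjHom_apply (x : WA r) (l : Idx) : conjHom r x l = conj (x (-l)) := rfl

lemma norm_conjHom (x : WA r) : ‖conjHom r x‖ = ‖x‖ := by
  rw [norm_def, norm_def, ← (Equiv.neg Idx).tsum_eq]
  simp

lemma continuous_conjHom : Continuous (conjHom r) :=
  AddMonoidHomClass.continuous_of_bound (conjHom r) 1 fun x => by simp [norm_conjHom]

@[simp] lemma conjHom_smul (c : ℂ) (x : WA r) : conjHom r (c • x) = conj c • conjHom r x :=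
  ext fun l => by simp

lemma conjHom_e (l : Idx) : conjHom r (e r l) = e r (-l) := ext fun k => by
  simp only [conjHom_apply, e_apply]
  by_cases h : k = -l
  · simp [h]
  · rw [Pi.single_eq_of_ne h, Pi.single_eq_of_ne (fun h' => h (by rw [← h', neg_neg])), map_zero]

lemma conjHom_incl (h : r' ≤ r) (x : WA r) : conjHom r' (incl h x) = incl h (conjHom r x) :=
  ext fun l => by simp

lemma conjHom_tau {ω : ℕ+ → ℝ} {t : ℝ} (x : WA r) :
    conjHom r (tau ω t r x) = tau ω t r (conjHom r x) := ext fun l => by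
  simp [← Complex.exp_conj]

lemma conj_ev {ω : ℕ+ → ℝ} {ξ : ℝ} (x : WA r) : conj (ev ω ξ r x) = ev ω ξ r (conjHom r x) := by
  rw [ev_eq_tsum, ev_eq_tsum, Complex.conj_tsum, ← (Equiv.neg Idx).tsum_eq]
  refine tsum_congr fun l => ?_
  simp [← Complex.exp_conj]

/-- Real-valuedness on the real line, in terms of coefficients. -/
def IsReal (x : WA r) : Prop := conjHom r x = x

namespace IsReal

variable {x y : WA r}

lemma add (hx : IsReal x) (hy : IsReal y) : IsReal (x + y) := by
  unfold IsReal at *; rw [map_add, hx, hy]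
lemma sub (hx : IsReal x) (hy : IsReal y) : IsReal (x - y) := by
  unfold IsReal at *; rw [map_sub, hx, hy]
lemma neg (hx : IsReal x) : IsReal (-x) := by
  unfold IsReal at *; rw [map_neg, hx]
lemma mul (hx : IsReal x) (hy : IsReal y) : IsReal (x * y) := by
  unfold IsReal at *; rw [map_mul, hx, hy]
lemma one : IsReal (1 : WA r) := map_one _
lemma zero : IsReal (0 : WA r) := map_zero _
lemma smul (hx : IsReal x) (c : ℝ) : IsReal ((c : ℂ) • x) := by
  unfold IsReal at *; rw [conjHom_smul, hx, Complex.conj_ofReal]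
lemma tau (hx : IsReal x) {ω : ℕ+ → ℝ} {t : ℝ} : IsReal (tau ω t r x) := by
  unfold IsReal at *; rw [conjHom_tau, hx]
lemma incl (hx : IsReal x) (h : r' ≤ r) : IsReal (incl h x) := by
  unfold IsReal at *; rw [conjHom_incl, hx]
-- The conjugate of an inverse of a real element is again an inverse, and inverses are unique.
lemma inv (hx : IsReal x) (h : x * y = 1) : IsReal y := by
  unfold IsReal at *
  have h1 : x * conjHom r y = 1 := by rw [← hx, ← map_mul, h, map_one]
  calc conjHom r y = (x * y) * conjHom r y := by rw [h, one_mul]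
    _ = y * (x * conjHom r y) := by ring
    _ = y := by rw [h1, mul_one]
lemma im_ev (hx : IsReal x) (ω : ℕ+ → ℝ) (ξ : ℝ) : (ev ω ξ r x).im = 0 := by
  rw [← Complex.conj_eq_iff_im, conj_ev, hx]
lemma im_coeff_zero (hx : IsReal x) : (x 0).im = 0 := by
  have h := congrArg (fun z : WA r => z 0) hx
  simp only [conjHom_apply, neg_zero] at h
  exact Complex.conj_eq_iff_im.1 h
lemma coeff_zero (hx : IsReal x) : x 0 = ((x 0).re : ℂ) :=
  Complex.ext (by simp) (by simp [hx.im_coeff_zero])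
lemma ev_eq (hx : IsReal x) (ω : ℕ+ → ℝ) (ξ : ℝ) : ev ω ξ r x = ((ev ω ξ r x).re : ℂ) :=
  Complex.ext (by simp) (by simp [hx.im_ev])

end IsReal

lemma isReal_of_tendsto {ι : Type*} {l : Filter ι} [l.NeBot] {s : ι → WA r} {x : WA r}
    (h : Filter.Tendsto s l (nhds x)) (hs : ∀ i, IsReal (s i)) : IsReal x :=
  (tendsto_nhds_unique ((continuous_conjHom.tendsto x).comp h) (h.congr fun i => (hs i).symm))

/-- An element near the unit is invertible, with an explicit bound. -/
lemma exists_inv {x : WA r} (hx : ‖x - 1‖ ≤ 1 / 2) : ∃ y, x * y = 1 ∧ ‖y‖ ≤ 2 := by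
  have h1 : ‖1 - x‖ < 1 := by rw [norm_sub_rev]; linarith
  refine ⟨∑' n, (1 - x) ^ n, ?_, ?_⟩
  · simpa using mul_neg_geom_series (1 - x) h1
  · refine tsum_of_norm_bounded hasSum_geometric_two fun n => ?_
    refine (norm_pow_le _ _).trans ?_
    rw [norm_sub_rev]
    gcongr

end WA

/-! ### Cauchy estimates in one complex variable. -/

section Cauchy

variable {B : Type*} [NormedAddCommGroup B] [NormedSpace ℂ B]

lemma norm_deriv_le_of_bounded {φ : ℂ → B} {T d ρ : ℝ} {z : ℂ}
    (hφ : DifferentiableOn ℂ φ (Metric.ball 0 T)) (hd : ∀ w ∈ Metric.ball (0 : ℂ) T, ‖φ w‖ ≤ d)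
    (hρ : 0 < ρ) (hz : ‖z‖ + ρ < T) : ‖deriv φ z‖ ≤ d / ρ := by
  have hsub : Metric.closedBall z ρ ⊆ Metric.ball 0 T := fun w hw => by
    rw [mem_closedBall_iff_norm] at hw
    rw [mem_ball_zero_iff]
    calc ‖w‖ = ‖z + (w - z)‖ := by congr 1; ring
      _ ≤ ‖z‖ + ‖w - z‖ := norm_add_le _ _
      _ < T := by linarith
  refine Complex.norm_deriv_le_of_forall_mem_sphere_norm_le hρ
    (DifferentiableOn.diffContOnCl ?_) fun w hw => hd w (hsub (Metric.sphere_subset_closedBall hw))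
  rw [closure_ball z hρ.ne']
  exact hφ.mono hsub

/-- For T ≥ 4 the disc of radius T/4 about any point of the closed unit disc stays inside the ball,
so the derivative is at most 4d/T there. -/
lemma norm_sub_le_of_bounded {φ : ℂ → B} {T d : ℝ} (hT : 4 ≤ T)
    (hφ : DifferentiableOn ℂ φ (Metric.ball 0 T))
    (hd : ∀ w ∈ Metric.ball (0 : ℂ) T, ‖φ w‖ ≤ d) : ‖φ 1 - φ 0‖ ≤ 4 * d / T := by
  have h := Convex.norm_image_sub_le_of_norm_deriv_le (𝕜 := ℂ) (f := φ) (x := 0) (y := 1)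
    (s := Metric.closedBall 0 1) (C := 4 * d / T) (fun z hz => ?_) (fun z hz => ?_)
    (convex_closedBall 0 1) (by simp) (by simp)
  · simpa using h
  · rw [mem_closedBall_zero_iff] at hz
    refine hφ.differentiableAt (Metric.isOpen_ball.mem_nhds ?_)
    rw [mem_ball_zero_iff]; linarith
  · rw [mem_closedBall_zero_iff] at hz
    refine (norm_deriv_le_of_bounded (ρ := T / 4) hφ hd (by linarith) (by linarith)).trans_eq ?_
    field_simp

lemma norm_sub_sub_deriv_le_of_bounded [CompleteSpace B] {φ : ℂ → B} {T d : ℝ} (hT : 4 ≤ T)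
    (hφ : DifferentiableOn ℂ φ (Metric.ball 0 T))
    (hd : ∀ w ∈ Metric.ball (0 : ℂ) T, ‖φ w‖ ≤ d) :
    ‖φ 1 - φ 0 - deriv φ 0‖ ≤ 16 * d / T ^ 2 := by
  have hT0 : 0 < T := by linarith
  -- Two Cauchy estimates with radius T/4 each: the first bounds φ' on the ball of radius 3T/4, the
  -- second bounds φ'' on the unit disc by 16d/T².
  have hd1 : DifferentiableOn ℂ (deriv φ) (Metric.ball 0 (3 * T / 4)) :=
    (hφ.deriv Metric.isOpen_ball).mono (Metric.ball_subset_ball (by linarith))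
  have hb1 : ∀ w ∈ Metric.ball (0 : ℂ) (3 * T / 4), ‖deriv φ w‖ ≤ d / (T / 4) := fun w hw => by
    rw [mem_ball_zero_iff] at hw
    exact norm_deriv_le_of_bounded hφ hd (by linarith) (by linarith)
  have hmem : ∀ z ∈ Metric.closedBall (0 : ℂ) 1, z ∈ Metric.ball (0 : ℂ) (3 * T / 4) :=
    fun z hz => by
      rw [mem_closedBall_zero_iff] at hz
      rw [mem_ball_zero_iff]; linarith
  have hmem' : ∀ z ∈ Metric.closedBall (0 : ℂ) 1, z ∈ Metric.ball (0 : ℂ) T := fun z hz =>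
    Metric.ball_subset_ball (by linarith) (hmem z hz)
  have h2 : ∀ z ∈ Metric.closedBall (0 : ℂ) 1, ‖deriv φ z - deriv φ 0‖ ≤ 16 * d / T ^ 2 := by
    intro z hz
    have h := Convex.norm_image_sub_le_of_norm_deriv_le (𝕜 := ℂ) (f := deriv φ) (x := 0) (y := z)
      (s := Metric.closedBall 0 1) (C := 16 * d / T ^ 2) (fun z hz => ?_) (fun z hz => ?_)
      (convex_closedBall 0 1) (by simp) hz
    · rw [sub_zero] at h
      rw [mem_closedBall_zero_iff] at hz
      have h0 : 0 ≤ 16 * d / T ^ 2 := by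
        have := (norm_nonneg _).trans (hd 0 (by simpa using hT0))
        positivity
      exact h.trans (mul_le_of_le_one_right h0 hz)
    · exact hd1.differentiableAt (Metric.isOpen_ball.mem_nhds (hmem z hz))
    · rw [mem_closedBall_zero_iff] at hz
      refine (norm_deriv_le_of_bounded (ρ := T / 4) hd1 hb1 (by linarith) (by linarith)).trans_eq ?_
      field_simp
      norm_num
  have h := Convex.norm_image_sub_le_of_norm_deriv_le (𝕜 := ℂ) (f := fun z => φ z - z • deriv φ 0)
    (x := 0) (y := 1) (s := Metric.closedBall 0 1) (C := 16 * d / T ^ 2) (fun z hz => ?_)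
    (fun z hz => ?_) (convex_closedBall 0 1) (by simp) (by simp)
  · simp only [one_smul, zero_smul, sub_zero, norm_one, mul_one] at h
    rwa [sub_right_comm] at h
  · exact (hφ.differentiableAt (Metric.isOpen_ball.mem_nhds (hmem' z hz))).sub
      (differentiableAt_id.smul_const _)
  · have h3 : HasDerivAt (fun z => φ z - z • deriv φ 0) (deriv φ z - (1 : ℂ) • deriv φ 0) z :=
      (hφ.differentiableAt (Metric.isOpen_ball.mem_nhds (hmem' z hz))).hasDerivAt.sub
        ((hasDerivAt_id z).smul_const _)
    rw [h3.deriv, one_smul]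
    exact h2 z hz

end Cauchy

/-! ### Fourier–Taylor coefficients of the perturbation. -/

/-- The coefficient family `a` of `∑ a (l, k) y ^ k e ^ (i (ω, l) x)` has norm at most `d` on the
polydisc of radii `R`, `s`. -/
structure GermBound (a : Idx × ℕ → ℂ) (R : ℝ≥0) (s d : ℝ) : Prop where
  summable : Summable fun j => ‖a j‖ * (s ^ j.2 * wt R j.1)
  le : ∑' j, ‖a j‖ * (s ^ j.2 * wt R j.1) ≤ d

/-- The coefficients of the derivative in `x`. -/
def germDx (ω : ℕ+ → ℝ) (a : Idx × ℕ → ℂ) (j : Idx × ℕ) : ℂ := I * freqPairing ω j.1 * a j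

/-- The coefficients of the derivative in `y`. -/
def germDy (a : Idx × ℕ → ℂ) (j : Idx × ℕ) : ℂ := ((j.2 : ℂ) + 1) * a (j.1, j.2 + 1)

namespace GermBound

variable {a : Idx × ℕ → ℂ} {R R' : ℝ≥0} {s s' d ρ : ℝ}

lemma nonneg (h : GermBound a R s d) (hs : 0 ≤ s) : 0 ≤ d :=
  (tsum_nonneg fun j => by have := wt_pos R j.1; positivity).trans h.le

lemma of_le {b : Idx × ℕ → ℂ} {C : ℝ} (h : GermBound a R s d) (hs' : 0 ≤ s') (hC : 0 ≤ C)
    (hb : ∀ j, ‖b j‖ * (s' ^ j.2 * wt R' j.1) ≤ C * (‖a j‖ * (s ^ j.2 * wt R j.1))) :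
    GermBound b R' s' (C * d) := by
  have hs : Summable fun j => ‖b j‖ * (s' ^ j.2 * wt R' j.1) :=
    Summable.of_nonneg_of_le (fun j => by have := wt_pos R' j.1; positivity) hb
      (h.summable.mul_left C)
  refine ⟨hs, (hs.tsum_le_tsum hb (h.summable.mul_left C)).trans ?_⟩
  rw [tsum_mul_left]
  exact mul_le_mul_of_nonneg_left h.le hC

lemma mono (h : GermBound a R s d) (hR : R' ≤ R) (hs : s' ≤ s) (hs' : 0 ≤ s') :
    GermBound a R' s' d := by
  have := h.of_le (b := a) (R' := R') (s' := s') (C := 1) hs' zero_le_one fun j => by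
    have := wt_mono hR j.1
    have := wt_pos R' j.1
    have := hs'.trans hs
    rw [one_mul]
    gcongr
  rwa [one_mul] at this

/-- The multiplier satisfies ρ|(ω, l)| ≤ ρ‖l‖ ≤ e^(ρ‖l‖), and the last factor is paid for by the
narrower strip. -/
lemma dx {ω : ℕ+ → ℝ} (hω : ∀ i, |ω i| ≤ 1) (h : GermBound a R s d) (hs : 0 ≤ s) (hρ : 0 < ρ)
    (hR : R' + ρ ≤ R) : GermBound (germDx ω a) R' s (ρ⁻¹ * d) := by
  refine h.of_le hs (by positivity) fun j => ?_
  have h1 : |freqPairing ω j.1| * wt R' j.1 ≤ ρ⁻¹ * wt R j.1 := by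
    have h2 := abs_freqPairing_le hω j.1
    have h0 := indexWeight_nonneg j.1
    have h3 : ρ * indexWeight j.1 ≤ Real.exp (ρ * indexWeight j.1) :=
      (by linarith [Real.add_one_le_exp (ρ * indexWeight j.1)])
    have h4 : Real.exp (ρ * indexWeight j.1) * wt R' j.1 ≤ wt R j.1 := by
      rw [wt, wt, ← Real.exp_add, ← add_mul]
      exact Real.exp_le_exp.2 (mul_le_mul_of_nonneg_right (by linarith) h0)
    rw [inv_mul_eq_div, le_div_iff₀ hρ]
    have := wt_pos R' j.1
    calc |freqPairing ω j.1| * wt R' j.1 * ρ ≤ indexWeight j.1 * wt R' j.1 * ρ := by gcongr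
      _ = ρ * indexWeight j.1 * wt R' j.1 := by ring
      _ ≤ _ := by gcongr
      _ ≤ _ := h4
  have h5 : ‖germDx ω a j‖ = |freqPairing ω j.1| * ‖a j‖ := by
    simp [germDx]
  rw [h5]
  calc |freqPairing ω j.1| * ‖a j‖ * (s ^ j.2 * wt R' j.1)
      = (|freqPairing ω j.1| * wt R' j.1) * (‖a j‖ * s ^ j.2) := by ring
    _ ≤ (ρ⁻¹ * wt R j.1) * (‖a j‖ * s ^ j.2) := by gcongr
    _ = _ := by ring

/-- The left side times ρ is the first-order term in the binomial expansion of (s' + ρ)^(k+1). -/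
lemma succ_mul_pow_le (hs' : 0 ≤ s') (hρ : 0 < ρ) (hs : s' + ρ ≤ s) (k : ℕ) :
    ((k : ℝ) + 1) * s' ^ k ≤ ρ⁻¹ * s ^ (k + 1) := by
  rw [inv_mul_eq_div, le_div_iff₀ hρ]
  have h1 : s' ^ (k + 1) + (k + 1 : ℕ) * s' ^ k * ρ ≤ (s' + ρ) ^ (k + 1) := by
    simpa using pow_add_mul_le_add_pow_of_sq_nonneg (a := s') (b := ρ) hs' (sq_nonneg _)
      (sq_nonneg _) (by linarith) (k + 1)
  have h2 : (s' + ρ) ^ (k + 1) ≤ s ^ (k + 1) := by gcongr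
  have h3 : 0 ≤ s' ^ (k + 1) := by positivity
  push_cast at h1
  linarith

lemma dy (h : GermBound a R s d) (hs' : 0 ≤ s') (hρ : 0 < ρ)
    (hs : s' + ρ ≤ s) : GermBound (germDy a) R s' (ρ⁻¹ * d) := by
  have hinj : Function.Injective fun j : Idx × ℕ => (j.1, j.2 + 1) := fun j k hjk => by
    simp only [Prod.mk.injEq, add_left_inj] at hjk
    exact Prod.ext hjk.1 hjk.2
  -- Lowering the degree by one selects a subfamily of the original sum; the factor s restores the
  -- missing power of the radius.
  have h1 : GermBound (fun j => a (j.1, j.2 + 1) * s) R s d := by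
    have hs0 : 0 ≤ s := by linarith
    have he : ∀ j : Idx × ℕ, ‖a (j.1, j.2 + 1) * s‖ * (s ^ j.2 * wt R j.1) =
        (fun j => ‖a j‖ * (s ^ j.2 * wt R j.1)) (j.1, j.2 + 1) := fun j => by
      simp [abs_of_nonneg hs0]; ring
    refine ⟨(h.summable.comp_injective hinj).congr fun j => (he j).symm, ?_⟩
    rw [tsum_congr he]
    refine le_trans ?_ h.le
    refine (h.summable.comp_injective hinj).tsum_le_tsum_of_inj _ hinj
      (fun j _ => by have := wt_pos R j.1; positivity) (fun j => le_rfl) h.summable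
  refine h1.of_le hs' (by positivity) fun j => ?_
  have h2 := succ_mul_pow_le hs' hρ hs j.2
  have h3 : ‖germDy a j‖ = (j.2 + 1) * ‖a (j.1, j.2 + 1)‖ := by
    rw [germDy, norm_mul]; congr 1; exact_mod_cast Complex.norm_natCast (j.2 + 1)
  have hs0 : 0 ≤ s := by linarith
  have := wt_pos R j.1
  rw [h3, norm_mul, Complex.norm_real, Real.norm_of_nonneg hs0]
  calc (j.2 + 1) * ‖a (j.1, j.2 + 1)‖ * (s' ^ j.2 * wt R j.1)
      = ((j.2 + 1) * s' ^ j.2) * (‖a (j.1, j.2 + 1)‖ * wt R j.1) := by ring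
    _ ≤ (ρ⁻¹ * s ^ (j.2 + 1)) * (‖a (j.1, j.2 + 1)‖ * wt R j.1) := by gcongr
    _ = _ := by ring

end GermBound

/-! ### Substitution of a nearby curve into the perturbation. -/

namespace WA

variable {r r' : ℝ≥0}

/-- A summand of the substitution. -/
def compTerm (ω : ℕ+ → ℝ) (a : Idx × ℕ → ℂ) (u w : WA r) (j : Idx × ℕ) : WA r :=
  a j • (e r j.1 * NormedSpace.exp ((I * freqPairing ω j.1) • u) * w ^ j.2)

/-- The substitution `f (x + u x, w x)` for `f (x, y) = ∑ a (l, k) y ^ k e ^ (i (ω, l) x)`. -/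
def comp (ω : ℕ+ → ℝ) (a : Idx × ℕ → ℂ) (u w : WA r) : WA r := ∑' j, compTerm ω a u w j

variable {ω : ℕ+ → ℝ} {a : Idx × ℕ → ℂ} {u w h k : WA r} {R : ℝ≥0} {s d : ℝ}

/-- The exponential of i(ω, l)u costs at most e^(‖l‖‖u‖), so substituting x + u acts on the weights
like widening the strip by ‖u‖. -/
lemma norm_compTerm_le (hω : ∀ i, |ω i| ≤ 1) (hu : r + ‖u‖ ≤ R) (hw : ‖w‖ ≤ s) (j : Idx × ℕ) :
    ‖compTerm ω a u w j‖ ≤ ‖a j‖ * (s ^ j.2 * wt R j.1) := by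
  rw [compTerm, norm_smul]
  gcongr
  have h1 : ‖NormedSpace.exp ((I * freqPairing ω j.1) • u)‖ ≤
      Real.exp (indexWeight j.1 * ‖u‖) := by
    refine (norm_exp_le _).trans (Real.exp_le_exp.2 ?_)
    rw [norm_smul]
    gcongr
    simpa using abs_freqPairing_le hω j.1
  have h2 : wt r j.1 * Real.exp (indexWeight j.1 * ‖u‖) ≤ wt R j.1 := by
    rw [wt, wt, ← Real.exp_add]
    refine Real.exp_le_exp.2 ?_
    nlinarith [mul_le_mul_of_nonneg_left hu (indexWeight_nonneg j.1)]
  calc ‖e r j.1 * NormedSpace.exp ((I * freqPairing ω j.1) • u) * w ^ j.2‖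
      ≤ ‖e r j.1‖ * ‖NormedSpace.exp ((I * freqPairing ω j.1) • u)‖ * ‖w‖ ^ j.2 := by
        refine (norm_mul_le _ _).trans ?_
        gcongr
        · exact norm_mul_le _ _
        · exact norm_pow_le _ _
    _ ≤ wt r j.1 * Real.exp (indexWeight j.1 * ‖u‖) * s ^ j.2 := by
        rw [norm_e]
        have := wt_pos r j.1
        gcongr
    _ ≤ wt R j.1 * s ^ j.2 := by
        gcongr
        exact pow_nonneg ((norm_nonneg _).trans hw) _
    _ = _ := mul_comm _ _

lemma norm_comp_le (hω : ∀ i, |ω i| ≤ 1) (ha : GermBound a R s d) (hu : r + ‖u‖ ≤ R)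
    (hw : ‖w‖ ≤ s) : ‖comp ω a u w‖ ≤ d :=
  (tsum_of_norm_bounded ha.summable.hasSum (norm_compTerm_le hω hu hw)).trans ha.le

lemma hasSum_comp (hω : ∀ i, |ω i| ≤ 1) (ha : GermBound a R s d) (hu : r + ‖u‖ ≤ R)
    (hw : ‖w‖ ≤ s) : HasSum (compTerm ω a u w) (comp ω a u w) :=
  (Summable.of_norm_bounded ha.summable (norm_compTerm_le hω hu hw)).hasSum

lemma incl_comp (hω : ∀ i, |ω i| ≤ 1) (ha : GermBound a R s d) (hu : r + ‖u‖ ≤ R)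
    (hw : ‖w‖ ≤ s) (hr : r' ≤ r) :
    incl hr (comp ω a u w) = comp ω a (incl hr u) (incl hr w) := by
  have h1 := (hasSum_comp hω ha hu hw).map (incl hr) (continuous_incl hr)
  rw [← h1.tsum_eq, comp]
  refine tsum_congr fun j => ?_
  simp only [Function.comp, compTerm, map_smul, map_mul, incl_e, map_pow,
    NormedSpace.map_exp (incl hr) (continuous_incl hr)]

/-- Evaluation is a continuous algebra homomorphism, so it passes through the series, the powers and
the exponential. This ties the algebraic substitution to values of functions. -/
lemma ev_comp (hω : ∀ i, |ω i| ≤ 1) (ha : GermBound a R s d) (hu : r + ‖u‖ ≤ R)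
    (hw : ‖w‖ ≤ s) (ξ : ℝ) :
    HasSum (fun j : Idx × ℕ => a j * (ev ω ξ r w) ^ j.2 *
      Complex.exp (I * freqPairing ω j.1 * (ξ + ev ω ξ r u))) (ev ω ξ r (comp ω a u w)) := by
  have h1 := (hasSum_comp hω ha hu hw).map (ev ω ξ r) continuous_ev
  refine h1.congr_fun fun j => ?_
  simp only [Function.comp, compTerm, map_smul, map_mul, map_pow, ev_e,
    NormedSpace.map_exp (ev ω ξ r) continuous_ev, ← Complex.exp_eq_exp_ℂ, smul_eq_mul]
  rw [mul_add, Complex.exp_add]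
  ring

/-- Coefficients of a function that is real at real points. -/
def RealGerm (a : Idx × ℕ → ℂ) : Prop := ∀ l k, a (-l, k) = conj (a (l, k))

lemma RealGerm.dx (h : RealGerm a) : RealGerm (germDx ω a) := fun l k => by
  simp [germDx, h l k]

lemma RealGerm.dy (h : RealGerm a) : RealGerm (germDy a) := fun l k => by
  simp [germDy, h l (k + 1)]

lemma isReal_comp (hω : ∀ i, |ω i| ≤ 1) (ha : GermBound a R s d) (hu : r + ‖u‖ ≤ R)
    (hw : ‖w‖ ≤ s) (hr : RealGerm a) (hur : IsReal u) (hwr : IsReal w) :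
    IsReal (comp ω a u w) := by
  have h1 := (hasSum_comp hω ha hu hw).map (conjHom r) continuous_conjHom
  rw [IsReal, ← h1.tsum_eq, comp,
    ← (Equiv.prodCongr (Equiv.neg Idx) (Equiv.refl ℕ)).tsum_eq (compTerm ω a u w)]
  refine tsum_congr fun j => ?_
  unfold IsReal at hur hwr
  simp only [Function.comp, compTerm, conjHom_smul, map_mul, map_pow, conjHom_e, hur, hwr,
    NormedSpace.map_exp (conjHom r) continuous_conjHom, Complex.conj_I, Complex.conj_ofReal,
    Equiv.prodCongr_apply, Prod.map, Equiv.neg_apply, Equiv.refl_apply, hr j.1 j.2,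
    freqPairing_neg, Complex.ofReal_neg, mul_neg, neg_mul]

/-- Translation multiplies each basis character by a phase, and that phase is the exponential of the
constant t added to u. -/
lemma tau_comp (hω : ∀ i, |ω i| ≤ 1) (ha : GermBound a R s d) (hu : r + ‖u‖ ≤ R)
    (hw : ‖w‖ ≤ s) (t : ℝ) :
    tau ω t r (comp ω a u w) = comp ω a (tau ω t r u + (t : ℂ) • 1) (tau ω t r w) := by
  have h1 := (hasSum_comp hω ha hu hw).map (tau ω t r) continuous_tau
  rw [← h1.tsum_eq, comp]
  refine tsum_congr fun j => ?_
  have h2 : NormedSpace.exp ((I * freqPairing ω j.1) • (t : ℂ) • (1 : WA r)) =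
      Complex.exp (I * freqPairing ω j.1 * t) • 1 := by
    rw [smul_smul, ← Algebra.algebraMap_eq_smul_one, ← Algebra.algebraMap_eq_smul_one,
      Complex.exp_eq_exp_ℂ]
    exact (NormedSpace.algebraMap_exp_comm (𝕂 := ℂ) (𝔸 := WA r) _).symm
  simp only [Function.comp, compTerm, map_smul, map_mul, tau_e, map_pow,
    NormedSpace.map_exp (tau ω t r) continuous_tau]
  rw [smul_add, NormedSpace.exp_add_of_commute (Commute.all _ _), h2]
  simp only [smul_mul_assoc, mul_smul_comm, mul_one]

lemma hasDerivAt_compTerm (u w h k : WA r) (j : Idx × ℕ) (t : ℂ) :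
    HasDerivAt (fun t : ℂ => compTerm ω a (u + t • h) (w + t • k) j)
      (a j • (e r j.1 * (NormedSpace.exp ((I * freqPairing ω j.1) • (u + t • h)) *
          ((I * freqPairing ω j.1) • h)) * (w + t • k) ^ j.2 +
        e r j.1 * NormedSpace.exp ((I * freqPairing ω j.1) • (u + t • h)) *
          ((j.2 : WA r) * (w + t • k) ^ (j.2 - 1) * k))) t := by
  have hl : ∀ x y : WA r, HasDerivAt (fun t : ℂ => x + t • y) y t := fun x y => by
    simpa using ((hasDerivAt_id t).smul_const y).const_add x
  have h0 : HasDerivAt (fun t : ℂ => (I * (freqPairing ω j.1 : ℂ)) • (u + t • h))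
      ((I * freqPairing ω j.1) • h) t := (hl u h).const_smul (I * (freqPairing ω j.1 : ℂ))
  have h1 : HasDerivAt (fun t : ℂ => NormedSpace.exp ((I * freqPairing ω j.1) • (u + t • h)))
      (NormedSpace.exp ((I * freqPairing ω j.1) • (u + t • h)) *
        ((I * freqPairing ω j.1) • h)) t := by
    have := (hasFDerivAt_exp (𝕂 := ℂ)
      (x := (I * freqPairing ω j.1) • (u + t • h))).comp_hasDerivAt t h0
    simpa [Function.comp_def] using this
  have h2 := (hl w k).pow j.2
  exact ((h1.const_mul (e r j.1)).mul h2).const_smul (a j)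

end WA

/-! ### Differentiability of the substitution and the chain rule. -/

namespace WA

variable {r r' : ℝ≥0} {ω : ℕ+ → ℝ} {a : Idx × ℕ → ℂ} {u w h k : WA r} {R : ℝ≥0} {s d η ν : ℝ}

/-- The differential of the substitution. -/
def dcomp (ω : ℕ+ → ℝ) (a : Idx × ℕ → ℂ) (u w h k : WA r) : WA r :=
  comp ω (germDx ω a) u w * h + comp ω (germDy a) u w * k

lemma hasSum_dcomp (hω : ∀ i, |ω i| ≤ 1) (ha : GermBound a R s d) (hη : 0 < η)
    (hu : r + ‖u‖ + η ≤ R) (hw : ‖w‖ + η ≤ s) :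
    HasSum (fun j => a j • (e r j.1 * (NormedSpace.exp ((I * freqPairing ω j.1) • u) *
          ((I * freqPairing ω j.1) • h)) * w ^ j.2 +
        e r j.1 * NormedSpace.exp ((I * freqPairing ω j.1) • u) *
          ((j.2 : WA r) * w ^ (j.2 - 1) * k))) (dcomp ω a u w h k) := by
  have hs : 0 ≤ s := by linarith [norm_nonneg w]
  have hx := hasSum_comp (u := u) (w := w) hω
    (ha.dx hω hs hη (R' := r + ‖u‖₊) (by push_cast; exact hu)) (by simp) (by linarith)
  have hy := hasSum_comp (u := u) (w := w) hω (ha.dy (norm_nonneg w) hη hw)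
    (by linarith) le_rfl
  have hinj : Function.Injective fun j : Idx × ℕ => (j.1, j.2 + 1) := fun j k hjk => by
    simp only [Prod.mk.injEq, add_left_inj] at hjk
    exact Prod.ext hjk.1 hjk.2
  -- Reindexing by k ↦ k + 1 misses only the terms of degree zero in y. These vanish through the
  -- factor k, whatever the truncated exponent k − 1 means there.
  have hy' : HasSum (fun j : Idx × ℕ => a j • (e r j.1 *
      NormedSpace.exp ((I * freqPairing ω j.1) • u) * ((j.2 : WA r) * w ^ (j.2 - 1))))
      (comp ω (germDy a) u w) := by
    rw [← hinj.hasSum_iff]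
    · refine hy.congr_fun fun j => ?_
      simp only [Function.comp, compTerm, germDy, Nat.add_sub_cancel]
      have h1 : ((j.2 + 1 : ℕ) : WA r) = ((j.2 : ℂ) + 1) • 1 := by
        rw [← Nat.cast_succ, Nat.cast_smul_eq_nsmul, nsmul_one]
      rw [h1]
      simp only [smul_mul_assoc, one_mul, mul_smul_comm, smul_smul, mul_comm (a _)]
    · rintro ⟨l, n⟩ hn
      cases n with
      | zero => simp
      | succ n => exact absurd ⟨(l, n), rfl⟩ hn
  refine ((hx.mul_right h).add (hy'.mul_right k)).congr_fun fun j => ?_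
  simp only [compTerm, germDx, mul_smul, smul_mul_assoc, mul_smul_comm, smul_add]
  congr 1
  · rw [smul_comm (a j) I, smul_comm (a j) (freqPairing ω j.1 : ℂ)]
    congr 3
    ring
  · congr 1
    ring

/-- For |t| < η/ν the displacement by t times a direction of norm at most ν is less than the margin
η. -/
lemma line_bounds (hω : ∀ i, |ω i| ≤ 1)
    (hu : r + ‖u‖ + η ≤ R) (hw : ‖w‖ + η ≤ s) (hν : 0 < ν) (hh : ‖h‖ ≤ ν) (hk : ‖k‖ ≤ ν)
    {t : ℂ} (ht : t ∈ Metric.ball (0 : ℂ) (η / ν)) (j : Idx × ℕ) :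
    ‖compTerm ω a (u + t • h) (w + t • k) j‖ ≤ ‖a j‖ * (s ^ j.2 * wt R j.1) := by
  rw [mem_ball_zero_iff, lt_div_iff₀ hν] at ht
  have hb : ∀ x y : WA r, ‖y‖ ≤ ν → ‖x + t • y‖ ≤ ‖x‖ + η := fun x y hy => by
    refine (norm_add_le _ _).trans (add_le_add_right ?_ _)
    rw [norm_smul]
    exact (mul_le_mul_of_nonneg_left hy (norm_nonneg _)).trans ht.le
  exact norm_compTerm_le hω (by linarith [hb u h hh]) (by linarith [hb w k hk]) j

/-- On a complex line the summands are holomorphic with a t-independent summable majorant, so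
termwise differentiation is allowed. Cauchy estimates on such lines then yield both the Lipschitz
and the second-order bound without computing higher derivatives. -/
lemma line_calculus (hω : ∀ i, |ω i| ≤ 1) (ha : GermBound a R s d) (hη : 0 < η)
    (hu : r + ‖u‖ + η ≤ R) (hw : ‖w‖ + η ≤ s) (hν : 0 < ν) (hh : ‖h‖ ≤ ν) (hk : ‖k‖ ≤ ν) :
    DifferentiableOn ℂ (fun t : ℂ => comp ω a (u + t • h) (w + t • k)) (Metric.ball 0 (η / ν)) ∧
    (∀ t ∈ Metric.ball (0 : ℂ) (η / ν), ‖comp ω a (u + t • h) (w + t • k)‖ ≤ d) ∧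
    deriv (fun t : ℂ => comp ω a (u + t • h) (w + t • k)) 0 = dcomp ω a u w h k := by
  have hd : ∀ j, DifferentiableOn ℂ (fun t : ℂ => compTerm ω a (u + t • h) (w + t • k) j)
      (Metric.ball 0 (η / ν)) :=
    fun j t _ => (hasDerivAt_compTerm u w h k j t).differentiableAt.differentiableWithinAt
  have hb := fun j t ht => line_bounds (a := a) hω hu hw hν hh hk (t := t) ht j
  refine ⟨Complex.differentiableOn_tsum_of_summable_norm ha.summable hd Metric.isOpen_ball hb,
    fun t ht => (tsum_of_norm_bounded ha.summable.hasSum fun j => hb j t ht).trans ha.le, ?_⟩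
  have h1 := Complex.hasSum_deriv_of_summable_norm ha.summable hd Metric.isOpen_ball hb
    (Metric.mem_ball_self (div_pos hη hν))
  refine h1.unique ((hasSum_dcomp hω ha hη hu hw).congr_fun fun j => ?_)
  rw [(hasDerivAt_compTerm u w h k j 0).deriv]
  simp

/-- Lipschitz estimate for the substitution. -/
lemma norm_comp_sub_le (hω : ∀ i, |ω i| ≤ 1) (ha : GermBound a R s d) (hη : 0 < η)
    (hu : r + ‖u‖ + η ≤ R) (hw : ‖w‖ + η ≤ s) (hν : 0 < ν) (hh : ‖h‖ ≤ ν) (hk : ‖k‖ ≤ ν)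
    (hνη : 4 * ν ≤ η) : ‖comp ω a (u + h) (w + k) - comp ω a u w‖ ≤ 4 * d * ν / η := by
  obtain ⟨h1, h2, -⟩ := line_calculus hω ha hη hu hw hν hh hk
  have h3 := norm_sub_le_of_bounded (by rwa [le_div_iff₀ hν]) h1 h2
  simp only [one_smul, zero_smul, add_zero] at h3
  refine h3.trans_eq ?_
  field_simp

/-- Second order Taylor estimate for the substitution. -/
lemma norm_comp_sub_sub_le (hω : ∀ i, |ω i| ≤ 1) (ha : GermBound a R s d) (hη : 0 < η)
    (hu : r + ‖u‖ + η ≤ R) (hw : ‖w‖ + η ≤ s) (hν : 0 < ν) (hh : ‖h‖ ≤ ν) (hk : ‖k‖ ≤ ν)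
    (hνη : 4 * ν ≤ η) :
    ‖comp ω a (u + h) (w + k) - comp ω a u w - dcomp ω a u w h k‖ ≤ 16 * d * ν ^ 2 / η ^ 2 := by
  obtain ⟨h1, h2, h3⟩ := line_calculus hω ha hη hu hw hν hh hk
  have h4 := norm_sub_sub_deriv_le_of_bounded (by rwa [le_div_iff₀ hν]) h1 h2
  rw [h3] at h4
  simp only [one_smul, zero_smul, add_zero] at h4
  refine h4.trans_eq ?_
  field_simp

/-- `du` is the derivative of `u`. -/
def IsDeriv (ω : ℕ+ → ℝ) (u : WA r) (du : WA r') : Prop := ∀ l, du l = I * freqPairing ω l * u l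

lemma IsDeriv.unique {du dv : WA r'} (h1 : IsDeriv ω u du) (h2 : IsDeriv ω u dv) : du = dv :=
  ext fun l => (h1 l).trans (h2 l).symm

lemma IsDeriv.add {u v : WA r} {du dv : WA r'} (h1 : IsDeriv ω u du) (h2 : IsDeriv ω v dv) :
    IsDeriv ω (u + v) (du + dv) := fun l => by simp [h1 l, h2 l]; ring

lemma IsDeriv.sub {u v : WA r} {du dv : WA r'} (h1 : IsDeriv ω u du) (h2 : IsDeriv ω v dv) :
    IsDeriv ω (u - v) (du - dv) := fun l => by simp [h1 l, h2 l]; ring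

lemma IsDeriv.tau {u : WA r} {du : WA r'} (h1 : IsDeriv ω u du) (t : ℝ) :
    IsDeriv ω (tau ω t r u) (tau ω t r' du) := fun l => by simp [h1 l]; ring

lemma IsDeriv.isReal {u : WA r} {du : WA r'} (h1 : IsDeriv ω u du) (hu : IsReal u) :
    IsReal du := ext fun l => by
  have h2 : conj (u (-l)) = u l := by rw [← conjHom_apply, hu]
  simp [h1 l, h1 (-l), h2]

/-- This is the exchange rate used throughout: giving up width ρ absorbs any multiplier of size at
most e^(ρ‖l‖). -/
lemma mul_wt_le {ρ x : ℝ} (hr : r' + ρ ≤ r) {l : Idx}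
    (hx : x ≤ Real.exp (ρ * indexWeight l)) : x * wt r' l ≤ wt r l := by
  have h4 : Real.exp (ρ * indexWeight l) * wt r' l ≤ wt r l := by
    rw [wt, wt, ← Real.exp_add, ← add_mul]
    exact Real.exp_le_exp.2 (mul_le_mul_of_nonneg_right (by linarith) (indexWeight_nonneg l))
  exact (mul_le_mul_of_nonneg_right hx (wt_pos r' l).le).trans h4

lemma exists_isDeriv (hω : ∀ i, |ω i| ≤ 1) {ρ : ℝ} (hρ : 0 < ρ) (hr : r' + ρ ≤ r) (u : WA r) :
    ∃ du : WA r', IsDeriv ω u du ∧ ‖du‖ ≤ ρ⁻¹ * ‖u‖ := by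
  refine ⟨diag (fun l => I * freqPairing ω l) ρ⁻¹ (fun l => ?_) u,
    fun l => diag_apply _ _ _ u l, norm_diag_le _ _ _ u⟩
  rw [inv_mul_eq_div, le_div_iff₀ hρ, norm_mul, Complex.norm_I, one_mul, Complex.norm_real,
    Real.norm_eq_abs, mul_right_comm]
  refine mul_wt_le hr ?_
  nlinarith [Real.add_one_le_exp (ρ * indexWeight l), abs_freqPairing_le hω l]

lemma norm_cexp_I_sub_le (x : ℝ) : ‖Complex.exp (I * x) - 1 - I * x‖ ≤ 3 * x ^ 2 := by
  have hn : ‖(I * x : ℂ)‖ = |x| := by simp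
  by_cases hx : |x| ≤ 1
  · have := Complex.norm_exp_sub_one_sub_id_le (x := I * x) (by rwa [hn])
    rw [hn, sq_abs] at this
    nlinarith [sq_nonneg x]
  · push Not at hx
    have h1 : ‖Complex.exp (I * x)‖ = 1 := by rw [mul_comm]; exact Complex.norm_exp_ofReal_mul_I x
    calc ‖Complex.exp (I * x) - 1 - I * x‖ ≤ ‖Complex.exp (I * x)‖ + ‖(1 : ℂ)‖ + ‖(I * x : ℂ)‖ :=
          (norm_sub_le _ _).trans (by gcongr; exact norm_sub_le _ _)
      _ = 1 + 1 + |x| := by rw [h1, hn, norm_one]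
      _ ≤ 3 * x ^ 2 := by rw [← sq_abs]; nlinarith

/-- Coefficientwise the remainder is of order (ω, l)²t², and (ρ‖l‖)²/2 ≤ e^(ρ‖l‖) makes it summable
on the narrower strip. -/
lemma hasDerivAt_tau (hω : ∀ i, |ω i| ≤ 1) {ρ : ℝ} (hρ : 0 < ρ) (hr : r' + ρ ≤ r) (hle : r' ≤ r)
    {u : WA r} {du : WA r'} (hdu : IsDeriv ω u du) :
    HasDerivAt (fun t : ℝ => incl hle (tau ω t r u)) du 0 := by
  have key : ∀ t : ℝ, ‖incl hle (tau ω t r u) - incl hle u - t • du‖ ≤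
      (6 * ρ⁻¹ ^ 2 * t ^ 2) * ‖u‖ := fun t => by
    refine norm_le_of_coeff_le fun l => ?_
    have h1 : (incl hle (tau ω t r u) - incl hle u - t • du) l =
        (Complex.exp (I * (freqPairing ω l * t : ℝ)) - 1 - I * (freqPairing ω l * t : ℝ)) * u l := by
      have : (t • du) l = t * du l := rfl
      simp only [sub_apply, incl_apply, tau_apply, this, hdu l]
      push_cast
      ring_nf
    have h2 : (freqPairing ω l) ^ 2 * ρ ^ 2 / 2 * wt r' l ≤ wt r l := by
      refine mul_wt_le hr ?_
      have h0 := indexWeight_nonneg l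
      have := Real.pow_div_factorial_le_exp (ρ * indexWeight l) (by positivity) 2
      refine le_trans ?_ this
      have h3 : freqPairing ω l ^ 2 ≤ indexWeight l ^ 2 := by
        rw [← sq_abs]; gcongr; exact abs_freqPairing_le hω l
      simp only [Nat.factorial, mul_pow]
      push_cast
      nlinarith [sq_nonneg ρ, mul_le_mul_of_nonneg_right h3 (sq_nonneg ρ)]
    rw [h1, norm_mul]
    have h4 := norm_cexp_I_sub_le (freqPairing ω l * t)
    have := wt_pos r' l
    calc _ ≤ 3 * (freqPairing ω l * t) ^ 2 * ‖u l‖ * wt r' l := by gcongr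
      _ = 6 * ρ⁻¹ ^ 2 * t ^ 2 * ‖u l‖ * ((freqPairing ω l) ^ 2 * ρ ^ 2 / 2 * wt r' l) := by
        field_simp
        ring
      _ ≤ 6 * ρ⁻¹ ^ 2 * t ^ 2 * ‖u l‖ * wt r l := by gcongr
      _ = _ := by ring
  have h0 : tau ω (0 : ℝ) r u = u := ext fun l => by simp
  rw [hasDerivAt_iff_isLittleO]
  simp only [sub_zero, h0]
  refine Asymptotics.IsBigO.trans_isLittleO (g := fun t : ℝ => t ^ 2) ?_ ?_
  · refine Asymptotics.IsBigO.of_bound (6 * ρ⁻¹ ^ 2 * ‖u‖) (Filter.Eventually.of_forall fun t => ?_)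
    refine (key t).trans_eq ?_
    rw [Real.norm_of_nonneg (sq_nonneg t)]
    ring
  · exact Asymptotics.isLittleO_pow_id one_lt_two

/-- The quadratic Taylor remainder gives differentiability; real scalars suffice since it is
composed with translations by a real parameter. -/
lemma hasFDerivAt_comp (hω : ∀ i, |ω i| ≤ 1) (ha : GermBound a R s d) (hη : 0 < η)
    (hu : r + ‖u‖ + η ≤ R) (hw : ‖w‖ + η ≤ s) :
    HasFDerivAt (𝕜 := ℝ) (fun p : WA r × WA r => comp ω a p.1 p.2)
      ((ContinuousLinearMap.mul ℝ (WA r) (comp ω (germDx ω a) u w)).comp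
          (ContinuousLinearMap.fst ℝ (WA r) (WA r)) +
        (ContinuousLinearMap.mul ℝ (WA r) (comp ω (germDy a) u w)).comp
          (ContinuousLinearMap.snd ℝ (WA r) (WA r))) (u, w) := by
  rw [hasFDerivAt_iff_isLittleO_nhds_zero]
  refine Asymptotics.IsBigO.trans_isLittleO (g := fun p : WA r × WA r => ‖p‖ ^ 2) ?_ ?_
  · refine Asymptotics.IsBigO.of_bound (16 * d / η ^ 2) ?_
    filter_upwards [Metric.ball_mem_nhds (0 : WA r × WA r) (show 0 < η / 4 by positivity)]
      with p hp
    rw [mem_ball_zero_iff] at hp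
    by_cases hp0 : p = 0
    · simp [hp0]
    · have := norm_comp_sub_sub_le hω ha hη hu hw (norm_pos_iff.2 hp0) (norm_fst_le p)
        (norm_snd_le p) (by linarith)
      simp only [Prod.fst_add, Prod.snd_add, _root_.add_apply,
        ContinuousLinearMap.comp_apply, ContinuousLinearMap.coe_fst', ContinuousLinearMap.coe_snd',
        ContinuousLinearMap.mul_apply', norm_pow, norm_norm]
      refine this.trans_eq ?_
      ring
  · simpa using (Asymptotics.isLittleO_norm_pow_id (E' := WA r × WA r) one_lt_two)

/-- The chain rule for the substitution. -/
lemma isDeriv_comp (hω : ∀ i, |ω i| ≤ 1) (ha : GermBound a R s d) (hη : 0 < η)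
    (hu : r + ‖u‖ + η ≤ R) (hw : ‖w‖ + η ≤ s) {ρ : ℝ} (hρ : 0 < ρ) (hr : r' + ρ ≤ r)
    (hle : r' ≤ r) {du dw : WA r'} (hdu : IsDeriv ω u du) (hdw : IsDeriv ω w dw) :
    IsDeriv ω (comp ω a u w) (comp ω (germDx ω a) (incl hle u) (incl hle w) * (1 + du) +
      comp ω (germDy a) (incl hle u) (incl hle w) * dw) := by
  obtain ⟨dF, hdF, -⟩ := exists_isDeriv hω hρ hr (comp ω a u w)
  have hu' : (r' : ℝ) + ‖incl hle u‖ + η ≤ R := by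
    have := norm_incl_le hle u
    have : (r' : ℝ) ≤ r := by exact_mod_cast hle
    linarith
  have hw' : ‖incl hle w‖ + η ≤ s := by linarith [norm_incl_le hle w]
  have h1 := hasDerivAt_tau hω hρ hr hle hdF
  have hid : HasDerivAt (fun t : ℝ => (t : ℂ) • (1 : WA r')) 1 0 := by
    have := (hasDerivAt_id (0 : ℝ)).smul_const (1 : WA r')
    simpa using this
  have h2 := ((hasDerivAt_tau hω hρ hr hle hdu).add hid).prodMk (hasDerivAt_tau hω hρ hr hle hdw)
  have h0 : ∀ x : WA r, tau ω (0 : ℝ) r x = x := fun x => ext fun l => by simp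
  have h3 := hasFDerivAt_comp hω ha hη hu' hw'
  have h4 := HasFDerivAt.comp_hasDerivAt_of_eq (0 : ℝ) h3 h2 (by simp [h0])
  -- Translating the composite equals composing with translated arguments, where the point x itself
  -- contributes the added constant t. Differentiating both sides at t = 0 is the chain rule.
  have h5 : (fun p : WA r' × WA r' => comp ω a p.1 p.2) ∘
      (fun t : ℝ => (incl hle (tau ω t r u) + (t : ℂ) • 1, incl hle (tau ω t r w))) =
      fun t : ℝ => incl hle (tau ω t r (comp ω a u w)) := funext fun t => by
    rw [incl_tau, incl_comp hω ha (by linarith) (by linarith),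
      tau_comp hω ha (by linarith) (by linarith), Function.comp, incl_tau, incl_tau]
  have h6 : HasDerivAt ((fun p : WA r' × WA r' => comp ω a p.1 p.2) ∘
      (fun t : ℝ => (incl hle (tau ω t r u) + (t : ℂ) • 1, incl hle (tau ω t r w)))) _ 0 := h4
  rw [h5] at h6
  have h7 := h1.unique h6
  intro l
  rw [← hdF l, h7]
  simp only [_root_.add_apply, ContinuousLinearMap.comp_apply, ContinuousLinearMap.coe_fst',
    ContinuousLinearMap.coe_snd', ContinuousLinearMap.mul_apply', add_comm du]

end WA

/-! ### Small divisors and the cohomological equation. -/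

lemma one_add_rpow_le {p t : ℝ} (hp : 0 < p) (ht : 1 ≤ t) :
    1 + t ^ p ≤ Real.exp ((1 + 2 * p) * √t) := by
  have h1 : 1 ≤ √t := Real.one_le_sqrt.2 ht
  have h2 : Real.log t ≤ 2 * √t := by
    have h3 := Real.log_le_sub_one_of_pos (show 0 < √t by linarith)
    rw [Real.log_sqrt (by linarith)] at h3
    linarith
  have h3 : t ^ p ≤ Real.exp (2 * p * √t) := by
    rw [Real.rpow_def_of_pos (by linarith)]
    exact Real.exp_le_exp.2 (by nlinarith)
  have h4 : 1 ≤ Real.exp (2 * p * √t) := Real.one_le_exp (by positivity)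
  have h5 : 2 ≤ Real.exp √t := by linarith [Real.add_one_le_exp √t]
  calc 1 + t ^ p ≤ 2 * Real.exp (2 * p * √t) := by linarith
    _ ≤ Real.exp √t * Real.exp (2 * p * √t) := by gcongr
    _ = _ := by rw [← Real.exp_add]; congr 1; ring

/-- With t = x², either C ≤ ρx and the linear term suffices, or (ρx)⁵ ≤ C⁵. The fifth power is
chosen so that the remainder decays like t⁻², which is summable over the coordinates i. -/
lemma mul_sqrt_le {C ρ t : ℝ} (hC : 0 < C) (hρ : 0 < ρ) (ht : 0 < t) :
    C * √t ≤ ρ * t + C ^ 6 / (ρ ^ 5 * t ^ 2) := by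
  obtain ⟨x, hx, rfl⟩ : ∃ x, 0 < x ∧ t = x ^ 2 :=
    ⟨√t, Real.sqrt_pos.2 ht, (Real.sq_sqrt ht.le).symm⟩
  rw [Real.sqrt_sq hx.le]
  by_cases h : C ≤ ρ * x
  · have : 0 ≤ C ^ 6 / (ρ ^ 5 * (x ^ 2) ^ 2) := by positivity
    nlinarith
  · push Not at h
    have h1 : C * x ≤ C ^ 6 / (ρ ^ 5 * (x ^ 2) ^ 2) := by
      rw [le_div_iff₀ (by positivity)]
      have h2 : (ρ * x) ^ 5 ≤ C ^ 5 := by gcongr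
      calc C * x * (ρ ^ 5 * (x ^ 2) ^ 2) = C * (ρ * x) ^ 5 := by ring
        _ ≤ C * C ^ 5 := by gcongr
        _ = _ := by ring
    have : 0 ≤ ρ * x ^ 2 := by positivity
    linarith

lemma summable_inv_pnat_sq : Summable fun i : ℕ+ => (((i : ℕ) : ℝ) ^ 2)⁻¹ :=
  (Real.summable_nat_pow_inv.2 one_lt_two).comp_injective PNat.coe_injective

/-- The divisor products are dominated by exponential weights. -/
lemma exists_divisorProd_le {p : ℝ} (hp : 0 < p) : ∃ K, 0 < K ∧ ∀ ρ, 0 < ρ → ∀ l : Idx,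
    divisorProd p l ≤ Real.exp (K / ρ ^ 5) * Real.exp (ρ * indexWeight l) := by
  set C := 1 + 2 * p
  have hC : 0 < C := by positivity
  set S := ∑' i : ℕ+, (((i : ℕ) : ℝ) ^ 2)⁻¹
  have hS : 0 ≤ S := tsum_nonneg fun i => by positivity
  refine ⟨C ^ 6 * (S + 1), by positivity, fun ρ hρ l => ?_⟩
  have hfac : ∀ i ∈ l.support, 1 + ((i : ℕ) : ℝ) ^ p * |(l i : ℝ)| ^ p ≤
      Real.exp (ρ * (|(l i : ℝ)| * ((i : ℕ) : ℝ)) + C ^ 6 / ρ ^ 5 * (((i : ℕ) : ℝ) ^ 2)⁻¹) := by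
    intro i hi
    have hi1 : (1 : ℝ) ≤ (i : ℕ) := by exact_mod_cast i.pos
    have hl1 : (1 : ℝ) ≤ |(l i : ℝ)| := by
      exact_mod_cast Int.one_le_abs (Finsupp.mem_support_iff.1 hi)
    set t := |(l i : ℝ)| * ((i : ℕ) : ℝ) with ht
    -- On the support |l i| ≥ 1, hence t ≥ i. The remainders are therefore dominated by a multiple
    -- of ∑ i⁻², independently of l and of the size of its support.
    have hti : ((i : ℕ) : ℝ) ≤ t := le_mul_of_one_le_left (by linarith) hl1
    rw [← Real.mul_rpow (by positivity) (by positivity), mul_comm, ← ht]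
    refine (one_add_rpow_le hp (hi1.trans hti)).trans (Real.exp_le_exp.2 ?_)
    refine (mul_sqrt_le hC hρ (by linarith)).trans ?_
    gcongr
    rw [← div_eq_mul_inv, div_div]
    gcongr
  unfold divisorProd Finsupp.prod
  refine (Finset.prod_le_prod (fun i _ => by positivity) hfac).trans ?_
  rw [← Real.exp_sum, ← Real.exp_add, Finset.sum_add_distrib, ← Finset.mul_sum, ← Finset.mul_sum]
  refine Real.exp_le_exp.2 ?_
  have h1 : ∑ i ∈ l.support, (((i : ℕ) : ℝ) ^ 2)⁻¹ ≤ S :=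
    summable_inv_pnat_sq.sum_le_tsum _ fun i _ => by positivity
  have h2 : ∑ i ∈ l.support, |(l i : ℝ)| * ((i : ℕ) : ℝ) = indexWeight l := rfl
  have h3 : C ^ 6 / ρ ^ 5 * ∑ i ∈ l.support, (((i : ℕ) : ℝ) ^ 2)⁻¹ ≤ C ^ 6 / ρ ^ 5 * (S + 1) := by
    gcongr
    linarith
  rw [h2]
  calc _ ≤ ρ * indexWeight l + C ^ 6 / ρ ^ 5 * (S + 1) := by gcongr
    _ = _ := by ring

lemma divisorProd_pos (p : ℝ) (l : Idx) : 0 < divisorProd p l :=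
  Finset.prod_pos fun i _ => by positivity

/-- Reduce θ/2π to its distance y from the nearest integer; then |e^(iθ) − 1| = 2|sin πy|, and
Jordan's inequality bounds this below by 4|y|. -/
lemma norm_cexp_sub_one_ge {θ δ : ℝ} (h : ∀ n : ℤ, δ ≤ |θ / (2 * Real.pi) - n|) :
    4 * δ ≤ ‖Complex.exp (I * θ) - 1‖ := by
  have hpi := Real.pi_pos
  set n := round (θ / (2 * Real.pi))
  set y := θ / (2 * Real.pi) - n with hy
  have h1 : |y| ≤ 1 / 2 := abs_sub_round _
  have h2 : Complex.exp (I * θ) = Complex.exp (I * (2 * Real.pi * y : ℝ)) := by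
    have h3 : (2 * Real.pi * y : ℝ) = θ - n * (2 * Real.pi) := by rw [hy]; field_simp
    rw [h3]
    push_cast
    rw [mul_sub, Complex.exp_sub]
    have : I * ((n : ℂ) * (2 * Real.pi)) = n * (2 * Real.pi * I) := by ring
    rw [this, Complex.exp_int_mul_two_pi_mul_I, div_one]
  rw [h2, Complex.norm_exp_I_mul_ofReal_sub_one, norm_mul, Real.norm_eq_abs, Real.norm_eq_abs]
  have h6 : 2 * Real.pi * y / 2 = Real.pi * y := by ring
  rw [h6]
  have h4 := Real.mul_abs_le_abs_sin (x := Real.pi * y) (by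
    rw [abs_mul, abs_of_pos hpi]
    nlinarith)
  rw [abs_mul, abs_of_pos hpi] at h4
  have h5 : 2 / Real.pi * (Real.pi * |y|) = 2 * |y| := by field_simp
  rw [abs_two]
  linarith [h n]

/-- The difference of the squared sides is affine in cos θ with slope 2 − 8κ ≤ 0, so its minimum is
at cos θ = 1, where it equals 4(κ − 1)². Thus the divisors with κ ≠ 1 need no nonresonance condition
of their own. -/
lemma norm_sub_cexp_ge {κ θ : ℝ} (hκ : 1 / 4 ≤ κ) :
    ‖Complex.exp (I * θ) - 1‖ ≤ 2 * ‖(κ : ℂ) - Complex.exp (I * θ)‖ := by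
  have hsq : ‖Complex.exp (I * θ) - 1‖ ^ 2 ≤ (2 * ‖(κ : ℂ) - Complex.exp (I * θ)‖) ^ 2 := by
    rw [mul_pow, Complex.sq_norm, Complex.sq_norm, mul_comm I, Complex.exp_mul_I,
      ← Complex.ofReal_cos, ← Complex.ofReal_sin]
    simp only [Complex.normSq_apply, Complex.sub_re, Complex.add_re, Complex.mul_re, Complex.I_re,
      Complex.I_im, Complex.ofReal_re, Complex.ofReal_im, Complex.one_re, Complex.one_im,
      Complex.sub_im, Complex.add_im, Complex.mul_im]
    nlinarith [Real.sin_sq_add_cos_sq θ, sq_nonneg (κ - 1), Real.cos_le_one θ]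
  exact (sq_le_sq₀ (norm_nonneg _) (by positivity)).1 hsq

/-- The divisors `κ - e ^ (i (ω, l) α)` cost at most the factor `Λ` on strips whose widths differ
by `ρ`. -/
def SmallDivisors (ω : ℕ+ → ℝ) (α ρ Λ : ℝ) : Prop := ∀ κ : ℝ, 1 / 4 ≤ κ → ∀ l : Idx, l ≠ 0 →
  1 ≤ Λ * Real.exp (ρ * indexWeight l) * ‖(κ : ℂ) - Complex.exp (I * freqPairing ω l * α)‖

lemma exists_smallDivisors {γ μ : ℝ} (hγ : 0 < γ) (hμ : 0 < μ) : ∃ K, 0 < K ∧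
    ∀ (ω : ℕ+ → ℝ) (α : ℝ), IsNonresonant ω γ μ α → ∀ ρ, 0 < ρ →
      SmallDivisors ω α ρ (γ⁻¹ * Real.exp (K / ρ ^ 5)) := by
  obtain ⟨K, hK, h⟩ := exists_divisorProd_le (p := 2 + 2 * μ) (by positivity)
  refine ⟨K, hK, fun ω α hα ρ hρ κ hκ l hl => ?_⟩
  have hp := divisorProd_pos (2 + 2 * μ) l
  have h1 : 4 * (γ * (1 / divisorProd (2 + 2 * μ) l)) ≤
      ‖Complex.exp (I * (freqPairing ω l * α : ℝ)) - 1‖ :=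
    norm_cexp_sub_one_ge fun n => by
      have := (hα l hl n).le
      rwa [mul_div_assoc]
  have h2 := norm_sub_cexp_ge (θ := freqPairing ω l * α) hκ
  have h4 : (I * freqPairing ω l * α : ℂ) = I * (freqPairing ω l * α : ℝ) := by push_cast; ring
  have h3 : γ / divisorProd (2 + 2 * μ) l ≤ ‖(κ : ℂ) - Complex.exp (I * freqPairing ω l * α)‖ := by
    have h5 : 0 ≤ γ / divisorProd (2 + 2 * μ) l := by positivity
    rw [h4]
    rw [mul_one_div] at h1
    linarith
  calc 1 = γ⁻¹ * divisorProd (2 + 2 * μ) l * (γ / divisorProd (2 + 2 * μ) l) := by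
        generalize divisorProd (2 + 2 * μ) l = P at hp ⊢
        field_simp
    _ ≤ γ⁻¹ * (Real.exp (K / ρ ^ 5) * Real.exp (ρ * indexWeight l)) *
        ‖(κ : ℂ) - Complex.exp (I * freqPairing ω l * α)‖ := by gcongr; exact h ρ hρ l
    _ = _ := by ring

namespace WA

variable {r r' : ℝ≥0} {ω : ℕ+ → ℝ} {α ρ Λ : ℝ}

/-- Solution of the cohomological equation up to the mean value. -/
lemma exists_solution (hs : SmallDivisors ω α ρ Λ) (hΛ : 0 ≤ Λ) (hr : r' + ρ ≤ r) (hle : r' ≤ r)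
    {κ : ℝ} (hκ : 1 / 4 ≤ κ) {x : WA r} (hx : IsReal x) :
    ∃ y : WA r', IsReal y ∧ y 0 = 0 ∧ ‖y‖ ≤ Λ * ‖x‖ ∧
      (κ : ℂ) • y - tau ω α r' y = incl hle x - x 0 • 1 := by
  -- The zero mode is set to 0, so no lower bound at l = 0 is needed and the mean of x is the only
  -- part left unsolved.
  set m : Idx → ℂ := fun l =>
    if l = 0 then 0 else ((κ : ℂ) - Complex.exp (I * freqPairing ω l * α))⁻¹ with hm
  have hne : ∀ l, l ≠ 0 → 0 < ‖(κ : ℂ) - Complex.exp (I * freqPairing ω l * α)‖ := by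
    intro l hl
    have h1 := hs κ hκ l hl
    by_contra h0
    rw [le_antisymm (not_lt.1 h0) (norm_nonneg _), mul_zero] at h1
    linarith
  have hb : ∀ l, ‖m l‖ * wt r' l ≤ Λ * wt r l := fun l => by
    by_cases hl : l = 0
    · simp only [hm, hl, if_true, norm_zero, zero_mul, wt_zero]; linarith
    · simp only [hm, hl, if_false, norm_inv]
      have h1 := wt_pos r' l
      calc _ ≤ Λ * Real.exp (ρ * indexWeight l) * wt r' l := by
            gcongr
            rw [inv_le_iff_one_le_mul₀ (hne l hl)]
            exact hs κ hκ l hl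
        _ = Λ * (Real.exp (ρ * indexWeight l) * wt r' l) := by ring
        _ ≤ _ := by
            gcongr
            exact mul_wt_le hr le_rfl
  refine ⟨diag m Λ hb x, ?_, ?_, norm_diag_le _ _ _ x, ?_⟩
  · refine ext fun l => ?_
    have hxl : conj (x (-l)) = x l := by rw [← conjHom_apply, hx]
    rw [conjHom_apply, diag_apply, diag_apply, map_mul, hxl]
    congr 1
    by_cases hl : l = 0
    · simp [hm, hl]
    · simp [hm, hl, ← Complex.exp_conj]
  · rw [diag_apply]; simp [hm]
  · refine ext fun l => ?_
    simp only [sub_apply, smul_apply, tau_apply, diag_apply, incl_apply, one_apply]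
    by_cases hl : l = 0
    · simp [hm, hl]
    · have h1 : (κ : ℂ) - Complex.exp (I * freqPairing ω l * α) ≠ 0 := norm_pos_iff.1 (hne l hl)
      simp only [hm, hl, if_false]
      rw [mul_zero, sub_zero, ← mul_assoc, ← mul_assoc, ← sub_mul, ← sub_mul,
        mul_inv_cancel₀ h1, one_mul]

end WA

/-! ### The algebraic identities behind the Newton step. -/

section Algebra

variable {A : Type*} [CommRing A]
  {Fx Fy Gx Gy U Up Ui Upi W Wp E₁ E₂ dE₁ dE₂ q qp qpi K E₃ b bp a ap k : A}

/-- A primed letter p stands for translation by α. The equation for a cancels the first error except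
for a times its derivative, because the tangent vector is transported up to dE₁. -/
lemma newton_first (h₁ : (1 + Fx) * U + (1 + Fy) * W - Up = dE₁) (hUp : Up * Upi = 1)
    (ha : a - ap = (-E₁ - (1 + Fy) * (q * b * Ui)) * Upi) :
    E₁ + (1 + Fx) * (U * a) + (1 + Fy) * (W * a + q * b * Ui) - Up * ap = a * dE₁ := by
  linear_combination a * h₁ + Up * ha + (-E₁ - (1 + Fy) * (q * b * Ui)) * hUp

/-- Multiplication by Up takes the determinant with the translated tangent vector, in which the
normal coefficient b separates from a. The constant k remains, together with products of two small
quantities. -/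
lemma newton_second (h₁ : (1 + Fx) * U + (1 + Fy) * W - Up = dE₁)
    (h₂ : Gx * U + (1 + Gy) * W - Wp = dE₂) (hU : U * Ui = 1) (hUp : Up * Upi = 1)
    (hqp : qp * qpi = 1)
    (h₃ : ((1 + Fx) * (1 + Gy) - (1 + Fy) * Gx) * q - K * qp = E₃)
    (hb : K * b - bp = -(Up * E₂ - Wp * E₁) * qpi + k)
    (ha : a - ap = (-E₁ - (1 + Fy) * (q * b * Ui)) * Upi) :
    Up * (E₂ + Gx * (U * a) + (1 + Gy) * (W * a + q * b * Ui) - (Wp * ap + qp * bp * Upi)) =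
      qp * k + (E₃ * b + ((1 + Fy) * dE₂ - (1 + Gy) * dE₁) * (q * b * Ui) + Up * (a * dE₂)) := by
  linear_combination Up * a * h₂ + Wp * Up * ha + Wp * (-E₁ - (1 + Fy) * (q * b * Ui)) * hUp
    - qp * bp * hUp - (1 + Gy) * (q * b * Ui) * h₁ + (1 + Fy) * (q * b * Ui) * h₂
    + ((1 + Fx) * (1 + Gy) - (1 + Fy) * Gx) * q * b * hU + b * h₃ + qp * hb
    - (Up * E₂ - Wp * E₁) * hqp

/-- Changing q to q(1 + z) and K to K + K' cancels the defect M to first order; only products of M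
or K' with z are left. -/
lemma newton_third {D z zp K' M : A} (hM : D * q - K * qp = M)
    (hz : K * (z - zp) = K' - M * qpi) (hqp : qp * qpi = 1) :
    D * (q * (1 + z)) - (K + K') * (qp * (1 + zp)) = M * z - K' * qp * zp := by
  linear_combination (1 + z) * hM + qp * hz - M * hqp

end Algebra

/-! ### Norm bounds for sums, products and inverses. -/

section Norm

variable {A : Type*} [NormedCommRing A] {x y : A} {a b : ℝ}

lemma norm_mul_le_of (hx : ‖x‖ ≤ a) (hy : ‖y‖ ≤ b) : ‖x * y‖ ≤ a * b :=
  (norm_mul_le x y).trans (mul_le_mul hx hy (norm_nonneg _) ((norm_nonneg _).trans hx))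

lemma norm_add_le_of (hx : ‖x‖ ≤ a) (hy : ‖y‖ ≤ b) : ‖x + y‖ ≤ a + b :=
  (norm_add_le x y).trans (add_le_add hx hy)

lemma norm_sub_le_of (hx : ‖x‖ ≤ a) (hy : ‖y‖ ≤ b) : ‖x - y‖ ≤ a + b :=
  (norm_sub_le x y).trans (add_le_add hx hy)

lemma norm_neg_le_of (hx : ‖x‖ ≤ a) : ‖-x‖ ≤ a := by rwa [norm_neg]

lemma norm_inv_sub_one_le (hx : ‖x - 1‖ ≤ a) (h : x * y = 1) (hy : ‖y‖ ≤ 2) :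
    ‖y - 1‖ ≤ 2 * a := by
  have h1 : y - 1 = -(y * (x - 1)) := by linear_combination h
  rw [h1, norm_neg]
  exact norm_mul_le_of hy hx

variable [NormOneClass A]

lemma norm_le_of_sub_one (hx : ‖x - 1‖ ≤ a) : ‖x‖ ≤ 1 + a := by
  have := norm_add_le (x - 1) 1
  rw [sub_add_cancel, norm_one] at this
  linarith

lemma norm_mul_sub_one_le (hx : ‖x - 1‖ ≤ a) (hy : ‖y - 1‖ ≤ b) :
    ‖x * y - 1‖ ≤ a * (1 + b) + b := by
  have h : x * y - 1 = (x - 1) * y + (y - 1) := by ring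
  rw [h]
  exact norm_add_le_of (norm_mul_le_of hx (norm_le_of_sub_one hy)) hy

end Norm

/-! ### Margins, approximate solutions and the derivatives of the errors. -/

namespace WA

variable {r r' : ℝ≥0} {ω : ℕ+ → ℝ} {α η c : ℝ} {a b : Idx × ℕ → ℂ} {R : ℝ≥0} {u w h k : WA r}

/-- A real perturbation that is small relative to the size `η` of the margins. -/
structure SmallGerm (a : Idx × ℕ → ℂ) (R : ℝ≥0) (η : ℝ) : Prop where
  isReal : RealGerm a
  bound : GermBound a R (3 * η) (η ^ 2 / 1600)

/-- The domain in which the substitutions are estimated. -/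
structure InDomain (R : ℝ≥0) (η : ℝ) (u w : WA r) : Prop where
  radius : r + 3 * η ≤ R
  left : ‖u‖ ≤ η
  right : ‖w‖ ≤ η

lemma InDomain.incl (h : InDomain R η u w) (hr : r' ≤ r) :
    InDomain R η (incl hr u) (incl hr w) where
  radius := by have : (r' : ℝ) ≤ r := by exact_mod_cast hr
               linarith [h.radius]
  left := (norm_incl_le hr u).trans h.left
  right := (norm_incl_le hr w).trans h.right

namespace SmallGerm

/-- The margin 3η is shared out in three parts: the size of the curve, one Cauchy estimate for first
derivatives, and displacements along lines. A perturbation of size η²/1600 then has derivatives of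
size η/1600. -/
lemma bound_dx (ha : SmallGerm a R η) (hω : ∀ i, |ω i| ≤ 1) (hη : 0 < η) {R' : ℝ≥0}
    (hR : R' + η ≤ R) : GermBound (germDx ω a) R' (2 * η) (η / 1600) := by
  have h1 := (ha.bound.dx hω (by positivity) hη hR).mono le_rfl (s' := 2 * η) (by linarith)
    (by positivity)
  rwa [show η⁻¹ * (η ^ 2 / 1600) = η / 1600 by field_simp] at h1

lemma bound_dy (ha : SmallGerm a R η) (hη : 0 < η) {R' : ℝ≥0}
    (hR : R' + η ≤ R) : GermBound (germDy a) R' (2 * η) (η / 1600) := by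
  have h1 := (ha.bound.dy (s' := 2 * η) (by positivity) hη (by linarith)).mono (R' := R')
    (by have : (R' : ℝ) ≤ R := by linarith
        exact_mod_cast this) le_rfl (by positivity)
  rwa [show η⁻¹ * (η ^ 2 / 1600) = η / 1600 by field_simp] at h1

lemma norm_dx_le (ha : SmallGerm a R η) (hω : ∀ i, |ω i| ≤ 1) (hη : 0 < η)
    (hd : InDomain R η u w) : ‖comp ω (germDx ω a) u w‖ ≤ η / 1600 :=
  norm_comp_le hω (ha.bound_dx hω hη (R' := r + ‖u‖₊)
    (by push_cast; linarith [hd.radius, hd.left])) (by simp) (by linarith [hd.right])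

lemma norm_dy_le (ha : SmallGerm a R η) (hω : ∀ i, |ω i| ≤ 1) (hη : 0 < η)
    (hd : InDomain R η u w) : ‖comp ω (germDy a) u w‖ ≤ η / 1600 :=
  norm_comp_le hω (ha.bound_dy hη (R' := r + ‖u‖₊)
    (by push_cast; linarith [hd.radius, hd.left])) (by simp) (by linarith [hd.right])

variable {ν : ℝ}

/-- The factor η² in the size of the perturbation cancels the η² in the denominator of the Taylor
estimate, leaving a remainder free of η. -/
lemma taylor (ha : SmallGerm a R η) (hω : ∀ i, |ω i| ≤ 1) (hη : 0 < η)
    (hd : InDomain R η u w) (hν : 0 < ν) (hh : ‖h‖ ≤ ν) (hk : ‖k‖ ≤ ν) (hνη : 4 * ν ≤ η) :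
    ‖comp ω a (u + h) (w + k) - comp ω a u w - dcomp ω a u w h k‖ ≤ ν ^ 2 := by
  refine (norm_comp_sub_sub_le hω ha.bound hη (by linarith [hd.radius, hd.left])
    (by linarith [hd.right]) hν hh hk hνη).trans ?_
  rw [div_le_iff₀ (by positivity)]
  nlinarith [mul_nonneg (sq_nonneg ν) (sq_nonneg η)]

lemma lipschitz (ha : SmallGerm a R η) (hω : ∀ i, |ω i| ≤ 1) (hη : 0 < η) (hη1 : η ≤ 1)
    (hd : InDomain R η u w) (hν : 0 < ν) (hh : ‖h‖ ≤ ν) (hk : ‖k‖ ≤ ν) (hνη : 4 * ν ≤ η) :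
    ‖comp ω a (u + h) (w + k) - comp ω a u w‖ ≤ ν := by
  refine (norm_comp_sub_le hω ha.bound hη (by linarith [hd.radius, hd.left])
    (by linarith [hd.right]) hν hh hk hνη).trans ?_
  rw [div_le_iff₀ (by positivity)]
  nlinarith [mul_pos hν hη]

lemma lipschitz_dx (ha : SmallGerm a R η) (hω : ∀ i, |ω i| ≤ 1) (hη : 0 < η)
    (hd : InDomain R η u w) (hν : 0 < ν) (hh : ‖h‖ ≤ ν) (hk : ‖k‖ ≤ ν) (hνη : 4 * ν ≤ η) :
    ‖comp ω (germDx ω a) (u + h) (w + k) - comp ω (germDx ω a) u w‖ ≤ ν := by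
  have h1 := ha.bound_dx hω hη (R' := r + ‖u‖₊ + η.toNNReal)
    (by push_cast [Real.coe_toNNReal η hη.le]; linarith [hd.radius, hd.left])
  refine (norm_comp_sub_le hω h1 hη (by simp [hη.le])
    (by linarith [hd.right]) hν hh hk hνη).trans ?_
  rw [div_le_iff₀ (by positivity)]
  nlinarith [mul_pos hν hη]

lemma lipschitz_dy (ha : SmallGerm a R η) (hω : ∀ i, |ω i| ≤ 1) (hη : 0 < η)
    (hd : InDomain R η u w) (hν : 0 < ν) (hh : ‖h‖ ≤ ν) (hk : ‖k‖ ≤ ν) (hνη : 4 * ν ≤ η) :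
    ‖comp ω (germDy a) (u + h) (w + k) - comp ω (germDy a) u w‖ ≤ ν := by
  have h1 := ha.bound_dy hη (R' := r + ‖u‖₊ + η.toNNReal)
    (by push_cast [Real.coe_toNNReal η hη.le]; linarith [hd.radius, hd.left])
  refine (norm_comp_sub_le hω h1 hη (by simp [hη.le])
    (by linarith [hd.right]) hν hh hk hνη).trans ?_
  rw [div_le_iff₀ (by positivity)]
  nlinarith [mul_pos hν hη]

end SmallGerm

/-- The first component of the error of the curve `(x + u x, w x)`. -/
def err₁ (ω : ℕ+ → ℝ) (α : ℝ) (a : Idx × ℕ → ℂ) (u w : WA r) : WA r :=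
  u + w + comp ω a u w - tau ω α r u

/-- The second component of the error of the curve `(x + u x, w x)`. -/
def err₂ (ω : ℕ+ → ℝ) (α : ℝ) (b : Idx × ℕ → ℂ) (u w : WA r) : WA r :=
  w + comp ω b u w - tau ω α r w

/-- The Jacobian determinant of the map along the curve. -/
def jac (ω : ℕ+ → ℝ) (a b : Idx × ℕ → ℂ) (u w : WA r) : WA r :=
  (1 + comp ω (germDx ω a) u w) * (1 + comp ω (germDy b) u w) -
    (1 + comp ω (germDy a) u w) * comp ω (germDx ω b) u w

/-- The error in the reduction of the normal dynamics to a constant. -/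
def err₃ (ω : ℕ+ → ℝ) (α : ℝ) (a b : Idx × ℕ → ℂ) (u w q : WA r) (κ : ℝ) : WA r :=
  jac ω a b u w * q - (κ : ℂ) • tau ω α r q

/-- A real approximate invariant curve together with an approximate reduction of its normal
dynamics. -/
structure Approx (ω : ℕ+ → ℝ) (α : ℝ) (a b : Idx × ℕ → ℂ) (c e : ℝ) (u w U W q : WA r) (κ : ℝ) :
    Prop where
  real_u : IsReal u
  real_w : IsReal w
  real_q : IsReal q
  deriv_u : IsDeriv ω u (U - 1)
  deriv_w : IsDeriv ω w W
  norm_u : ‖u‖ ≤ c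
  norm_w : ‖w‖ ≤ c
  norm_U : ‖U - 1‖ ≤ c
  norm_W : ‖W‖ ≤ c
  norm_q : ‖q - 1‖ ≤ c
  abs_κ : |κ - 1| ≤ c
  norm_err₁ : ‖err₁ ω α a u w‖ ≤ e
  norm_err₂ : ‖err₂ ω α b u w‖ ≤ e
  norm_err₃ : ‖err₃ ω α a b u w q κ‖ ≤ e

/-- Every real curve in the given range has a point where the second error is dominated by the
first one. -/
def Crossing (ω : ℕ+ → ℝ) (α : ℝ) (a b : Idx × ℕ → ℂ) (R : ℝ≥0) (η c : ℝ) (r₀ : ℝ≥0) : Prop :=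
  ∀ r : ℝ≥0, r₀ ≤ r → r + 3 * η ≤ R → ∀ u w : WA r, IsReal u → IsReal w → ‖u‖ ≤ c → ‖w‖ ≤ c →
    ∃ ξ : ℝ, ‖ev ω ξ r (err₂ ω α b u w)‖ ≤ ‖ev ω ξ r (err₁ ω α a u w)‖

/-- The standing assumptions of the iteration. -/
structure KamData (ω : ℕ+ → ℝ) (α : ℝ) (a b : Idx × ℕ → ℂ) (R : ℝ≥0) (η c₀ : ℝ) (r₀ : ℝ≥0) :
    Prop where
  freq : ∀ i, |ω i| ≤ 1
  η_pos : 0 < η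
  η_le : η ≤ 1
  small_a : SmallGerm a R η
  small_b : SmallGerm b R η
  crossing : Crossing ω α a b R η c₀ r₀
  c₀_le : c₀ ≤ 1 / 100
  c₀_le_η : c₀ ≤ η

/-- The loss `Λ` of the small divisors and of differentiation on strips whose widths differ
by `ρ`. -/
structure Loss (ω : ℕ+ → ℝ) (α ρ Λ : ℝ) : Prop where
  pos : 0 < ρ
  inv_le : ρ⁻¹ ≤ Λ
  large : 10 ^ 5 ≤ Λ
  divisors : SmallDivisors ω α ρ Λ

lemma IsDeriv.incl_right {r₁ r₂ : ℝ≥0} {u : WA r} {du : WA r₁} (h : IsDeriv ω u du)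
    (hr : r₂ ≤ r₁) : IsDeriv ω u (WA.incl hr du) := fun l => by simp [h l]

namespace Approx

variable {e κ : ℝ} {U W q : WA r}

lemma inDomain (h : Approx ω α a b c e u w U W q κ) (hc : c ≤ η) (hr : r + 3 * η ≤ R) :
    InDomain R η u w := ⟨hr, h.norm_u.trans hc, h.norm_w.trans hc⟩

variable {c₀ : ℝ} {r₀ : ℝ≥0}

/-- By the chain rule, the differential of the map transports the tangent vector of the curve, in
its first component, with a defect equal to the derivative of the error; this defect is therefore
itself small. -/
lemma isDeriv_err₁ (h : Approx ω α a b c e u w U W q κ) (D : KamData ω α a b R η c₀ r₀)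
    (hc : c ≤ η) (hr : r + 3 * η ≤ R) {ρ : ℝ} (hρ : 0 < ρ) (hr' : r' + ρ ≤ r) (hle : r' ≤ r) :
    IsDeriv ω (err₁ ω α a u w) ((1 + incl hle (comp ω (germDx ω a) u w)) * incl hle U +
      (1 + incl hle (comp ω (germDy a) u w)) * incl hle W - incl hle (tau ω α r U)) := by
  have hd := h.inDomain hc hr
  have hx := D.small_a.bound_dx (R' := r + ‖u‖₊) D.freq D.η_pos
    (by push_cast; linarith [hd.radius, hd.left, D.η_pos])
  have hy := D.small_a.bound_dy (R' := r + ‖u‖₊) D.η_pos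
    (by push_cast; linarith [hd.radius, hd.left, D.η_pos])
  have hu := h.deriv_u.incl_right hle
  have hw := h.deriv_w.incl_right hle
  have hC := isDeriv_comp D.freq D.small_a.bound D.η_pos
    (by linarith [hd.radius, hd.left, D.η_pos]) (by linarith [hd.right, D.η_pos]) hρ hr' hle hu hw
  have h1 := ((hu.add hw).add hC).sub (hu.tau α)
  rw [← incl_comp D.freq hx (by simp) (by linarith [hd.right, D.η_pos]),
    ← incl_comp D.freq hy (by simp) (by linarith [hd.right, D.η_pos]), ← incl_tau] at h1
  simp only [map_sub, map_one] at h1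
  refine fun l => Eq.trans ?_ (h1 l)
  congr 1
  ring

lemma isDeriv_err₂ (h : Approx ω α a b c e u w U W q κ) (D : KamData ω α a b R η c₀ r₀)
    (hc : c ≤ η) (hr : r + 3 * η ≤ R) {ρ : ℝ} (hρ : 0 < ρ) (hr' : r' + ρ ≤ r) (hle : r' ≤ r) :
    IsDeriv ω (err₂ ω α b u w) (incl hle (comp ω (germDx ω b) u w) * incl hle U +
      (1 + incl hle (comp ω (germDy b) u w)) * incl hle W - incl hle (tau ω α r W)) := by
  have hd := h.inDomain hc hr
  have hx := D.small_b.bound_dx (R' := r + ‖u‖₊) D.freq D.η_pos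
    (by push_cast; linarith [hd.radius, hd.left, D.η_pos])
  have hy := D.small_b.bound_dy (R' := r + ‖u‖₊) D.η_pos
    (by push_cast; linarith [hd.radius, hd.left, D.η_pos])
  have hu := h.deriv_u.incl_right hle
  have hw := h.deriv_w.incl_right hle
  have hC := isDeriv_comp D.freq D.small_b.bound D.η_pos
    (by linarith [hd.radius, hd.left, D.η_pos]) (by linarith [hd.right, D.η_pos]) hρ hr' hle hu hw
  have h1 := (hw.add hC).sub (hw.tau α)
  rw [← incl_comp D.freq hx (by simp) (by linarith [hd.right, D.η_pos]),
    ← incl_comp D.freq hy (by simp) (by linarith [hd.right, D.η_pos]), ← incl_tau] at h1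
  simp only [map_sub, map_one] at h1
  refine fun l => Eq.trans ?_ (h1 l)
  congr 1
  ring

end Approx

end WA

/-! ### The Newton correction in the moving frame. -/

namespace WA

variable {r r₁ r₂ : ℝ≥0} {ω : ℕ+ → ℝ} {α η c : ℝ} {a b : Idx × ℕ → ℂ} {R : ℝ≥0}

lemma norm_incl_le_of {r r' : ℝ≥0} (h : r' ≤ r) {x : WA r} {C : ℝ} (hx : ‖x‖ ≤ C) :
    ‖incl h x‖ ≤ C := (norm_incl_le h x).trans hx

lemma norm_tau_le_of {r : ℝ≥0} {x : WA r} {C : ℝ} (hx : ‖x‖ ≤ C) : ‖tau ω α r x‖ ≤ C :=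
  (norm_tau_le x).trans hx

/-- Numerical constants in the estimates are absorbed by spending one further power of Λ. -/
lemma mul_pow_le_pow_succ {Λ x : ℝ} (hΛ : 10 ^ 5 ≤ Λ) (hx : 0 ≤ x) (n : ℕ) :
    10 ^ 5 * (Λ ^ n * x) ≤ Λ ^ (n + 1) * x := by
  rw [pow_succ' Λ n, mul_assoc]
  have : 0 ≤ Λ := by linarith
  gcongr

lemma norm_smul_one (c : ℂ) : ‖c • (1 : WA r)‖ = ‖c‖ := by rw [norm_smul, norm_one, mul_one]

/-- The normal component of the correction: a solution of the reduced normal equation whose mean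
value is adjusted to the tangential equation. -/
lemma exists_normal_tangent {ρ Λ e : ℝ} (L : Loss ω α ρ Λ) (h1 : r₁ + ρ ≤ r) (h2 : r₂ + ρ ≤ r₁)
    (hle1 : r₁ ≤ r) (hle2 : r₂ ≤ r₁) {x y g : WA r} {κ : ℝ} (hκ : |κ - 1| ≤ 1 / 100)
    (hx : IsReal x) (hy : IsReal y) (hg : IsReal g) (hxe : ‖x‖ ≤ 6 * e) (hye : ‖y‖ ≤ 2 * e)
    (hg1 : ‖g - 1‖ ≤ 1 / 2) (he : 0 ≤ e) :
    ∃ (n : WA r₁) (t : WA r₂) (k : ℂ), IsReal n ∧ IsReal t ∧ ‖n‖ ≤ 40 * Λ * e ∧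
      ‖t‖ ≤ 62 * Λ ^ 2 * e ∧
      (κ : ℂ) • n - tau ω α r₁ n = incl hle1 x + k • 1 ∧
      t - tau ω α r₂ t = incl hle2 (-incl hle1 y - incl hle1 g * n) := by
  have hΛ := L.large
  have hκ' := abs_le.1 hκ
  obtain ⟨s, hsr, -, hsn, hs⟩ := exists_solution L.divisors (by linarith) h1 hle1
    (by linarith : 1 / 4 ≤ κ) hx
  have hm1 : ‖g 0 - 1‖ ≤ 1 / 2 := by
    have := norm_coeff_le (g - 1) 0
    rw [sub_apply, one_apply_zero] at this
    linarith
  -- The mean of g is the averaged twist; it must not vanish, since the mean of the tangential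
  -- equation is divided by it.
  have hm : 1 / 2 ≤ ‖g 0‖ := by
    have := norm_sub_norm_le (1 : ℂ) (1 - g 0)
    rw [norm_one, norm_sub_rev, sub_sub_cancel] at this
    linarith
  have hgn : ‖g‖ ≤ 2 := (norm_le_of_sub_one hg1).trans (by norm_num)
  have hg0 : g 0 ≠ 0 := norm_pos_iff.1 (by linarith)
  set N : WA r₁ := incl hle1 y + incl hle1 g * s with hN
  have hNr : IsReal N := (hy.incl hle1).add ((hg.incl hle1).mul hsr)
  have hsn' : ‖s‖ ≤ 6 * Λ * e := hsn.trans (by nlinarith)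
  have hNn : ‖N‖ ≤ 2 * e + 2 * (6 * Λ * e) :=
    norm_add_le_of (norm_incl_le_of hle1 hye) (norm_mul_le_of (norm_incl_le_of hle1 hgn) hsn')
  have hΛe : 10 ^ 5 * e ≤ Λ * e := by gcongr
  -- The constant β is added to s so that y + g(s + β) has mean zero, which is the solvability
  -- condition for t.
  set β : ℝ := -((N 0).re / (g 0).re) with hβ
  have hβc : (β : ℂ) * g 0 = -N 0 := by
    have h3 : ((g 0).re : ℂ) ≠ 0 := by rwa [← hg.coeff_zero]
    rw [hg.coeff_zero, hNr.coeff_zero, hβ]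
    push_cast
    field_simp
  have hβn : ‖(β : ℂ)‖ ≤ 26 * Λ * e := by
    have h3 : ‖(β : ℂ)‖ * ‖g 0‖ = ‖N 0‖ := by rw [← norm_mul, hβc, norm_neg]
    have h4 := norm_coeff_le N 0
    nlinarith [norm_nonneg (β : ℂ)]
  set n : WA r₁ := s + (β : ℂ) • 1 with hn
  have hnr : IsReal n := hsr.add (IsReal.one.smul β)
  have hnn : ‖n‖ ≤ 32 * Λ * e := by
    have := norm_add_le_of hsn' ((norm_smul_one (r := r₁) (β : ℂ)).trans_le hβn)
    linarith
  set T : WA r₁ := -incl hle1 y - incl hle1 g * n with hT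
  have hTr : IsReal T := (hy.incl hle1).neg.sub ((hg.incl hle1).mul hnr)
  have hT0 : T 0 = 0 := by
    have h3 : T = -N - (β : ℂ) • incl hle1 g := by
      rw [hT, hN, hn, mul_add, mul_smul_comm, mul_one]; ring
    rw [h3, sub_apply, neg_apply, smul_apply, incl_apply, hβc]
    ring
  have hTn : ‖T‖ ≤ 62 * Λ * e := by
    have h3 : T = -N - (β : ℂ) • incl hle1 g := by
      rw [hT, hN, hn, mul_add, mul_smul_comm, mul_one]; ring
    rw [h3]
    have h4 : ‖(β : ℂ) • incl hle1 g‖ ≤ 26 * Λ * e * (3 / 2) := by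
      rw [norm_smul]
      have h5 := norm_incl_le_of hle1 (norm_le_of_sub_one hg1)
      gcongr
      linarith
    exact (norm_sub_le_of (norm_neg_le_of hNn) h4).trans (by nlinarith)
  obtain ⟨t, htr, -, htn, ht⟩ := exists_solution L.divisors (by linarith) h2 hle2
    (by norm_num : (1 / 4 : ℝ) ≤ 1) hTr
  -- The constant collects the unsolved mean of x and the effect of β, on which κ − translation acts
  -- as κ − 1.
  refine ⟨n, t, ((κ - 1) * β - x 0), hnr, htr, hnn.trans (by nlinarith), htn.trans ?_, ?_, ?_⟩
  · calc Λ * ‖T‖ ≤ Λ * (62 * Λ * e) := by gcongr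
      _ = _ := by ring
  · rw [hn, map_add, map_smul, map_one, smul_add, smul_smul, sub_smul, sub_mul, sub_smul, one_mul]
    linear_combination hs
  · rw [hT0, zero_smul, sub_zero, Complex.ofReal_one, one_smul] at ht
    exact ht

namespace Approx

variable {e κ ρ Λ c₀ : ℝ} {u w U W q : WA r} {r₀ : ℝ≥0}

set_option maxHeartbeats 1600000 in
/-- The Newton correction of an approximate invariant curve. Up to a constant the new error is
quadratic. -/
lemma exists_correction (h : Approx ω α a b c e u w U W q κ) (D : KamData ω α a b R η c₀ r₀)
    (L : Loss ω α ρ Λ) (hc : c ≤ c₀) (hr : r + 3 * η ≤ R) (h1 : r₁ + ρ ≤ r) (h2 : r₂ + ρ ≤ r₁)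
    (hle1 : r₁ ≤ r) (hle2 : r₂ ≤ r₁) (hsmall : 4 * (Λ ^ 3 * e) ≤ η) (he : 0 < e) :
    ∃ (û ŵ : WA r₂) (k : ℂ) (Y : WA r₂), IsReal û ∧ IsReal ŵ ∧ ‖û‖ ≤ Λ ^ 3 * e ∧
      ‖ŵ‖ ≤ Λ ^ 3 * e ∧
      ‖err₁ ω α a (incl (hle2.trans hle1) u + û) (incl (hle2.trans hle1) w + ŵ)‖ ≤
        2 * (Λ ^ 6 * e ^ 2) ∧
      incl (hle2.trans hle1) (tau ω α r U) *
        err₂ ω α b (incl (hle2.trans hle1) u + û) (incl (hle2.trans hle1) w + ŵ) =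
        incl (hle2.trans hle1) (tau ω α r q) * k • 1 + Y ∧
      ‖Y‖ ≤ Λ ^ 7 * e ^ 2 := by
  have hc1 : c ≤ 1 / 100 := hc.trans D.c₀_le
  have hd := h.inDomain (hc.trans D.c₀_le_η) hr
  have hle := hle2.trans hle1
  have hη := D.η_pos
  have hη1 := D.η_le
  have hΛ := L.large
  -- inverses
  have hUn : ‖U - 1‖ ≤ 1 / 100 := h.norm_U.trans hc1
  have hqn : ‖q - 1‖ ≤ 1 / 100 := h.norm_q.trans hc1
  obtain ⟨Ui, hUi, hUin⟩ := exists_inv (hUn.trans (by norm_num))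
  obtain ⟨qi, hqi, hqin⟩ := exists_inv (hqn.trans (by norm_num))
  have hUr : IsReal U := by
    have := (h.deriv_u.isReal h.real_u).add IsReal.one
    rwa [sub_add_cancel] at this
  have hWr : IsReal W := h.deriv_w.isReal h.real_w
  have hUir := hUr.inv hUi
  have hqir := h.real_q.inv hqi
  set Up := tau ω α r U
  set Upi := tau ω α r Ui
  set Wp := tau ω α r W
  set qp := tau ω α r q
  set qpi := tau ω α r qi
  have hUp : Up * Upi = 1 := by rw [← map_mul, hUi, map_one]
  have hqp : qp * qpi = 1 := by rw [← map_mul, hqi, map_one]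
  set Fx := comp ω (germDx ω a) u w
  set Fy := comp ω (germDy a) u w
  set Gx := comp ω (germDx ω b) u w
  set Gy := comp ω (germDy b) u w
  have hFx : ‖Fx‖ ≤ 1 / 100 := (D.small_a.norm_dx_le D.freq hη hd).trans (by linarith)
  have hFy : ‖Fy‖ ≤ 1 / 100 := (D.small_a.norm_dy_le D.freq hη hd).trans (by linarith)
  have hGx : ‖Gx‖ ≤ 1 / 100 := (D.small_b.norm_dx_le D.freq hη hd).trans (by linarith)
  have hGy : ‖Gy‖ ≤ 1 / 100 := (D.small_b.norm_dy_le D.freq hη hd).trans (by linarith)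
  have hreal : ∀ {a' : Idx × ℕ → ℂ}, SmallGerm a' R η → IsReal (comp ω a' u w) ∧
      IsReal (comp ω (germDy a') u w) := fun ha' =>
    ⟨isReal_comp D.freq ha'.bound (by linarith [hd.radius, hd.left]) (by linarith [hd.right])
      ha'.isReal h.real_u h.real_w, isReal_comp D.freq (ha'.bound_dy hη (R' := r + ‖u‖₊)
      (by push_cast; linarith [hd.radius, hd.left])) (by simp) (by linarith [hd.right])
      ha'.isReal.dy h.real_u h.real_w⟩
  have hE₁r : IsReal (err₁ ω α a u w) :=
    ((h.real_u.add h.real_w).add (hreal D.small_a).1).sub h.real_u.tau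
  have hE₂r : IsReal (err₂ ω α b u w) := (h.real_w.add (hreal D.small_b).1).sub h.real_w.tau
  have hFyr : IsReal Fy := (hreal D.small_a).2
  set E₁ := err₁ ω α a u w with hE₁
  set E₂ := err₂ ω α b u w with hE₂
  have hE₁n : ‖E₁‖ ≤ e := h.norm_err₁
  have hE₂n : ‖E₂‖ ≤ e := h.norm_err₂
  have hUpn : ‖Up‖ ≤ 101 / 100 :=
    norm_tau_le_of ((norm_le_of_sub_one hUn).trans (by norm_num))
  have hWpn : ‖Wp‖ ≤ 1 / 100 := norm_tau_le_of (h.norm_W.trans hc1)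
  have hqpin : ‖qpi‖ ≤ 2 := norm_tau_le_of hqin
  have hUpin : ‖Upi‖ ≤ 2 := norm_tau_le_of hUin
  -- the coefficient of the tangential equation
  have hg : ‖(1 + Fy) * q * (Ui * Upi) - 1‖ ≤ 1 / 2 := by
    have hF1 : ‖(1 + Fy) - 1‖ ≤ 1 / 100 := by rwa [add_sub_cancel_left]
    have hUi1 : ‖Ui - 1‖ ≤ 2 * (1 / 100) := norm_inv_sub_one_le hUn hUi hUin
    have hUpi1 : ‖Upi - 1‖ ≤ 2 * (1 / 100) := by
      have : Upi - 1 = tau ω α r (Ui - 1) := by rw [map_sub, map_one]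
      rw [this]
      exact norm_tau_le_of hUi1
    exact (norm_mul_sub_one_le (norm_mul_sub_one_le hF1 hqn)
      (norm_mul_sub_one_le hUi1 hUpi1)).trans (by norm_num)
  -- The error is resolved in the frame (U, W), (0, q/U): x is minus the determinant of the
  -- translated tangent with the error, divided by the translated q, while y and g are the error and
  -- the twist divided by the translated U.
  obtain ⟨n, t, k, hnr, htr, hnn, htn, hn, ht⟩ := exists_normal_tangent (e := e)
    (x := -(Up * E₂ - Wp * E₁) * qpi) (y := E₁ * Upi) (g := (1 + Fy) * q * (Ui * Upi))
    L h1 h2 hle1 hle2 (h.abs_κ.trans hc1)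
    (((hUr.tau.mul hE₂r).sub (hWr.tau.mul hE₁r)).neg.mul hqir.tau) (hE₁r.mul hUir.tau)
    (((IsReal.one.add hFyr).mul h.real_q).mul (hUir.mul hUir.tau))
    ((norm_mul_le_of (norm_neg_le_of (norm_sub_le_of (norm_mul_le_of hUpn hE₂n)
      (norm_mul_le_of hWpn hE₁n))) hqpin).trans (by linarith))
    ((norm_mul_le_of hE₁n hUpin).trans (by linarith)) hg he.le
  -- the corrections
  set û : WA r₂ := incl hle U * t with hû
  set ŵ : WA r₂ := incl hle W * t + incl hle q * incl hle2 n * incl hle Ui with hŵ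
  have p2 := mul_pow_le_pow_succ hΛ he.le 1
  have p3 := mul_pow_le_pow_succ hΛ he.le 2
  have q2 := mul_pow_le_pow_succ hΛ (sq_nonneg e) 1
  have q3 := mul_pow_le_pow_succ hΛ (sq_nonneg e) 2
  have q4 := mul_pow_le_pow_succ hΛ (sq_nonneg e) 3
  have q5 := mul_pow_le_pow_succ hΛ (sq_nonneg e) 4
  have q6 := mul_pow_le_pow_succ hΛ (sq_nonneg e) 5
  have q7 := mul_pow_le_pow_succ hΛ (sq_nonneg e) 6
  have p0 : 0 ≤ Λ ^ 2 * e := by positivity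
  have q0 : 0 ≤ Λ ^ 2 * e ^ 2 := by positivity
  simp only [Nat.reduceAdd, pow_one] at p2 p3 q2 q3 q4 q5 q6 q7
  have hUn2 : ‖U‖ ≤ 2 := (norm_le_of_sub_one hUn).trans (by norm_num)
  have hqn2 : ‖q‖ ≤ 2 := (norm_le_of_sub_one hqn).trans (by norm_num)
  have hqnUi : ‖incl hle q * incl hle2 n * incl hle Ui‖ ≤ 2 * (40 * Λ * e) * 2 :=
    norm_mul_le_of (norm_mul_le_of (norm_incl_le_of hle hqn2) (norm_incl_le_of hle2 hnn))
      (norm_incl_le_of hle hUin)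
  have hûn : ‖û‖ ≤ Λ ^ 3 * e :=
    (norm_mul_le_of (norm_incl_le_of hle hUn2) htn).trans (by linarith)
  have hŵn : ‖ŵ‖ ≤ Λ ^ 3 * e :=
    (norm_add_le_of (norm_mul_le_of (norm_incl_le_of hle (h.norm_W.trans hc1)) htn)
      hqnUi).trans (by linarith)
  have hûr : IsReal û := (hUr.incl hle).mul htr
  have hŵr : IsReal ŵ := ((hWr.incl hle).mul htr).add
    (((h.real_q.incl hle).mul (hnr.incl hle2)).mul (hUir.incl hle))
  -- the derivatives of the errors
  obtain ⟨dE₁', hdE₁', hdE₁n⟩ := exists_isDeriv D.freq L.pos h1 E₁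
  obtain ⟨dE₂', hdE₂', hdE₂n⟩ := exists_isDeriv D.freq L.pos h1 E₂
  have hz₁ := (h.isDeriv_err₁ D (hc.trans D.c₀_le_η) hr L.pos h1 hle1).unique hdE₁'
  have hz₂ := (h.isDeriv_err₂ D (hc.trans D.c₀_le_η) hr L.pos h1 hle1).unique hdE₂'
  set dE₁ := incl hle2 dE₁'
  set dE₂ := incl hle2 dE₂'
  have hdn : ∀ {x : WA r} {y : WA r₁}, ‖x‖ ≤ e → ‖y‖ ≤ ρ⁻¹ * ‖x‖ → ‖incl hle2 y‖ ≤ Λ * e :=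
    fun hx hy => norm_incl_le_of hle2 (hy.trans (by
      have := inv_pos.2 L.pos
      gcongr
      exact L.inv_le))
  have hdE₁n' : ‖dE₁‖ ≤ Λ * e := hdn hE₁n hdE₁n
  have hdE₂n' : ‖dE₂‖ ≤ Λ * e := hdn hE₂n hdE₂n
  -- From here every relation is restricted to the innermost strip, in the form required by the
  -- Newton identities.
  have i₁ : (1 + incl hle Fx) * incl hle U + (1 + incl hle Fy) * incl hle W - incl hle Up =
      dE₁ := by
    have := congrArg (incl hle2) hz₁
    simpa only [map_add, map_mul, map_sub, map_one, incl_incl] using this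
  have i₂ : incl hle Gx * incl hle U + (1 + incl hle Gy) * incl hle W - incl hle Wp = dE₂ := by
    have := congrArg (incl hle2) hz₂
    simpa only [map_add, map_mul, map_sub, map_one, incl_incl] using this
  have iU : incl hle U * incl hle Ui = 1 := by rw [← map_mul, hUi, map_one]
  have iUp : incl hle Up * incl hle Upi = 1 := by rw [← map_mul, hUp, map_one]
  have iqp : incl hle qp * incl hle qpi = 1 := by rw [← map_mul, hqp, map_one]
  have i₃ : ((1 + incl hle Fx) * (1 + incl hle Gy) - (1 + incl hle Fy) * incl hle Gx) *
      incl hle q - (κ : ℂ) • 1 * incl hle qp = incl hle (err₃ ω α a b u w q κ) := by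
    simp only [err₃, jac, map_sub, map_mul, map_add, map_one, map_smul, smul_mul_assoc, one_mul]
    rfl
  have ib : (κ : ℂ) • 1 * incl hle2 n - incl hle2 (tau ω α r₁ n) =
      -(incl hle Up * incl hle E₂ - incl hle Wp * incl hle E₁) * incl hle qpi + k • 1 := by
    have := congrArg (incl hle2) hn
    simpa only [map_add, map_mul, map_sub, map_neg, map_one, map_smul, incl_incl, smul_mul_assoc,
      one_mul] using this
  have ia : t - tau ω α r₂ t = (-incl hle E₁ - (1 + incl hle Fy) *
      (incl hle q * incl hle2 n * incl hle Ui)) * incl hle Upi := by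
    rw [ht]
    simp only [map_add, map_mul, map_sub, map_neg, map_one, incl_incl]
    ring
  have hτû : tau ω α r₂ û = incl hle Up * tau ω α r₂ t := by
    rw [hû, map_mul, ← incl_tau]
  have hτŵ : tau ω α r₂ ŵ = incl hle Wp * tau ω α r₂ t +
      incl hle qp * incl hle2 (tau ω α r₁ n) * incl hle Upi := by
    simp only [hŵ, map_add, map_mul, ← incl_tau]
    rfl
  have hd2 := hd.incl hle
  have hν : 0 < Λ ^ 3 * e := by have := pow_pos (show 0 < Λ by linarith) 3; positivity
  have hQ₁ := D.small_a.taylor D.freq hη hd2 hν hûn hŵn hsmall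
  have hQ₂ := D.small_b.taylor D.freq hη hd2 hν hûn hŵn hsmall
  have hcomp : ∀ {a' : Idx × ℕ → ℂ}, SmallGerm a' R η → comp ω a' (incl hle u) (incl hle w) =
      incl hle (comp ω a' u w) ∧
      comp ω (germDx ω a') (incl hle u) (incl hle w) = incl hle (comp ω (germDx ω a') u w) ∧
      comp ω (germDy a') (incl hle u) (incl hle w) = incl hle (comp ω (germDy a') u w) :=
    fun ha' => ⟨(incl_comp D.freq ha'.bound (by linarith [hd.radius, hd.left])
      (by linarith [hd.right]) hle).symm,
      (incl_comp D.freq (ha'.bound_dx D.freq hη (R' := r + ‖u‖₊)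
      (by push_cast; linarith [hd.radius, hd.left])) (by simp) (by linarith [hd.right]) hle).symm,
      (incl_comp D.freq (ha'.bound_dy hη (R' := r + ‖u‖₊)
      (by push_cast; linarith [hd.radius, hd.left])) (by simp) (by linarith [hd.right]) hle).symm⟩
  obtain ⟨ca, cax, cay⟩ := hcomp D.small_a
  obtain ⟨cb, cbx, cby⟩ := hcomp D.small_b
  rw [dcomp, ca, cax, cay] at hQ₁
  rw [dcomp, cb, cbx, cby] at hQ₂
  set Q₁ := comp ω a (incl hle u + û) (incl hle w + ŵ) - incl hle (comp ω a u w) -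
    (incl hle Fx * û + incl hle Fy * ŵ) with hQ₁d
  set Q₂ := comp ω b (incl hle u + û) (incl hle w + ŵ) - incl hle (comp ω b u w) -
    (incl hle Gx * û + incl hle Gy * ŵ) with hQ₂d
  -- The new first error consists of a correction times an error derivative and the Taylor
  -- remainder. No constant remains, because the tangential equation is solved exactly.
  have e₁ : err₁ ω α a (incl hle u + û) (incl hle w + ŵ) = t * dE₁ + Q₁ := by
    rw [← newton_first i₁ iUp ia, hQ₁d, err₁, map_add, hτû, hE₁, err₁]
    simp only [map_add, map_sub, incl_tau]
    ring
  have e₂ : incl hle Up * err₂ ω α b (incl hle u + û) (incl hle w + ŵ) =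
      incl hle qp * k • 1 + (incl hle (err₃ ω α a b u w q κ) * incl hle2 n +
        ((1 + incl hle Fy) * dE₂ - (1 + incl hle Gy) * dE₁) *
          (incl hle q * incl hle2 n * incl hle Ui) + incl hle Up * (t * dE₂) +
        incl hle Up * Q₂) := by
    have := newton_second i₁ i₂ iU iUp iqp i₃ ib ia
    have hX : err₂ ω α b (incl hle u + û) (incl hle w + ŵ) =
        incl hle E₂ + incl hle Gx * (incl hle U * t) + (1 + incl hle Gy) *
          (incl hle W * t + incl hle q * incl hle2 n * incl hle Ui) -
        (incl hle Wp * tau ω α r₂ t + incl hle qp * incl hle2 (tau ω α r₁ n) * incl hle Upi) +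
        Q₂ := by
      rw [hQ₂d, err₂, map_add (tau ω α r₂) (incl hle w) ŵ, hτŵ, hE₂, err₂]
      simp only [map_add, map_sub, incl_tau]
      ring
    rw [hX, mul_add, this]
    ring
  refine ⟨û, ŵ, k, _, hûr, hŵr, hûn, hŵn, ?_, e₂, ?_⟩
  · rw [e₁]
    refine (norm_add_le_of (norm_mul_le_of htn hdE₁n') hQ₁).trans ?_
    ring_nf at *
    linarith
  · have h1F : ‖1 + incl hle Fy‖ ≤ 2 :=
      (norm_add_le_of norm_one.le (norm_incl_le_of hle hFy)).trans (by norm_num)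
    have h1G : ‖1 + incl hle Gy‖ ≤ 2 :=
      (norm_add_le_of norm_one.le (norm_incl_le_of hle hGy)).trans (by norm_num)
    have hUpn' : ‖incl hle Up‖ ≤ 2 := norm_incl_le_of hle (hUpn.trans (by norm_num))
    refine (norm_add_le_of (norm_add_le_of (norm_add_le_of
      (norm_mul_le_of (norm_incl_le_of hle h.norm_err₃) (norm_incl_le_of hle2 hnn))
      (norm_mul_le_of (norm_sub_le_of (norm_mul_le_of h1F hdE₂n') (norm_mul_le_of h1G hdE₁n'))
        hqnUi))
      (norm_mul_le_of hUpn' (norm_mul_le_of htn hdE₂n'))) (norm_mul_le_of hUpn' hQ₂)).trans ?_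
    ring_nf at *
    linarith

end Approx

end WA

/-! ### One full step of the iteration. -/

namespace WA

variable {r r' r₁ r₂ r₃ : ℝ≥0} {ω : ℕ+ → ℝ} {α η c : ℝ} {a b : Idx × ℕ → ℂ} {R : ℝ≥0} {u w : WA r}

namespace SmallGerm

lemma isReal_dx (ha : SmallGerm a R η) (hω : ∀ i, |ω i| ≤ 1) (hη : 0 < η)
    (hd : InDomain R η u w) (hu : IsReal u) (hw : IsReal w) : IsReal (comp ω (germDx ω a) u w) :=
  WA.isReal_comp hω (ha.bound_dx hω hη (R' := r + ‖u‖₊)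
    (by push_cast; linarith [hd.radius, hd.left])) (by simp) (by linarith [hd.right])
    ha.isReal.dx hu hw

lemma isReal_dy (ha : SmallGerm a R η) (hω : ∀ i, |ω i| ≤ 1) (hη : 0 < η)
    (hd : InDomain R η u w) (hu : IsReal u) (hw : IsReal w) : IsReal (comp ω (germDy a) u w) :=
  WA.isReal_comp hω (ha.bound_dy hη (R' := r + ‖u‖₊)
    (by push_cast; linarith [hd.radius, hd.left])) (by simp) (by linarith [hd.right])
    ha.isReal.dy hu hw

lemma incl_comp (ha : SmallGerm a R η) (hω : ∀ i, |ω i| ≤ 1) (hη : 0 < η)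
    (hd : InDomain R η u w) (hr : r' ≤ r) :
    incl hr (comp ω a u w) = comp ω a (incl hr u) (incl hr w) :=
  WA.incl_comp hω ha.bound (by linarith [hd.radius, hd.left]) (by linarith [hd.right]) hr

lemma incl_dx (ha : SmallGerm a R η) (hω : ∀ i, |ω i| ≤ 1) (hη : 0 < η)
    (hd : InDomain R η u w) (hr : r' ≤ r) :
    incl hr (comp ω (germDx ω a) u w) = comp ω (germDx ω a) (incl hr u) (incl hr w) :=
  WA.incl_comp hω (ha.bound_dx hω hη (R' := r + ‖u‖₊)
    (by push_cast; linarith [hd.radius, hd.left])) (by simp) (by linarith [hd.right]) hr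

lemma incl_dy (ha : SmallGerm a R η) (hω : ∀ i, |ω i| ≤ 1) (hη : 0 < η)
    (hd : InDomain R η u w) (hr : r' ≤ r) :
    incl hr (comp ω (germDy a) u w) = comp ω (germDy a) (incl hr u) (incl hr w) :=
  WA.incl_comp hω (ha.bound_dy hη (R' := r + ‖u‖₊)
    (by push_cast; linarith [hd.radius, hd.left])) (by simp) (by linarith [hd.right]) hr

lemma incl_err₁ (ha : SmallGerm a R η) (hω : ∀ i, |ω i| ≤ 1) (hη : 0 < η)
    (hd : InDomain R η u w) (hr : r' ≤ r) :
    incl hr (err₁ ω α a u w) = err₁ ω α a (incl hr u) (incl hr w) := by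
  simp only [err₁, map_add, map_sub, ha.incl_comp hω hη hd hr, incl_tau]

lemma incl_err₂ (hb : SmallGerm b R η) (hω : ∀ i, |ω i| ≤ 1) (hη : 0 < η)
    (hd : InDomain R η u w) (hr : r' ≤ r) :
    incl hr (err₂ ω α b u w) = err₂ ω α b (incl hr u) (incl hr w) := by
  simp only [err₂, map_add, map_sub, hb.incl_comp hω hη hd hr, incl_tau]

lemma isReal_jac (ha : SmallGerm a R η) (hb : SmallGerm b R η) (hω : ∀ i, |ω i| ≤ 1) (hη : 0 < η)
    (hd : InDomain R η u w) (hu : IsReal u) (hw : IsReal w) : IsReal (jac ω a b u w) :=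
  ((IsReal.one.add (ha.isReal_dx hω hη hd hu hw)).mul
    (IsReal.one.add (hb.isReal_dy hω hη hd hu hw))).sub
    ((IsReal.one.add (ha.isReal_dy hω hη hd hu hw)).mul (hb.isReal_dx hω hη hd hu hw))

lemma incl_jac (ha : SmallGerm a R η) (hb : SmallGerm b R η) (hω : ∀ i, |ω i| ≤ 1) (hη : 0 < η)
    (hd : InDomain R η u w) (hr : r' ≤ r) :
    incl hr (jac ω a b u w) = jac ω a b (incl hr u) (incl hr w) := by
  simp only [jac, map_add, map_sub, map_mul, map_one, ha.incl_dx hω hη hd hr,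
    ha.incl_dy hω hη hd hr, hb.incl_dx hω hη hd hr, hb.incl_dy hω hη hd hr]

end SmallGerm

lemma norm_mul_sub_mul_le {A : Type*} [NormedCommRing A] {x x' y y' : A} {ν : ℝ}
    (hx : ‖x' - x‖ ≤ ν) (hy : ‖y' - y‖ ≤ ν) (hxn : ‖x‖ ≤ 2) (hyn : ‖y'‖ ≤ 2) :
    ‖x' * y' - x * y‖ ≤ 4 * ν := by
  have h : x' * y' - x * y = (x' - x) * y' + x * (y' - y) := by ring
  rw [h]
  exact (norm_add_le_of (norm_mul_le_of hx hyn) (norm_mul_le_of hxn hy)).trans (by linarith)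

lemma norm_jac_sub_le (ha : SmallGerm a R η) (hb : SmallGerm b R η) (hω : ∀ i, |ω i| ≤ 1)
    (hη : 0 < η) (hη1 : η ≤ 1) {h k : WA r} (hd : InDomain R η u w)
    (hd' : InDomain R η (u + h) (w + k)) {ν : ℝ} (hν : 0 < ν) (hh : ‖h‖ ≤ ν) (hk : ‖k‖ ≤ ν)
    (hνη : 4 * ν ≤ η) : ‖jac ω a b (u + h) (w + k) - jac ω a b u w‖ ≤ 8 * ν := by
  have hx : ∀ {a' : Idx × ℕ → ℂ} {u w : WA r}, SmallGerm a' R η → InDomain R η u w →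
      ‖comp ω (germDx ω a') u w‖ ≤ 1 := fun ha' h =>
    (ha'.norm_dx_le hω hη h).trans (by linarith)
  have hy : ∀ {a' : Idx × ℕ → ℂ} {u w : WA r}, SmallGerm a' R η → InDomain R η u w →
      ‖comp ω (germDy a') u w‖ ≤ 1 := fun ha' h =>
    (ha'.norm_dy_le hω hη h).trans (by linarith)
  have h1 : ∀ {x : WA r}, ‖x‖ ≤ 1 → ‖1 + x‖ ≤ 2 := fun hx =>
    (norm_add_le_of norm_one.le hx).trans (by norm_num)
  have hsub : ∀ {x y : WA r} {C : ℝ}, ‖y - x‖ ≤ C → ‖(1 + y) - (1 + x)‖ ≤ C := fun h => by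
    rwa [add_sub_add_left_eq_sub]
  have e1 := norm_mul_sub_mul_le (hsub (ha.lipschitz_dx hω hη hd hν hh hk hνη))
    (hsub (hb.lipschitz_dy hω hη hd hν hh hk hνη)) (h1 (hx ha hd)) (h1 (hy hb hd'))
  have e2 := norm_mul_sub_mul_le (hsub (ha.lipschitz_dy hω hη hd hν hh hk hνη))
    (hb.lipschitz_dx hω hη hd hν hh hk hνη) (h1 (hy ha hd)) ((hx hb hd').trans (by norm_num))
  have e3 : jac ω a b (u + h) (w + k) - jac ω a b u w = _ - _ := sub_sub_sub_comm _ _ _ _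
  rw [e3]
  exact (norm_sub_le_of e1 e2).trans (by linarith)

namespace Approx

variable {e κ ρ Λ c₀ : ℝ} {U W q : WA r} {r₀ : ℝ≥0}

/-- The Newton correction with both error components quadratic, by the intersection property. -/
lemma exists_curve (h : Approx ω α a b c e u w U W q κ) (D : KamData ω α a b R η c₀ r₀)
    (L : Loss ω α ρ Λ) (hr : r + 3 * η ≤ R) (h1 : r₁ + ρ ≤ r) (h2 : r₂ + ρ ≤ r₁)
    (hle1 : r₁ ≤ r) (hle2 : r₂ ≤ r₁) (hr₀ : r₀ ≤ r₂) (hsmall : 4 * (Λ ^ 3 * e) ≤ η) (he : 0 < e)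
    (hc : c + Λ ^ 3 * e ≤ c₀) :
    ∃ û ŵ : WA r₂, IsReal û ∧ IsReal ŵ ∧ ‖û‖ ≤ Λ ^ 3 * e ∧ ‖ŵ‖ ≤ Λ ^ 3 * e ∧
      ‖err₁ ω α a (incl (hle2.trans hle1) u + û) (incl (hle2.trans hle1) w + ŵ)‖ ≤
        Λ ^ 8 * e ^ 2 ∧
      ‖err₂ ω α b (incl (hle2.trans hle1) u + û) (incl (hle2.trans hle1) w + ŵ)‖ ≤
        Λ ^ 8 * e ^ 2 := by
  have hΛ := L.large
  have hΛ0 : 0 < Λ := by linarith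
  have hν : 0 < Λ ^ 3 * e := by positivity
  obtain ⟨û, ŵ, k, Y, hûr, hŵr, hûn, hŵn, e₁, e₂, hY⟩ :=
    h.exists_correction D L (by linarith) hr h1 h2 hle1 hle2 hsmall he
  have hle := hle2.trans hle1
  -- The crossing is taken on the corrected curve, whose first error is already quadratic.
  obtain ⟨ξ, hξ⟩ := D.crossing r₂ hr₀ (by linarith [L.pos]) _ _ ((h.real_u.incl hle).add hûr)
    ((h.real_w.incl hle).add hŵr)
    ((norm_add_le_of (norm_incl_le_of hle h.norm_u) hûn).trans hc)
    ((norm_add_le_of (norm_incl_le_of hle h.norm_w) hŵn).trans hc)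
  set E₁ := err₁ ω α a (incl hle u + û) (incl hle w + ŵ)
  set E₂ := err₂ ω α b (incl hle u + û) (incl hle w + ŵ)
  have hc1 : c ≤ 1 / 100 := by linarith [D.c₀_le]
  have hUn : ‖U - 1‖ ≤ 1 / 100 := h.norm_U.trans hc1
  have hqn : ‖q - 1‖ ≤ 1 / 100 := h.norm_q.trans hc1
  obtain ⟨Ui, hUi, hUin⟩ := exists_inv (hUn.trans (by norm_num))
  have q6 := mul_pow_le_pow_succ hΛ (sq_nonneg e) 6
  have q7 := mul_pow_le_pow_succ hΛ (sq_nonneg e) 7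
  simp only [Nat.reduceAdd] at q6 q7
  have q0 : 0 ≤ Λ ^ 6 * e ^ 2 := by positivity
  have hUp : ‖incl hle (tau ω α r U)‖ ≤ 2 :=
    norm_incl_le_of hle (norm_tau_le_of ((norm_le_of_sub_one hUn).trans (by norm_num)))
  have hqp1 : ‖incl hle (tau ω α r q) - 1‖ ≤ 1 / 100 := by
    have : incl hle (tau ω α r q) - 1 = incl hle (tau ω α r (q - 1)) := by
      simp only [map_sub, map_one]
    rw [this]
    exact norm_incl_le_of hle (norm_tau_le_of hqn)
  have hqp : ‖incl hle (tau ω α r q)‖ ≤ 2 := (norm_le_of_sub_one hqp1).trans (by norm_num)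
  have hqξ : 1 / 2 ≤ ‖ev ω ξ r₂ (incl hle (tau ω α r q))‖ := by
    have h3 : ‖ev ω ξ r₂ (incl hle (tau ω α r q)) - 1‖ ≤ 1 / 100 := by
      rw [← map_one (ev ω ξ r₂), ← map_sub]
      exact (norm_ev_le _).trans hqp1
    have h4 := norm_sub_norm_le (1 : ℂ) (1 - ev ω ξ r₂ (incl hle (tau ω α r q)))
    rw [norm_one, norm_sub_rev, sub_sub_cancel] at h4
    linarith
  -- At ξ the second error is bounded by the quadratic first one. Solving the second Newton relation
  -- there for the constant k, whose factor is close to 1, makes k quadratic.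
  have hk : ‖k‖ ≤ 4 * (Λ ^ 7 * e ^ 2) := by
    have h3 : ev ω ξ r₂ (incl hle (tau ω α r q)) * k =
        ev ω ξ r₂ (incl hle (tau ω α r U)) * ev ω ξ r₂ E₂ - ev ω ξ r₂ Y := by
      rw [← map_mul, e₂, map_add, map_mul, map_smul, map_one, smul_eq_mul, mul_one,
        add_sub_cancel_right]
    have h4 : ‖ev ω ξ r₂ (incl hle (tau ω α r q))‖ * ‖k‖ ≤
        2 * (2 * (Λ ^ 6 * e ^ 2)) + Λ ^ 7 * e ^ 2 := by
      rw [← norm_mul, h3]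
      exact norm_sub_le_of (norm_mul_le_of ((norm_ev_le _).trans hUp)
        (hξ.trans ((norm_ev_le _).trans e₁))) ((norm_ev_le _).trans hY)
    nlinarith [norm_nonneg k]
  refine ⟨û, ŵ, hûr, hŵr, hûn, hŵn, e₁.trans (by linarith), ?_⟩
  have hUi' : incl hle (tau ω α r U) * incl hle (tau ω α r Ui) = 1 := by
    rw [← map_mul, ← map_mul, hUi, map_one, map_one]
  have hE : E₂ = incl hle (tau ω α r Ui) * (incl hle (tau ω α r q) * k • 1 + Y) := by
    rw [← e₂]
    linear_combination (-E₂) * hUi'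
  change ‖E₂‖ ≤ _
  rw [hE]
  refine (norm_mul_le_of (norm_incl_le_of hle (norm_tau_le_of hUin)) (norm_add_le_of
    (norm_mul_le_of hqp ((norm_smul_one k).trans_le hk)) hY)).trans ?_
  linarith

set_option maxHeartbeats 800000 in
/-- One step of the iteration. -/
lemma exists_step (h : Approx ω α a b c e u w U W q κ) (D : KamData ω α a b R η c₀ r₀)
    (L : Loss ω α ρ Λ) (hr : r + 3 * η ≤ R) (h1 : r₁ + ρ ≤ r) (h2 : r₂ + ρ ≤ r₁)
    (h3 : r₃ + ρ ≤ r₂) (hle1 : r₁ ≤ r) (hle2 : r₂ ≤ r₁) (hle3 : r₃ ≤ r₂) (hr₀ : r₀ ≤ r₃)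
    (he : 0 < e) (hc0 : 0 ≤ c) (hc : c + Λ ^ 5 * e ≤ c₀) :
    ∃ (u' w' U' W' q' : WA r₃) (κ' : ℝ),
      Approx ω α a b (c + Λ ^ 5 * e) (Λ ^ 8 * e ^ 2) u' w' U' W' q' κ' ∧
      ‖u' - incl (hle3.trans (hle2.trans hle1)) u‖ ≤ Λ ^ 5 * e ∧
      ‖w' - incl (hle3.trans (hle2.trans hle1)) w‖ ≤ Λ ^ 5 * e := by
  have hΛ := L.large
  have hΛ0 : 0 < Λ := by linarith
  have hν : 0 < Λ ^ 3 * e := by positivity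
  have p4 := mul_pow_le_pow_succ hΛ he.le 3
  have p5 := mul_pow_le_pow_succ hΛ he.le 4
  have q7 := mul_pow_le_pow_succ hΛ (sq_nonneg e) 7
  simp only [Nat.reduceAdd] at p4 p5 q7
  have q0 : 0 ≤ Λ ^ 7 * e ^ 2 := by positivity
  have hη := D.η_pos
  have hcη := D.c₀_le_η
  have hsmall : 4 * (Λ ^ 3 * e) ≤ η := by linarith
  obtain ⟨û, ŵ, hûr, hŵr, hûn, hŵn, e₁, e₂⟩ :=
    h.exists_curve D L hr h1 h2 hle1 hle2 (hr₀.trans hle3) hsmall he (by linarith)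
  have hle := hle2.trans hle1
  set u₂ := incl hle u + û with hu₂
  set w₂ := incl hle w + ŵ with hw₂
  have hu₂r : IsReal u₂ := (h.real_u.incl hle).add hûr
  have hw₂r : IsReal w₂ := (h.real_w.incl hle).add hŵr
  have hu₂n : ‖u₂‖ ≤ c + Λ ^ 3 * e := norm_add_le_of (norm_incl_le_of hle h.norm_u) hûn
  have hw₂n : ‖w₂‖ ≤ c + Λ ^ 3 * e := norm_add_le_of (norm_incl_le_of hle h.norm_w) hŵn
  have hd := h.inDomain (by linarith) hr
  have hd2 := hd.incl hle
  have hd' : InDomain R η u₂ w₂ := ⟨hd2.radius, hu₂n.trans (by linarith), hw₂n.trans (by linarith)⟩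
  have hc1 : c ≤ 1 / 100 := by linarith [D.c₀_le]
  have hqn : ‖q - 1‖ ≤ 1 / 100 := h.norm_q.trans hc1
  have hqn2 : ‖q‖ ≤ 2 := (norm_le_of_sub_one hqn).trans (by norm_num)
  have hκ := abs_le.1 (h.abs_κ.trans hc1)
  obtain ⟨qi, hqi, hqin⟩ := exists_inv (hqn.trans (by norm_num))
  have hqir := h.real_q.inv hqi
  -- the defect of the reduction along the new curve
  set J := jac ω a b u₂ w₂ with hJ
  set M : WA r₂ := J * incl hle q - (κ : ℂ) • incl hle (tau ω α r q) with hM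
  have hMn : ‖M‖ ≤ 17 * (Λ ^ 3 * e) := by
    -- Moving the curve changes the Jacobian by first-order terms, so M has size Λ³e and not e²; the
    -- update of q and κ makes the final defect quadratic.
    have h4 : M = incl hle (err₃ ω α a b u w q κ) +
        (J - jac ω a b (incl hle u) (incl hle w)) * incl hle q := by
      rw [hM, err₃, map_sub, map_mul, map_smul, D.small_a.incl_jac D.small_b D.freq hη hd]
      ring
    rw [h4]
    have h5 := norm_jac_sub_le D.small_a D.small_b D.freq hη D.η_le hd2 hd' hν hûn hŵn hsmall
    refine (norm_add_le_of (norm_incl_le_of hle h.norm_err₃)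
      (norm_mul_le_of h5 (norm_incl_le_of hle hqn2))).trans ?_
    have : 1 * e ≤ Λ ^ 3 * e := by
      gcongr
      exact one_le_pow₀ (by linarith)
    linarith
  have hMr : IsReal M := ((D.small_a.isReal_jac D.small_b D.freq hη hd' hu₂r hw₂r).mul
    (h.real_q.incl hle)).sub ((h.real_q.tau.incl hle).smul κ)
  -- Divided by κ, the equation for z has left side z − z(· + α). Its right side x need not have
  -- mean zero, and the mean is absorbed into the change κ' of the constant.
  set x : WA r₂ := -(((κ⁻¹ : ℝ) : ℂ) • (M * incl hle (tau ω α r qi))) with hx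
  have hxr : IsReal x := ((hMr.mul (hqir.tau.incl hle)).smul _).neg
  have hxn : ‖x‖ ≤ 2 * (17 * (Λ ^ 3 * e) * 2) := by
    rw [hx, norm_neg, norm_smul, Complex.norm_real, Real.norm_eq_abs, abs_inv]
    have h4 : |κ|⁻¹ ≤ 2 := by
      rw [abs_of_pos (by linarith), inv_le_comm₀ (by linarith) (by norm_num)]
      linarith
    have h5 := norm_mul_le_of hMn (norm_incl_le_of hle (norm_tau_le_of (ω := ω) (α := α) hqin))
    gcongr
  obtain ⟨z, hzr, -, hzn, hz⟩ := exists_solution L.divisors hΛ0.le h3 hle3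
    (by norm_num : (1 / 4 : ℝ) ≤ 1) hxr
  rw [Complex.ofReal_one, one_smul] at hz
  have hzn' : ‖z‖ ≤ 68 * (Λ ^ 4 * e) := hzn.trans (by
    calc Λ * ‖x‖ ≤ Λ * (2 * (17 * (Λ ^ 3 * e) * 2)) := by gcongr
      _ = _ := by ring)
  set κ' : ℝ := -κ * (x 0).re with hκ'
  have hκ'c : (κ' : ℂ) = -κ * x 0 := by
    rw [hxr.coeff_zero, hκ']; push_cast; rfl
  have hκ'n : ‖(κ' : ℂ)‖ ≤ 2 * (2 * (17 * (Λ ^ 3 * e) * 2)) := by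
    rw [hκ'c, norm_mul, norm_neg, Complex.norm_real, Real.norm_eq_abs, abs_of_pos (by linarith)]
    exact mul_le_mul (by linarith) ((norm_coeff_le x 0).trans hxn) (norm_nonneg _) (by norm_num)
  have hκ'n' : |κ'| ≤ 136 * (Λ ^ 3 * e) := by
    rw [← Real.norm_eq_abs, ← Complex.norm_real]
    linarith
  -- everything on the final strip
  have hl := hle3.trans hle
  obtain ⟨dû, hdû, hdûn⟩ := exists_isDeriv D.freq L.pos h3 û
  obtain ⟨dŵ, hdŵ, hdŵn⟩ := exists_isDeriv D.freq L.pos h3 ŵ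
  have hder : ∀ {x : WA r₂} {y : WA r₃}, ‖x‖ ≤ Λ ^ 3 * e → ‖y‖ ≤ ρ⁻¹ * ‖x‖ →
      ‖y‖ ≤ Λ ^ 4 * e := fun hx hy => hy.trans (by
    have := inv_pos.2 L.pos
    calc _ ≤ Λ * (Λ ^ 3 * e) := by
          gcongr
          exact L.inv_le
      _ = _ := by ring)
  have hqz : ‖incl hl q * z‖ ≤ 2 * (68 * (Λ ^ 4 * e)) :=
    norm_mul_le_of (norm_incl_le_of hl hqn2) hzn'
  have hiu : incl hle3 u₂ - incl hl u = incl hle3 û := by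
    rw [hu₂, map_add, incl_incl, add_sub_cancel_left]
  have hiw : incl hle3 w₂ - incl hl w = incl hle3 ŵ := by
    rw [hw₂, map_add, incl_incl, add_sub_cancel_left]
  refine ⟨incl hle3 u₂, incl hle3 w₂, incl hl U + dû, incl hl W + dŵ, incl hl q * (1 + z), κ + κ',
    ⟨hu₂r.incl hle3, hw₂r.incl hle3, (h.real_q.incl hl).mul (IsReal.one.add hzr), ?_, ?_,
      norm_incl_le_of hle3 (by linarith), norm_incl_le_of hle3 (by linarith), ?_, ?_, ?_, ?_,
      ?_, ?_, ?_⟩, ?_, ?_⟩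
  · intro l
    have h4 := h.deriv_u l
    have h5 := hdû l
    simp only [sub_apply, hu₂, map_add, add_apply, incl_apply, h5] at h4 ⊢
    have h6 : (1 : WA r₃) l = (1 : WA r) l := by rw [one_apply, one_apply]
    rw [h6]
    linear_combination h4
  · intro l
    have h4 := h.deriv_w l
    have h5 := hdŵ l
    simp only [hw₂, map_add, add_apply, incl_apply, h5, h4]
    ring
  · have h4 : incl hl U + dû - 1 = incl hl (U - 1) + dû := by rw [map_sub, map_one]; ring
    rw [h4]
    exact (norm_add_le_of (norm_incl_le_of hl h.norm_U) (hder hûn hdûn)).trans (by linarith)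
  · exact (norm_add_le_of (norm_incl_le_of hl h.norm_W) (hder hŵn hdŵn)).trans (by linarith)
  · have h4 : incl hl q * (1 + z) - 1 = incl hl (q - 1) + incl hl q * z := by
      rw [map_sub, map_one]; ring
    rw [h4]
    exact (norm_add_le_of (norm_incl_le_of hl h.norm_q) hqz).trans (by linarith)
  · have h4 : κ + κ' - 1 = (κ - 1) + κ' := by ring
    rw [h4]
    exact (abs_add_le _ _).trans (by linarith [h.abs_κ])
  · rw [← D.small_a.incl_err₁ D.freq hη hd']
    exact norm_incl_le_of hle3 e₁
  · rw [← D.small_b.incl_err₂ D.freq hη hd']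
    exact norm_incl_le_of hle3 e₂
  · have hqp : incl hl (tau ω α r q) * incl hl (tau ω α r qi) = 1 := by
      rw [← map_mul, ← map_mul, hqi, map_one, map_one]
    have hM3 : incl hle3 J * incl hl q - (κ : ℂ) • 1 * incl hl (tau ω α r q) = incl hle3 M := by
      rw [hM, map_sub, map_mul, map_smul, incl_incl, incl_incl, smul_mul_assoc, one_mul]
    have hz3 : (κ : ℂ) • 1 * (z - tau ω α r₃ z) =
        (κ' : ℂ) • 1 - incl hle3 M * incl hl (tau ω α r qi) := by
      have hκ0 : (κ : ℂ) ≠ 0 := by exact_mod_cast (show κ ≠ 0 by linarith)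
      have h6 : (κ : ℂ) • incl hle3 x = -(incl hle3 M * incl hl (tau ω α r qi)) := by
        rw [hx, map_neg, map_smul, map_mul, incl_incl, smul_neg, smul_smul, Complex.ofReal_inv,
          mul_inv_cancel₀ hκ0, one_smul]
      rw [hz, smul_mul_assoc, one_mul, smul_sub, h6, smul_smul, hκ'c, neg_mul, neg_smul]
      ring
    -- What remains of the third error is M z and κ' q z, translated where needed, of order Λ³e ·
    -- Λ⁴e up to constants.
    have h4 := newton_third hM3 hz3 hqp
    have h5 : err₃ ω α a b (incl hle3 u₂) (incl hle3 w₂) (incl hl q * (1 + z)) (κ + κ') =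
        incl hle3 M * z - (κ' : ℂ) • 1 * incl hl (tau ω α r q) * tau ω α r₃ z := by
      rw [← h4, err₃, ← D.small_a.incl_jac D.small_b D.freq hη hd', map_mul, map_add, map_one,
        ← incl_tau, ← add_smul, Complex.ofReal_add, smul_mul_assoc, one_mul]
    rw [h5]
    refine (norm_sub_le_of (norm_mul_le_of (norm_incl_le_of hle3 hMn) hzn')
      (norm_mul_le_of (norm_mul_le_of ((norm_smul_one _).trans_le hκ'n)
        (norm_incl_le_of hl (norm_tau_le_of hqn2))) (norm_tau_le_of hzn'))).trans ?_
    ring_nf at q7 q0 ⊢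
    linarith
  · rw [hiu]
    exact norm_incl_le_of hle3 (hûn.trans (by linarith))
  · rw [hiw]
    exact norm_incl_le_of hle3 (hŵn.trans (by linarith))

end Approx

end WA

/-! ### Functions on the strip and the use of the intersection property. -/

namespace WA

variable {r r' : ℝ≥0} {ω : ℕ+ → ℝ} {α η c : ℝ} {a b : Idx × ℕ → ℂ} {R : ℝ≥0} {u w h : WA r}

/-- The almost periodic function with the given coefficients. -/
def toFun (ω : ℕ+ → ℝ) (x : WA r) (z : ℂ) : ℂ :=
  ∑' l, x l * Complex.exp (I * (freqPairing ω l : ℂ) * z)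

lemma hasFourierSeries_toFun (hω : ∀ i, |ω i| ≤ 1) (x : WA r) :
    HasFourierSeries ω r x (toFun ω x) := fun z hz => by
  refine (Summable.of_norm_bounded x.summable fun l => ?_).hasSum
  rw [norm_mul]
  gcongr
  rw [Complex.norm_exp, wt]
  refine Real.exp_le_exp.2 ?_
  have h1 : (I * (freqPairing ω l : ℂ) * z).re = -(freqPairing ω l * z.im) := by simp
  rw [h1]
  calc -(freqPairing ω l * z.im) ≤ |freqPairing ω l| * |z.im| := by
        rw [← abs_mul]; exact neg_le_abs _
    _ ≤ indexWeight l * r := by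
        gcongr
        · exact indexWeight_nonneg l
        · exact abs_freqPairing_le hω l
    _ = _ := mul_comm _ _

lemma coeffNorm_eq (x : WA r) : coeffNorm r x = ENNReal.ofReal ‖x‖ := by
  rw [norm_def, ENNReal.ofReal_tsum_of_nonneg (fun l => by have := wt_pos r l; positivity) x.summable]
  refine tsum_congr fun l => ?_
  rw [ENNReal.ofReal_mul (norm_nonneg _), ofReal_norm]
  rfl

lemma toFun_mem_AP (hω : ∀ i, |ω i| ≤ 1) (x : WA r) : toFun ω x ∈ AP ω r :=
  ⟨x, hasFourierSeries_toFun hω x, by rw [coeffNorm_eq]; exact ENNReal.ofReal_lt_top⟩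

lemma apNorm_toFun_le (hω : ∀ i, |ω i| ≤ 1) (x : WA r) :
    apNorm ω r (toFun ω x) ≤ ENNReal.ofReal ‖x‖ := by
  rw [← coeffNorm_eq]
  exact iInf₂_le (x : Idx → ℂ) (hasFourierSeries_toFun hω x)

lemma toFun_ofReal (x : WA r) (ξ : ℝ) : toFun ω x ξ = ev ω ξ r x := rfl

lemma realOnReals_toFun {x : WA r} (hx : IsReal x) : RealOnReals (toFun ω x) := fun ξ => by
  rw [toFun_ofReal]; exact hx.im_ev ω ξ

/-- Each character has Lipschitz constant |(ω, l)| ≤ r⁻¹e^(r‖l‖), and the weights sum these up. -/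
lemma norm_ev_sub_ev_le (hω : ∀ i, |ω i| ≤ 1) (hr : 0 < r) (x : WA r) (ξ ξ' : ℝ) :
    ‖ev ω ξ r x - ev ω ξ' r x‖ ≤ (r : ℝ)⁻¹ * ‖x‖ * |ξ - ξ'| := by
  have hs : ∀ ξ : ℝ, HasSum (fun l => x l * Complex.exp (I * (freqPairing ω l : ℝ) * ξ))
      (ev ω ξ r x) := fun ξ => by
    have := hasFourierSeries_toFun hω x ξ (by simpa using hr)
    exact this
  have h1 := (hs ξ).sub (hs ξ')
  rw [← h1.tsum_eq]
  have h2 : HasSum (fun l => (r : ℝ)⁻¹ * (‖x l‖ * wt r l) * |ξ - ξ'|)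
      ((r : ℝ)⁻¹ * ‖x‖ * |ξ - ξ'|) := by
    have := (x.summable.hasSum.mul_left (r : ℝ)⁻¹).mul_right |ξ - ξ'|
    rwa [← norm_def] at this
  refine tsum_of_norm_bounded h2 fun l => ?_
  have hr' : (0 : ℝ) < r := hr
  rw [← mul_sub, norm_mul]
  have h3 : ‖Complex.exp (I * (freqPairing ω l : ℝ) * ξ) -
      Complex.exp (I * (freqPairing ω l : ℝ) * ξ')‖ ≤ |freqPairing ω l| * |ξ - ξ'| := by
    have h4 : Complex.exp (I * (freqPairing ω l : ℝ) * ξ) -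
        Complex.exp (I * (freqPairing ω l : ℝ) * ξ') =
        Complex.exp (I * (freqPairing ω l : ℝ) * ξ') *
          (Complex.exp (I * (freqPairing ω l * (ξ - ξ') : ℝ)) - 1) := by
      rw [mul_sub, ← Complex.exp_add, mul_one]
      congr 2
      push_cast
      ring
    rw [h4, norm_mul, norm_cexp_mul_I, one_mul, ← abs_mul]
    exact Real.norm_exp_I_mul_ofReal_sub_one_le
  have h5 : |freqPairing ω l| ≤ (r : ℝ)⁻¹ * wt r l := by
    rw [inv_mul_eq_div, le_div_iff₀ hr', wt]
    have := abs_freqPairing_le hω l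
    nlinarith [Real.add_one_le_exp (r * indexWeight l)]
  calc ‖x l‖ * _ ≤ ‖x l‖ * (((r : ℝ)⁻¹ * wt r l) * |ξ - ξ'|) := by
        gcongr
        exact h3.trans (by gcongr)
    _ = _ := by ring

/-- A function of `x` as a germ that does not depend on `y`. -/
def constGerm (x : WA r) (j : Idx × ℕ) : ℂ := if j.2 = 0 then x j.1 else 0

lemma constGerm_injective : Function.Injective fun l : Idx => (l, (0 : ℕ)) :=
  fun _ _ h => (Prod.mk.inj h).1

lemma hasSum_constGerm_iff {E : Type*} [AddCommMonoid E] [TopologicalSpace E]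
    {F : Idx × ℕ → E} (hF : ∀ l k, k ≠ 0 → F (l, k) = 0) {y : E} :
    HasSum F y ↔ HasSum (fun l => F (l, 0)) y := by
  rw [← constGerm_injective.hasSum_iff (f := F)]
  · rfl
  · rintro ⟨l, k⟩ hlk
    refine hF l k fun hk => hlk ⟨l, ?_⟩
    simp [hk]

lemma germBound_constGerm (x : WA r) (s : ℝ) : GermBound (constGerm x) r s ‖x‖ := by
  have h1 : HasSum (fun j => ‖constGerm x j‖ * (s ^ j.2 * wt r j.1)) ‖x‖ := by
    rw [hasSum_constGerm_iff]
    · rw [norm_def]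
      simpa [constGerm] using x.summable.hasSum
    · intro l k hk
      simp [constGerm, hk]
  exact ⟨h1.summable, h1.tsum_eq.le⟩

lemma realGerm_constGerm {x : WA r} (hx : IsReal x) : RealGerm (constGerm x) := fun l k => by
  have h1 : conj (x l) = x (-l) := by
    have := conjHom_apply x (-l)
    rw [hx, neg_neg] at this
    exact this.symm
  by_cases hk : k = 0
  · simp [constGerm, hk, h1]
  · simp [constGerm, hk]

lemma ev_comp_constGerm (hω : ∀ i, |ω i| ≤ 1) (x : WA r) {h : WA r'} (hh : r' + ‖h‖ ≤ r)
    (hr : IsReal h) (ξ : ℝ) :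
    ev ω ξ r' (comp ω (constGerm x) h 0) = ev ω (ξ + (ev ω ξ r' h).re) r x := by
  have h1 := ev_comp (w := (0 : WA r')) hω (germBound_constGerm x 0) hh (by simp) ξ
  rw [hasSum_constGerm_iff (fun l k hk => by simp [constGerm, hk])] at h1
  rw [← h1.tsum_eq, ev_eq_tsum]
  refine tsum_congr fun l => ?_
  simp only [constGerm, if_true, pow_zero, mul_one]
  rw [Complex.ofReal_add, ← hr.ev_eq, smul_eq_mul]

/-- The series with coefficients `a` represents `f` near the line `y = α`. -/
def Represents (ω : ℕ+ → ℝ) (α s : ℝ) (a : Idx × ℕ → ℂ) (f : ℂ → ℂ → ℂ) : Prop :=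
  ∀ x y : ℝ, |y| ≤ s → HasSum (fun j : Idx × ℕ => a j * (y : ℂ) ^ j.2 *
    Complex.exp (I * freqPairing ω j.1 * x)) (f x (α + y : ℝ))

lemma Represents.ev_comp {f : ℂ → ℂ → ℂ} (hf : Represents ω α (3 * η) a f)
    (ha : SmallGerm a R η) (hω : ∀ i, |ω i| ≤ 1) (hη : 0 < η)
    (hd : InDomain R η u w) (hu : IsReal u) (hw : IsReal w) (ξ : ℝ) :
    ev ω ξ r (comp ω a u w) = f (ξ + ev ω ξ r u) (α + ev ω ξ r w) := by
  have h1 := WA.ev_comp hω ha.bound (by linarith [hd.radius, hd.left])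
    (show ‖w‖ ≤ 3 * η by linarith [hd.right]) ξ (u := u)
  have hwn : |(ev ω ξ r w).re| ≤ 3 * η :=
    (Complex.abs_re_le_norm _).trans ((norm_ev_le w).trans (by linarith [hd.right]))
  have h2 := hf (ξ + (ev ω ξ r u).re) _ hwn
  push_cast at h2
  rw [← hu.ev_eq, ← hw.ev_eq] at h2
  exact h1.unique h2

/-- A fixed point of h ↦ −u(x + h(x)) makes x + h(x) a right inverse of ξ + u(ξ). With half the
strip given up, of which r/4 serves as Cauchy margin, the map contracts the ball of radius c by the
factor 16c/r ≤ 1/4. -/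
lemma exists_inverse (hω : ∀ i, |ω i| ≤ 1) (hr : 0 < r) (hr' : (r' : ℝ) = r / 2) {u : WA r}
    (hu : IsReal u) {c : ℝ} (hc : 64 * c ≤ r) (huc : ‖u‖ ≤ c) :
    ∃ h : WA r', IsReal h ∧ ‖h‖ ≤ c ∧ h = -comp ω (constGerm u) h 0 := by
  have hr0 : (0 : ℝ) < r := hr
  have hc0 : 0 ≤ c := (norm_nonneg u).trans huc
  set Φ : WA r' → WA r' := fun h => -comp ω (constGerm u) h 0 with hΦ
  set S : Set (WA r') := {h | ‖h‖ ≤ c ∧ IsReal h} with hS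
  have hSc : IsComplete S := by
    refine (IsClosed.inter ?_ ?_).isComplete
    · exact isClosed_le continuous_norm continuous_const
    · exact isClosed_eq continuous_conjHom continuous_id
  have hb := germBound_constGerm u (r / 4)
  have hmaps : Set.MapsTo Φ S S := by
    rintro h ⟨hn, hre⟩
    refine ⟨?_, (isReal_comp hω hb (by linarith) (by simp; linarith) (realGerm_constGerm hu) hre
      IsReal.zero).neg⟩
    rw [hΦ, norm_neg]
    exact (norm_comp_le hω hb (by linarith) (by simp; linarith)).trans huc
  have hcontr : ContractingWith (1 / 2) (hmaps.restrict Φ S S) := by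
    refine ⟨by rw [← NNReal.coe_lt_coe]; norm_num, LipschitzWith.of_dist_le_mul ?_⟩
    rintro ⟨x, hx⟩ ⟨y, hy⟩
    simp only [Set.MapsTo.restrict, Subtype.map, Subtype.dist_eq, dist_eq_norm]
    by_cases hxy : x = y
    · simp [hxy]
    have hpos : 0 < ‖x - y‖ := norm_pos_iff.2 (sub_ne_zero.2 hxy)
    have hxyn : ‖x - y‖ ≤ 2 * c := (norm_sub_le x y).trans (by linarith [hx.1, hy.1])
    have h1 := norm_comp_sub_le (u := y) (w := (0 : WA r')) (h := x - y) (k := 0) (η := r / 4) hω hb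
      (by linarith) (by linarith [hy.1]) (by simp) hpos le_rfl (by simp) (by linarith)
    rw [add_sub_cancel, add_zero] at h1
    have h2 : Φ x - Φ y = -(comp ω (constGerm u) x 0 - comp ω (constGerm u) y 0) := by
      simp only [hΦ]; ring
    rw [h2, norm_neg]
    refine h1.trans ?_
    rw [div_le_iff₀ (by linarith)]
    push_cast
    nlinarith
  obtain ⟨h, hhS, hh, -⟩ := hcontr.exists_fixedPoint' hSc hmaps (x := 0)
    ⟨by simpa using hc0, IsReal.zero⟩ (edist_ne_top _ _)
  exact ⟨h, hhS.2, hhS.1, hh.symm⟩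

/-- The intersection property bounds the second error by the first one at some point. -/
lemma crossing_of_intersection {f g : ℂ → ℂ → ℂ} {s₀ : ℝ} {r₀ : ℝ≥0} (hω : ∀ i, |ω i| ≤ 1)
    (hη : 0 < η) (ha : SmallGerm a R η) (hb : SmallGerm b R η)
    (hf : Represents ω α (3 * η) a f) (hg : Represents ω α (3 * η) b g)
    (hs₀ : η < s₀) (hr₀ : 0 < r₀) (hcη : c ≤ η) (hcr : 64 * c ≤ r₀)
    (hint : HasIntersectionProperty ω α s₀ f g) : Crossing ω α a b R η c r₀ := by
  intro r hr hrR u w hu hw huc hwc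
  have hrr₀ : (r₀ : ℝ) ≤ r := hr
  have hr0 : (0 : ℝ) < r₀ := hr₀
  have hrpos : 0 < r := hr₀.trans_le hr
  have hd : InDomain R η u w := ⟨hrR, huc.trans hcη, hwc.trans hcη⟩
  obtain ⟨h, hhr, hhc, hh⟩ := exists_inverse (r' := r / 2) hω hrpos (by simp) hu
    (hcr.trans hrr₀) huc
  have hhn : ((r / 2 : ℝ≥0) : ℝ) + ‖h‖ ≤ r := by push_cast; linarith
  -- The parametrised curve is rewritten as a graph over x, the form to which the intersection
  -- property applies; Ξ recovers the parameter from x.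
  set ψ : WA (r / 2) := (α : ℂ) • 1 + comp ω (constGerm w) h 0 with hψ
  have hψr : IsReal ψ := (IsReal.one.smul α).add (isReal_comp hω (germBound_constGerm w 0) hhn
    (by simp) (realGerm_constGerm hw) hhr IsReal.zero)
  set Ξ : ℝ → ℝ := fun x => x + (ev ω x (r / 2) h).re with hΞ
  have hψx : ∀ x : ℝ, toFun ω ψ x = α + ev ω (Ξ x) r w := fun x => by
    rw [toFun_ofReal, hψ, map_add, map_smul, map_one, smul_eq_mul, mul_one,
      ev_comp_constGerm hω w hhn hhr]
  have hΞx : ∀ x : ℝ, (Ξ x : ℂ) + ev ω (Ξ x) r u = x := fun x => by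
    have h1 : ev ω x (r / 2) h = -ev ω (Ξ x) r u := by
      conv_lhs => rw [hh]
      rw [map_neg, ev_comp_constGerm hω u hhn hhr]
    have h2 : (Ξ x : ℂ) = x + ev ω x (r / 2) h := by
      rw [hhr.ev_eq]
      exact Complex.ofReal_add _ _
    rw [h2, h1]
    ring
  obtain ⟨p, ⟨-, ⟨x, rfl⟩, hx⟩, ⟨x', hx'⟩⟩ := hint (toFun ω ψ)
    ⟨_, by exact_mod_cast half_pos hrpos, toFun_mem_AP hω ψ⟩ (realOnReals_toFun hψr) (fun x => by
      rw [mem_ball_iff_norm, hψx, add_sub_cancel_left]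
      exact (norm_ev_le w).trans_lt (by linarith))
  rw [← hx'] at hx
  simp only [twistMap, id, Prod.mk.injEq] at hx
  obtain ⟨hx1, hx2⟩ := hx
  set ξ := Ξ x with hξ
  set ξ' := Ξ x' with hξ'
  have k1 := hf.ev_comp ha hω hη hd hu hw ξ
  have k2 := hg.ev_comp hb hω hη hd hu hw ξ
  rw [hΞx, ← hψx] at k1 k2
  -- The image of the point with parameter ξ is the point with parameter ξ', whereas exact conjugacy
  -- would give ξ + α. Both errors at ξ are therefore differences between the curve at ξ' and at ξ +
  -- α.
  have E1 : ev ω ξ r (err₁ ω α a u w) =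
      ((ξ' - (ξ + α) : ℝ) : ℂ) + (ev ω ξ' r u - ev ω (ξ + α) r u) := by
    simp only [err₁, map_add, map_sub, ev_tau, k1]
    have l1 := hΞx x
    have l2 := hΞx x'
    have l3 := hψx x
    push_cast
    linear_combination hx1 - l3 + l1 - l2
  have E2 : ev ω ξ r (err₂ ω α b u w) = ev ω ξ' r w - ev ω (ξ + α) r w := by
    simp only [err₂, map_add, map_sub, ev_tau, k2]
    have l3 := hψx x
    have l4 := hψx x'
    linear_combination hx2 - l3 + l4
  refine ⟨ξ, ?_⟩
  -- With Lipschitz constants at most 1/2 for u and w, the second error is at most |ξ' − ξ − α|/2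
  -- and the first at least that.
  have hL : ∀ x : WA r, ‖x‖ ≤ c → ‖ev ω ξ' r x - ev ω (ξ + α) r x‖ ≤
      1 / 2 * |ξ' - (ξ + α)| := fun x hx => by
    refine (norm_ev_sub_ev_le hω hrpos x _ _).trans ?_
    gcongr
    rw [inv_mul_le_iff₀ (by linarith)]
    linarith [norm_nonneg x]
  rw [E1, E2]
  have h1 := norm_sub_norm_le ((ξ' - (ξ + α) : ℝ) : ℂ) (-(ev ω ξ' r u - ev ω (ξ + α) r u))
  rw [sub_neg_eq_add, norm_neg, Complex.norm_real, Real.norm_eq_abs] at h1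
  linarith [hL u huc, hL w hwc]

end WA

/-! ### Convergence of the iteration. -/

open Filter Topology

lemma SmallDivisors.mono {ω : ℕ+ → ℝ} {α ρ Λ Λ' : ℝ} (h : SmallDivisors ω α ρ Λ) (hΛ : Λ ≤ Λ') :
    SmallDivisors ω α ρ Λ' := fun κ hκ l hl => (h κ hκ l hl).trans (by gcongr)

lemma exists_dependent_sequence {S : ℕ → Type*} {P : ∀ n, S n → S (n + 1) → Prop}
    (h : ∀ n s, ∃ s', P n s s') (s₀ : S 0) : ∃ s : ∀ n, S n, s 0 = s₀ ∧ ∀ n, P n (s n) (s (n + 1)) := by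
  choose f hf using h
  exact ⟨fun n => Nat.rec s₀ f n, rfl, fun n => hf n _⟩

namespace WA

/-- Raising K by 1 gains the factor exp(ρ⁻⁵), which exceeds ρ⁻¹, exceeds γ⁻¹ once ρ ≤ γ, and exceeds
10⁵ once ρ ≤ 1/10. One exponential then controls every loss. -/
lemma exists_loss {γ μ : ℝ} (hγ : 0 < γ) (hμ : 0 < μ) : ∃ K, 0 < K ∧ ∃ ρ₁, 0 < ρ₁ ∧
    ∀ (ω : ℕ+ → ℝ) (α : ℝ), IsNonresonant ω γ μ α → ∀ ρ, 0 < ρ → ρ ≤ ρ₁ →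
      Loss ω α ρ (Real.exp (K / ρ ^ 5)) := by
  obtain ⟨K, hK, h⟩ := exists_smallDivisors hγ hμ
  refine ⟨K + 1, by linarith, min (1 / 10) γ, by positivity, fun ω α hα ρ hρ hρ₁ => ?_⟩
  have h10 : ρ ≤ 1 / 10 := hρ₁.trans (min_le_left _ _)
  have hργ : ρ ≤ γ := hρ₁.trans (min_le_right _ _)
  have h5 : ρ⁻¹ ≤ (ρ ^ 5)⁻¹ := by
    rw [inv_le_inv₀ hρ (by positivity)]
    calc ρ ^ 5 ≤ ρ ^ 1 := pow_le_pow_of_le_one hρ.le (by linarith) (by norm_num)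
      _ = ρ := pow_one ρ
  have hexp := Real.add_one_le_exp ((ρ ^ 5)⁻¹)
  have hsplit : Real.exp ((K + 1) / ρ ^ 5) = Real.exp ((ρ ^ 5)⁻¹) * Real.exp (K / ρ ^ 5) := by
    rw [← Real.exp_add]
    congr 1
    ring
  have hone : 1 ≤ Real.exp (K / ρ ^ 5) := Real.one_le_exp (by positivity)
  have hlow : ∀ x : ℝ, x ≤ (ρ ^ 5)⁻¹ → x ≤ Real.exp ((ρ ^ 5)⁻¹) * Real.exp (K / ρ ^ 5) :=
    fun x hx => (hx.trans (by linarith)).trans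
      (le_mul_of_one_le_right (Real.exp_pos _).le hone)
  rw [hsplit]
  refine ⟨hρ, hlow _ h5, hlow _ ?_, (h ω α hα ρ hρ).mono ?_⟩
  · rw [le_inv_comm₀ (by positivity) (by positivity)]
    calc ρ ^ 5 ≤ (1 / 10) ^ 5 := by gcongr
      _ = _ := by norm_num
  · gcongr
    have : γ⁻¹ ≤ ρ⁻¹ := by gcongr
    linarith

variable {r r' : ℝ≥0} {ω : ℕ+ → ℝ} {α η c c' e e' d κ : ℝ} {a b : Idx × ℕ → ℂ} {R : ℝ≥0}
  {u w U W q : WA r}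

lemma Approx.mono (h : Approx ω α a b c e u w U W q κ) (hc : c ≤ c') (he : e ≤ e') :
    Approx ω α a b c' e' u w U W q κ where
  real_u := h.real_u
  real_w := h.real_w
  real_q := h.real_q
  deriv_u := h.deriv_u
  deriv_w := h.deriv_w
  norm_u := h.norm_u.trans hc
  norm_w := h.norm_w.trans hc
  norm_U := h.norm_U.trans hc
  norm_W := h.norm_W.trans hc
  norm_q := h.norm_q.trans hc
  abs_κ := h.abs_κ.trans hc
  norm_err₁ := h.norm_err₁.trans he
  norm_err₂ := h.norm_err₂.trans he
  norm_err₃ := h.norm_err₃.trans he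

/-- The unperturbed curve is an approximate invariant curve. -/
lemma approx_zero (hω : ∀ i, |ω i| ≤ 1) (hη : 0 < η) (hη1 : η ≤ 1)
    (ha : GermBound a R (3 * η) d) (hb : GermBound b R (3 * η) d) (hr : r + 3 * η ≤ R)
    (hd : 5 * d ≤ η * e) (he : e ≤ 1) :
    Approx ω α a b 0 e (0 : WA r) (0 : WA r) (1 : WA r) (0 : WA r) (1 : WA r) 1 := by
  have hd0 : 0 ≤ d := ha.nonneg (by positivity)
  have hη' : 0 < η⁻¹ := inv_pos.2 hη
  have hy : 5 * (η⁻¹ * d) ≤ e := by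
    rw [show 5 * (η⁻¹ * d) = η⁻¹ * (5 * d) by ring, inv_mul_le_iff₀ hη]
    exact hd
  have hy0 : 0 ≤ η⁻¹ * d := by positivity
  have hde : d ≤ e := by nlinarith
  have hu : (r : ℝ) + ‖(0 : WA r)‖ ≤ R := by rw [norm_zero]; linarith
  have hs : ‖(0 : WA r)‖ ≤ 3 * η := by rw [norm_zero]; linarith
  have hs2 : ‖(0 : WA r)‖ ≤ 2 * η := by rw [norm_zero]; linarith
  have hu0 : (r : ℝ) + ‖(0 : WA r)‖ ≤ r := by rw [norm_zero, add_zero]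
  have hx' : ∀ {a : Idx × ℕ → ℂ}, GermBound a R (3 * η) d →
      ‖comp ω (germDx ω a) (0 : WA r) (0 : WA r)‖ ≤ η⁻¹ * d := fun ha =>
    norm_comp_le hω (ha.dx hω (by positivity) hη (by linarith)) hu0 hs
  have hy' : ∀ {a : Idx × ℕ → ℂ}, GermBound a R (3 * η) d →
      ‖comp ω (germDy a) (0 : WA r) (0 : WA r)‖ ≤ η⁻¹ * d := fun ha =>
    norm_comp_le hω (ha.dy (s' := 2 * η) (by positivity) hη (by linarith)) hu hs2
  refine ⟨IsReal.zero, IsReal.zero, IsReal.one, fun l => by simp, fun l => by simp, by simp,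
    by simp, by simp, by simp, by simp, by simp, ?_, ?_, ?_⟩
  · simpa [err₁] using (norm_comp_le hω ha hu hs).trans hde
  · simpa [err₂] using (norm_comp_le hω hb hu hs).trans hde
  · have hone : η⁻¹ * d ≤ 1 := by linarith
    -- With q = κ = 1 the third error is the Jacobian minus 1: three linear and two quadratic terms
    -- in derivatives of size d/η ≤ 1, hence the factor 5 in the smallness condition.
    have h1 : err₃ ω α a b (0 : WA r) 0 1 1 = comp ω (germDx ω a) 0 0 + comp ω (germDy b) 0 0 +
        comp ω (germDx ω a) 0 0 * comp ω (germDy b) 0 0 - (comp ω (germDx ω b) 0 0 +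
        comp ω (germDy a) 0 0 * comp ω (germDx ω b) 0 0) := by
      simp only [err₃, jac, map_one, Complex.ofReal_one, one_smul, mul_one]
      ring
    rw [h1]
    refine (norm_sub_le_of (norm_add_le_of (norm_add_le_of (hx' ha) (hy' hb))
      (norm_mul_le_of (hx' ha) (hy' hb)))
      (norm_add_le_of (hx' hb) (norm_mul_le_of (hy' ha) (hx' hb)))).trans ?_
    nlinarith

lemma SmallGerm.tendsto_comp (ha : SmallGerm a R η) (hω : ∀ i, |ω i| ≤ 1) (hη : 0 < η)
    (hη1 : η ≤ 1) (hd : InDomain R η u w) {x y : ℕ → WA r} (hx : Tendsto x atTop (𝓝 u))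
    (hy : Tendsto y atTop (𝓝 w)) :
    Tendsto (fun n => comp ω a (x n) (y n)) atTop (𝓝 (comp ω a u w)) := by
  rw [Metric.tendsto_atTop'] at hx hy ⊢
  intro ε hε
  have hν : 0 < min (ε / 2) (η / 4) := by positivity
  obtain ⟨N, hN⟩ := hx _ hν
  obtain ⟨M, hM⟩ := hy _ hν
  refine ⟨max N M, fun n hn => ?_⟩
  have h1 := hN n ((le_max_left _ _).trans_lt hn)
  have h2 := hM n ((le_max_right _ _).trans_lt hn)
  rw [dist_eq_norm] at h1 h2 ⊢
  have h3 := ha.lipschitz hω hη hη1 hd hν h1.le h2.le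
    (by linarith [min_le_right (ε / 2) (η / 4)])
  rw [add_sub_cancel, add_sub_cancel] at h3
  linarith [min_le_left (ε / 2) (η / 4)]

/-- Convergence of the iteration. -/
theorem exists_invariant_curve {r₀ : ℝ≥0} {c₀ K : ℝ} {ρ₀ : ℝ≥0} (D : KamData ω α a b R η c₀ r₀)
    (hK : 0 < K) (hρ₀ : 0 < ρ₀)
    (hL : ∀ ρ : ℝ, 0 < ρ → ρ ≤ ρ₀ → Loss ω α ρ (Real.exp (K / ρ ^ 5)))
    (hρc : 10 * ρ₀ ≤ c₀) (hR : r₀ + 30 * ρ₀ + 3 * η ≤ R)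
    (ha : GermBound a R (3 * η) d) (hb : GermBound b R (3 * η) d)
    (hd : 5 * d ≤ η * Real.exp (-(40 * (K / ρ₀ ^ 5)))) :
    ∃ u w : WA r₀, IsReal u ∧ IsReal w ∧ ‖u‖ ≤ c₀ ∧ ‖w‖ ≤ c₀ ∧
      err₁ ω α a u w = 0 ∧ err₂ ω α b u w = 0 := by
  have hρ₀' : (0 : ℝ) < ρ₀ := hρ₀
  have hc₀ : 0 < c₀ := by linarith
  set θ : ℕ → ℝ≥0 := fun n => ρ₀ * (9 / 10) ^ n with hθ
  have hθR : ∀ n, (θ n : ℝ) = ρ₀ * (9 / 10) ^ n := fun n => by simp [hθ]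
  have hθpos : ∀ n, (0 : ℝ) < θ n := fun n => by rw [hθR]; positivity
  have hθle : ∀ n, (θ n : ℝ) ≤ ρ₀ := fun n => by
    rw [hθR]
    exact mul_le_of_le_one_right hρ₀'.le (pow_le_one₀ (by norm_num) (by norm_num))
  have hθsucc : ∀ n, (θ (n + 1) : ℝ) = 9 / 10 * θ n := fun n => by
    rw [hθR, hθR, pow_succ]; ring
  -- Since 30(θ n − θ (n+1)) = 3 θ n, consecutive strips leave room for exactly the three losses of
  -- one step.
  set rad : ℕ → ℝ≥0 := fun n => r₀ + 30 * θ n with hrad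
  have hradR : ∀ n, (rad n : ℝ) = r₀ + 30 * θ n := fun n => by simp [hrad]
  have hr₀ : ∀ n, r₀ ≤ rad n := fun n => le_self_add
  have hradR' : ∀ n, (rad n : ℝ) + 3 * η ≤ R := fun n => by
    rw [hradR]; linarith [hθle n]
  set Λ : ℕ → ℝ := fun n => Real.exp (K / (θ n : ℝ) ^ 5) with hΛ
  set E : ℕ → ℝ := fun n => Real.exp (-(40 * (K / (θ n : ℝ) ^ 5))) with hE
  have hEpos : ∀ n, 0 < E n := fun n => Real.exp_pos _
  have hloss : ∀ n, Loss ω α (θ n) (Λ n) := fun n => hL _ (hθpos n) (hθle n)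
  set C : ℕ → ℝ := fun n => c₀ * (1 - (9 / 10) ^ n) with hC
  have hpow : ∀ n, (0 : ℝ) < (9 / 10) ^ n := fun n => by positivity
  have hpow1 : ∀ n, (9 / 10 : ℝ) ^ n ≤ 1 := fun n => pow_le_one₀ (by norm_num) (by norm_num)
  have hC0 : ∀ n, 0 ≤ C n := fun n => mul_nonneg hc₀.le (by linarith [hpow1 n])
  have hCc : ∀ n, C n ≤ c₀ := fun n => mul_le_of_le_one_right hc₀.le (by linarith [hpow n])
  -- the quantities controlling one step
  have hstep : ∀ n, Λ n ^ 5 * E n ≤ c₀ * (9 / 10) ^ n / 10 := fun n => by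
    have hx : 0 < K / (θ n : ℝ) ^ 5 := by have := hθpos n; positivity
    have h1 : Λ n ^ 5 * E n ≤ (Λ n)⁻¹ := by
      rw [hΛ, hE]
      dsimp only
      rw [← Real.exp_nat_mul, ← Real.exp_add, ← Real.exp_neg]
      refine Real.exp_le_exp.2 ?_
      push_cast
      linarith
    have h2 : (Λ n)⁻¹ ≤ θ n := by
      rw [inv_le_comm₀ (Real.exp_pos _) (hθpos n)]
      exact (hloss n).inv_le
    refine (h1.trans h2).trans ?_
    rw [hθR]
    have := hpow n
    nlinarith
  -- In powers of Λ n the left exponent is 8 − 80 = −72, while narrowing θ by 9/10 gives −40(10/9)⁵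
  -- > −68 on the right.
  have hquad : ∀ n, Λ n ^ 8 * E n ^ 2 ≤ E (n + 1) := fun n => by
    have hp := hθpos n
    have hx : 0 < K / (θ n : ℝ) ^ 5 := by positivity
    rw [hΛ, hE]
    dsimp only
    rw [← Real.exp_nat_mul, ← Real.exp_nat_mul, ← Real.exp_add, hθsucc]
    refine Real.exp_le_exp.2 ?_
    have h1 : K / (9 / 10 * (θ n : ℝ)) ^ 5 = (10 / 9) ^ 5 * (K / (θ n : ℝ) ^ 5) := by
      field_simp
    rw [h1]
    push_cast
    nlinarith
  -- The ambient algebra changes with n, so the iterates form a dependent sequence; they are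
  -- compared only after restriction to the limiting strip r₀.
  let S : ℕ → Type := fun n => {p : (WA (rad n) × WA (rad n)) × (WA (rad n) × WA (rad n)) ×
    (WA (rad n) × ℝ) // Approx ω α a b (C n) (E n) p.1.1 p.1.2 p.2.1.1 p.2.1.2 p.2.2.1 p.2.2.2}
  let P : ∀ n, S n → S (n + 1) → Prop := fun n s s' =>
    ‖incl (hr₀ (n + 1)) s'.1.1.1 - incl (hr₀ n) s.1.1.1‖ ≤ c₀ / 10 * (9 / 10) ^ n ∧
      ‖incl (hr₀ (n + 1)) s'.1.1.2 - incl (hr₀ n) s.1.1.2‖ ≤ c₀ / 10 * (9 / 10) ^ n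
  have hnext : ∀ n s, ∃ s', P n s s' := by
    rintro n ⟨⟨⟨u, w⟩, ⟨U, W⟩, q, κ⟩, h⟩
    have e1 : ((r₀ + 29 * θ n : ℝ≥0) : ℝ) = r₀ + 29 * θ n := by push_cast; rfl
    have e2 : ((r₀ + 28 * θ n : ℝ≥0) : ℝ) = r₀ + 28 * θ n := by push_cast; rfl
    have hp := hθpos n
    have hCn : C n + Λ n ^ 5 * E n ≤ C (n + 1) := by
      have := hstep n
      simp only [hC, pow_succ]
      linarith
    obtain ⟨u', w', U', W', q', κ', h', hu', hw'⟩ := h.exists_step D (hloss n) (hradR' n)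
      (r₁ := r₀ + 29 * θ n) (r₂ := r₀ + 28 * θ n) (r₃ := rad (n + 1))
      (by rw [e1, hradR]; linarith) (by rw [e1, e2]; linarith)
      (by rw [e2, hradR, hθsucc]; linarith)
      (by rw [← NNReal.coe_le_coe, e1, hradR]; linarith)
      (by rw [← NNReal.coe_le_coe, e1, e2]; linarith)
      (by rw [← NNReal.coe_le_coe, e2, hradR, hθsucc]; linarith) (hr₀ _) (hEpos n) (hC0 n)
      (hCn.trans (hCc _))
    refine ⟨⟨⟨⟨u', w'⟩, ⟨U', W'⟩, q', κ'⟩, h'.mono hCn (hquad n)⟩, ?_, ?_⟩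
    · have h1 := norm_incl_le_of (hr₀ (n + 1)) hu'
      rw [map_sub, incl_incl] at h1
      exact h1.trans ((hstep n).trans_eq (by ring))
    · have h1 := norm_incl_le_of (hr₀ (n + 1)) hw'
      rw [map_sub, incl_incl] at h1
      exact h1.trans ((hstep n).trans_eq (by ring))
  have hzero : Approx ω α a b (C 0) (E 0) (0 : WA (rad 0)) (0 : WA (rad 0)) (1 : WA (rad 0))
      (0 : WA (rad 0)) (1 : WA (rad 0)) 1 := by
    refine (approx_zero D.freq D.η_pos D.η_le ha hb (hradR' 0) (e := E 0) ?_ ?_).mono (hC0 0) le_rfl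
    · simpa [hE, hθ] using hd
    · refine Real.exp_le_one_iff.2 ?_
      have := hθpos 0
      have : 0 < K / (θ 0 : ℝ) ^ 5 := by positivity
      linarith
  obtain ⟨s, -, hs⟩ := exists_dependent_sequence hnext ⟨⟨⟨0, 0⟩, ⟨1, 0⟩, 1, 1⟩, hzero⟩
  set x : ℕ → WA r₀ := fun n => incl (hr₀ n) (s n).1.1.1 with hx
  set y : ℕ → WA r₀ := fun n => incl (hr₀ n) (s n).1.1.2 with hy
  have hcx : CauchySeq x := cauchySeq_of_le_geometric (9 / 10) (c₀ / 10) (by norm_num) fun n => by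
    rw [dist_comm, dist_eq_norm]; exact (hs n).1
  have hcy : CauchySeq y := cauchySeq_of_le_geometric (9 / 10) (c₀ / 10) (by norm_num) fun n => by
    rw [dist_comm, dist_eq_norm]; exact (hs n).2
  obtain ⟨u, hu⟩ := cauchySeq_tendsto_of_complete hcx
  obtain ⟨w, hw⟩ := cauchySeq_tendsto_of_complete hcy
  have hun : ‖u‖ ≤ c₀ := le_of_tendsto hu.norm (.of_forall fun n =>
    (norm_incl_le_of (hr₀ n) (s n).2.norm_u).trans (hCc n))
  have hwn : ‖w‖ ≤ c₀ := le_of_tendsto hw.norm (.of_forall fun n =>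
    (norm_incl_le_of (hr₀ n) (s n).2.norm_w).trans (hCc n))
  have hdom : InDomain R η u w :=
    ⟨by linarith, hun.trans D.c₀_le_η, hwn.trans D.c₀_le_η⟩
  have hdomn : ∀ n, InDomain R η (s n).1.1.1 (s n).1.1.2 := fun n =>
    (s n).2.inDomain ((hCc n).trans D.c₀_le_η) (hradR' n)
  have hElim : Tendsto E atTop (𝓝 0) := by
    have h1 : Tendsto (fun n => (θ n : ℝ)) atTop (𝓝 0) := by
      simp only [hθR]
      simpa using (tendsto_pow_atTop_nhds_zero_of_lt_one (r := (9 / 10 : ℝ)) (by norm_num)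
        (by norm_num)).const_mul (ρ₀ : ℝ)
    refine squeeze_zero (fun n => (hEpos n).le) (fun n => ?_) h1
    refine le_trans ?_ ((inv_le_comm₀ (Real.exp_pos _) (hθpos n)).2 (hloss n).inv_le)
    rw [← Real.exp_neg]
    refine Real.exp_le_exp.2 ?_
    have := hθpos n
    have : 0 < K / (θ n : ℝ) ^ 5 := by positivity
    linarith
  refine ⟨u, w, isReal_of_tendsto hu (fun n => (s n).2.real_u.incl _),
    isReal_of_tendsto hw (fun n => (s n).2.real_w.incl _), hun, hwn, ?_, ?_⟩
  · have h1 : Tendsto (fun n => err₁ ω α a (x n) (y n)) atTop (𝓝 (err₁ ω α a u w)) :=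
      ((hu.add hw).add (D.small_a.tendsto_comp D.freq D.η_pos D.η_le hdom hu hw)).sub
        ((continuous_tau.tendsto u).comp hu)
    refine tendsto_nhds_unique h1 (squeeze_zero_norm (fun n => ?_) hElim)
    rw [hx, hy]
    dsimp only
    rw [← D.small_a.incl_err₁ D.freq D.η_pos (hdomn n)]
    exact norm_incl_le_of _ (s n).2.norm_err₁
  · have h1 : Tendsto (fun n => err₂ ω α b (x n) (y n)) atTop (𝓝 (err₂ ω α b u w)) :=
      (hw.add (D.small_b.tendsto_comp D.freq D.η_pos D.η_le hdom hu hw)).sub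
        ((continuous_tau.tendsto w).comp hw)
    refine tendsto_nhds_unique h1 (squeeze_zero_norm (fun n => ?_) hElim)
    rw [hx, hy]
    dsimp only
    rw [← D.small_b.incl_err₂ D.freq D.η_pos (hdomn n)]
    exact norm_incl_le_of _ (s n).2.norm_err₂

end WA

/-! ### Coefficient families of the given functions. -/

namespace WA

variable {ω : ℕ+ → ℝ} {α η s d : ℝ} {a : Idx × ℕ → ℂ} {R : ℝ≥0} {f : ℂ → ℂ → ℂ}

lemma exists_taylor {φ : ℂ → ℂ} {z : ℂ} {m : ℝ} (hs : 0 < s)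
    (hφ : AnalyticOnNhd ℂ φ (Metric.ball z s)) (hm : ∀ y ∈ Metric.ball z s, ‖φ y‖ ≤ m) :
    ∃ p : ℕ → ℂ, (∀ k, ‖p k‖ * (s / 2) ^ k ≤ m) ∧
      ∀ y : ℂ, ‖y‖ < s → HasSum (fun k => p k * y ^ k) (φ (z + y)) := by
  refine ⟨fun k => (k.factorial : ℂ)⁻¹ * iteratedDeriv k φ z, fun k => ?_, fun y hy => ?_⟩
  · have hsub : Metric.closedBall z (s / 2) ⊆ Metric.ball z s :=
      Metric.closedBall_subset_ball (by linarith)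
    have h1 := Complex.norm_iteratedDeriv_le_of_forall_mem_sphere_norm_le k (half_pos hs)
      ((hφ.differentiableOn.mono hsub).diffContOnCl_ball subset_rfl)
      (C := m) fun y hy => hm y (hsub (Metric.sphere_subset_closedBall hy))
    have hk : (0 : ℝ) < k.factorial := by exact_mod_cast k.factorial_pos
    rw [norm_mul, norm_inv, Complex.norm_natCast]
    rw [le_div_iff₀ (by positivity)] at h1
    rw [mul_assoc, inv_mul_le_iff₀ hk]
    exact h1
  · have h1 := Complex.hasSum_taylorSeries_on_ball (c := z) (r := s.toNNReal) (f := φ) (z := z + y)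
      (by rw [Real.coe_toNNReal s hs.le]; exact hφ.differentiableOn)
      (by rw [Real.coe_toNNReal s hs.le]; simpa using hy)
    refine h1.congr_fun fun k => ?_
    rw [add_sub_cancel_left, smul_eq_mul, smul_eq_mul]
    ring

/-- Cauchy's estimate at radius s/2 bounds the Taylor coefficients of each Fourier coefficient. As
3η ≤ s/4, the Taylor sums are dominated by a geometric series of ratio 1/2, which costs the factor
2. -/
lemma exists_germ {c : Idx → ℂ → ℂ} (hs : 0 < s) (hη : 0 < η) (hηs : 12 * η ≤ s) (hR : 0 < R)
    (hf : HasFourierSeries₂ ω α R s c f) (hc : coeffNorm₂ α R s c ≤ ENNReal.ofReal d)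
    (hd : 0 ≤ d) :
    ∃ a, GermBound a R (3 * η) (2 * d) ∧ Represents ω α (3 * η) a f := by
  set M : Idx → ℝ≥0∞ := fun l => ⨆ y ∈ Metric.ball (α : ℂ) s, ‖c l y‖ₑ with hM
  have hle : ∀ l, M l * ENNReal.ofReal (wt R l) ≤ ENNReal.ofReal d := fun l =>
    (ENNReal.le_tsum l).trans hc
  have hMtop : ∀ l, M l ≠ ⊤ := fun l h => by
    have h1 := hle l
    rw [h, ENNReal.top_mul (by simpa using wt_pos R l)] at h1
    exact ENNReal.ofReal_ne_top (top_le_iff.1 h1)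
  have hm : ∀ l, ∀ y ∈ Metric.ball (α : ℂ) s, ‖c l y‖ ≤ (M l).toReal := fun l y hy => by
    rw [← toReal_enorm]
    exact ENNReal.toReal_mono (hMtop l) (le_iSup₂ (f := fun y _ => ‖c l y‖ₑ) y hy)
  have hterm : ∀ l, (M l * ENNReal.ofReal (wt R l)).toReal = (M l).toReal * wt R l := fun l => by
    rw [ENNReal.toReal_mul, ENNReal.toReal_ofReal (wt_pos R l).le]
  have hfin : ∑' l, M l * ENNReal.ofReal (wt R l) ≠ ⊤ := ne_top_of_le_ne_top
    ENNReal.ofReal_ne_top hc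
  have hsum : Summable fun l => (M l).toReal * wt R l := by
    simpa only [hterm] using ENNReal.summable_toReal hfin
  have htsum : ∑' l, (M l).toReal * wt R l ≤ d := by
    simp only [← hterm]
    rw [← ENNReal.tsum_toReal_eq (fun l => ENNReal.ne_top_of_tsum_ne_top hfin l)]
    exact ENNReal.toReal_le_of_le_ofReal hd hc
  choose p hp hps using fun l => exists_taylor hs (hf.analytic l) (hm l)
  have hgeo : HasSum (fun k : ℕ => (1 / 2 : ℝ) ^ k) 2 := hasSum_geometric_two
  have hmaj : HasSum (fun j : Idx × ℕ => (M j.1).toReal * wt R j.1 * (1 / 2) ^ j.2)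
      ((∑' l, (M l).toReal * wt R l) * 2) :=
    hsum.hasSum.mul hgeo (hsum.mul_of_nonneg hgeo.summable
      (fun l => mul_nonneg ENNReal.toReal_nonneg (wt_pos R l).le) (fun k => by positivity))
  have hbound : ∀ j : Idx × ℕ, ‖p j.1 j.2‖ * ((3 * η) ^ j.2 * wt R j.1) ≤
      (M j.1).toReal * wt R j.1 * (1 / 2) ^ j.2 := fun j => by
    have h1 := hp j.1 j.2
    have h2 := wt_pos R j.1
    calc ‖p j.1 j.2‖ * ((3 * η) ^ j.2 * wt R j.1)
        ≤ ‖p j.1 j.2‖ * ((s / 2 * (1 / 2)) ^ j.2 * wt R j.1) := by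
          have h3 : 3 * η ≤ s / 2 * (1 / 2) := by linarith
          gcongr ‖p j.1 j.2‖ * (?_ ^ j.2 * wt R j.1)
      _ = (‖p j.1 j.2‖ * (s / 2) ^ j.2) * (wt R j.1 * (1 / 2) ^ j.2) := by
          rw [mul_pow]; ring
      _ ≤ (M j.1).toReal * (wt R j.1 * (1 / 2) ^ j.2) := by gcongr
      _ = _ := by ring
  have hsummable : Summable fun j : Idx × ℕ => ‖p j.1 j.2‖ * ((3 * η) ^ j.2 * wt R j.1) :=
    hmaj.summable.of_nonneg_of_le (fun j => by have := wt_pos R j.1; positivity) hbound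
  refine ⟨fun j => p j.1 j.2, ⟨hsummable, ?_⟩, fun x y hy => ?_⟩
  · refine (hsummable.tsum_le_tsum hbound hmaj.summable).trans ?_
    rw [hmaj.tsum_eq]
    linarith
  · have hys : ‖(y : ℂ)‖ < s := by
      rw [Complex.norm_real, Real.norm_eq_abs]
      linarith
    have habs : Summable fun j : Idx × ℕ => p j.1 j.2 * (y : ℂ) ^ j.2 *
        Complex.exp (I * freqPairing ω j.1 * x) := by
      refine Summable.of_norm_bounded hsummable fun j => ?_
      rw [norm_mul, norm_mul, norm_cexp_mul_I, mul_one, norm_pow, Complex.norm_real,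
        Real.norm_eq_abs]
      gcongr
      exact (pow_le_pow_left₀ (abs_nonneg _) hy _).trans
        (le_mul_of_one_le_right (by positivity) (one_le_wt R j.1))
    have h1 : ∀ l, HasSum (fun k => p l k * (y : ℂ) ^ k * Complex.exp (I * freqPairing ω l * x))
        (c l (α + y : ℝ) * Complex.exp (I * freqPairing ω l * x)) := fun l => by
      rw [Complex.ofReal_add]
      exact (hps l y hys).mul_right _
    have h2 := habs.hasSum.prod_fiberwise h1
    have h3 := hf.hasSum x (by simpa using hR) ((α + y : ℝ) : ℂ) (by simpa using hys)
    rw [h3.unique h2]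
    exact habs.hasSum

/-- Averaging the family with its conjugate reflected in l gives real symmetry without increasing
the norm bound. It still represents f because f equals its own conjugate at real points; uniqueness
of coefficients is not invoked. -/
lemma exists_realGerm (hs : 0 ≤ s) (ha : GermBound a R s d) (hf : Represents ω α s a f)
    (hreal : ∀ x y : ℝ, |y| ≤ s → (f x (α + y : ℝ)).im = 0) :
    ∃ a', RealGerm a' ∧ GermBound a' R s d ∧ Represents ω α s a' f := by
  set ι : Idx × ℕ ≃ Idx × ℕ := (Equiv.neg Idx).prodCongr (Equiv.refl ℕ) with hι
  have hι' : ∀ j : Idx × ℕ, ι j = (-j.1, j.2) := fun j => rfl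
  set a' : Idx × ℕ → ℂ := fun j => 1 / 2 * (a j + conj (a (ι j))) with ha'
  have hterm : ∀ j, ‖a (ι j)‖ * (s ^ (ι j).2 * wt R (ι j).1) = ‖a (ι j)‖ * (s ^ j.2 * wt R j.1) :=
    fun j => by rw [hι', wt_neg]
  have hsum' : HasSum (fun j => ‖a (ι j)‖ * (s ^ j.2 * wt R j.1))
      (∑' j, ‖a j‖ * (s ^ j.2 * wt R j.1)) := by
    have h1 := (ι.hasSum_iff (f := fun j => ‖a j‖ * (s ^ j.2 * wt R j.1))).2 ha.summable.hasSum
    exact h1.congr_fun fun j => (hterm j).symm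
  have hmaj := (ha.summable.hasSum.add hsum').mul_left (1 / 2)
  have hbound : ∀ j, ‖a' j‖ * (s ^ j.2 * wt R j.1) ≤ 1 / 2 * (‖a j‖ * (s ^ j.2 * wt R j.1) +
      ‖a (ι j)‖ * (s ^ j.2 * wt R j.1)) := fun j => by
    have h1 : ‖a' j‖ ≤ 1 / 2 * (‖a j‖ + ‖a (ι j)‖) := by
      rw [ha', norm_mul]
      have h2 := norm_add_le (a j) (conj (a (ι j)))
      rw [RCLike.norm_conj] at h2
      norm_num
      linarith
    have h2 := wt_pos R j.1
    calc _ ≤ 1 / 2 * (‖a j‖ + ‖a (ι j)‖) * (s ^ j.2 * wt R j.1) := by gcongr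
      _ = _ := by ring
  have hsummable : Summable fun j => ‖a' j‖ * (s ^ j.2 * wt R j.1) :=
    hmaj.summable.of_nonneg_of_le (fun j => by have := wt_pos R j.1; positivity) hbound
  refine ⟨a', fun l k => ?_, ⟨hsummable, ?_⟩, fun x y hy => ?_⟩
  · simp only [ha', hι', neg_neg, map_mul, map_add, Complex.conj_conj, map_div₀, map_one]
    rw [add_comm, show conj (2 : ℂ) = 2 from Complex.conj_ofNat 2]
  · refine (hsummable.tsum_le_tsum hbound hmaj.summable).trans ?_
    rw [hmaj.tsum_eq]
    linarith [ha.le]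
  · have h1 := hf x y hy
    have h2 := (ι.hasSum_iff (f := fun j : Idx × ℕ => conj (a j * (y : ℂ) ^ j.2 *
      Complex.exp (I * freqPairing ω j.1 * x)))).2 ((Complex.hasSum_conj' (x := f x (α + y : ℝ))).2 h1)
    rw [Complex.conj_eq_iff_im.2 (hreal x y hy)] at h2
    have h3 := (h1.add h2).mul_left (1 / 2)
    rw [show 1 / 2 * (f x (α + y : ℝ) + f x (α + y : ℝ)) = f x (α + y : ℝ) by ring] at h3
    refine h3.congr_fun fun j => ?_
    simp only [ha', Function.comp_apply, hι', freqPairing_neg, map_mul, map_pow,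
      Complex.conj_ofReal, ← Complex.exp_conj, Complex.conj_I, Complex.ofReal_neg, neg_mul_neg]
    ring

/-- A small almost periodic function on a complex strip is given by a real power series. -/
lemma exists_realGerm_of_apNorm₂_lt (hs : 0 < s) (hη : 0 < η) (hηs : 12 * η ≤ s) (hR : 0 < R)
    (hd : 0 ≤ d) (hf : apNorm₂ ω α R s f < ENNReal.ofReal d) (hreal : RealOnStrip α s f) :
    ∃ a, RealGerm a ∧ GermBound a R (3 * η) (2 * d) ∧ Represents ω α (3 * η) a f := by
  simp only [apNorm₂, iInf_lt_iff] at hf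
  obtain ⟨c, hc, hcd⟩ := hf
  obtain ⟨a, ha, haf⟩ := exists_germ hs hη hηs hR hc hcd.le hd
  refine exists_realGerm (by positivity) ha haf fun x y hy => hreal x _ ?_
  rw [add_sub_cancel_left]
  linarith

/-- The almost periodic function `α + x`. -/
lemma hasFourierSeries_const_add {r : ℝ≥0} (hω : ∀ i, |ω i| ≤ 1) (x : WA r) (c : ℂ) :
    HasFourierSeries ω r (c • (1 : WA r) + x : WA r) fun z => c + toFun ω x z := fun z hz => by
  refine ((hasSum_ite_eq (0 : Idx) c).add (hasFourierSeries_toFun hω x z hz)).congr_fun fun l => ?_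
  by_cases hl : l = 0
  · simp [hl, one_apply]
  · simp [hl, one_apply]

end WA

end

/-! ### Choice of constants and conclusion. -/

theorem theorem2p1 (r₀ s₀ γ μ ε : ℝ) (hr₀ : 0 < r₀) (hs₀ : 0 < s₀) (hγ : 0 < γ) (hμ : 0 < μ)
    (hε : 0 < ε) :
    ∃ δ : ℝ, 0 < δ ∧
      ∀ (γ₀ : ℝ) (ω : ℕ+ → ℝ) (α : ℝ), 0 < γ₀ → IsDiophantine ω γ₀ μ → IsNonresonant ω γ μ α →
      ∀ f ∈ AP₂ ω α r₀ s₀, ∀ g ∈ AP₂ ω α r₀ s₀,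
        RealOnStrip α s₀ f → RealOnStrip α s₀ g →
        HasIntersectionProperty ω α s₀ f g →
        apNorm₂ ω α r₀ s₀ f + apNorm₂ ω α r₀ s₀ g < ENNReal.ofReal δ →
        ∃ u ∈ AP ω (r₀ / 2), ∃ v ∈ AP ω (r₀ / 2),
          RealOnReals u ∧ RealOnReals v ∧
          apNorm ω (r₀ / 2) u + apNorm ω (r₀ / 2) (fun z => v z - (α : ℂ)) < ENNReal.ofReal ε ∧
          -- the curve lies in the domain of the map
          (∀ ξ : ℝ, v ξ ∈ Metric.ball (α : ℂ) s₀) ∧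
          -- it is invariant, and the map acts on it as `ξ ↦ ξ + α`
          twistMap f g '' curveSet (fun ξ => ξ + u ξ) v = curveSet (fun ξ => ξ + u ξ) v ∧
          ∀ ξ : ℝ, twistMap f g ((ξ : ℂ) + u ξ, v ξ) =
            (((ξ + α : ℝ) : ℂ) + u ((ξ + α : ℝ) : ℂ), v ((ξ + α : ℝ) : ℂ)) := by
  obtain ⟨K, hK, ρ₁, hρ₁, hloss⟩ := WA.exists_loss hγ hμ
  lift r₀ to ℝ≥0 using hr₀.le
  -- The half strip given up, r₀/2, is split evenly: 3η ≤ r₀/4 for the margins and 30ρ₀ ≤ r₀/4 for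
  -- the iteration. The bound by s₀ serves the Taylor expansion in y.
  obtain ⟨η, hη, hη1, hηr, hηs⟩ : ∃ η : ℝ, 0 < η ∧ η ≤ 1 ∧ 12 * η ≤ r₀ ∧ 12 * η ≤ s₀ :=
    ⟨min 1 (min (r₀ / 12) (s₀ / 12)), by positivity, min_le_left _ _, by
      linarith [(min_le_right (1 : ℝ) _).trans (min_le_left (r₀ / 12 : ℝ) (s₀ / 12))], by
      linarith [(min_le_right (1 : ℝ) _).trans (min_le_right (r₀ / 12 : ℝ) (s₀ / 12))]⟩
  -- The bound 128 c₀ ≤ r₀ is the condition for inverting ξ + u(ξ) on strips of width at least r₀/2;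
  -- 4 c₀ ≤ ε makes ‖u‖ + ‖w‖ ≤ 2 c₀ smaller than ε.
  obtain ⟨c₀, hc₀, hc1, hcη, hcr, hcε⟩ : ∃ c₀ : ℝ, 0 < c₀ ∧ c₀ ≤ 1 / 100 ∧ c₀ ≤ η ∧
      128 * c₀ ≤ r₀ ∧ 4 * c₀ ≤ ε :=
    ⟨min (min (1 / 100) η) (min (r₀ / 128) (ε / 4)), by positivity,
      (min_le_left _ _).trans (min_le_left _ _), (min_le_left _ _).trans (min_le_right _ _), by
      linarith [(min_le_right (min (1 / 100) η) _).trans (min_le_left (r₀ / 128 : ℝ) (ε / 4))], by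
      linarith [(min_le_right (min (1 / 100) η) _).trans (min_le_right (r₀ / 128 : ℝ) (ε / 4))]⟩
  obtain ⟨ρ₀, hρ₀, hρ₀₁, hρ₀c, hρ₀r⟩ : ∃ ρ₀ : ℝ, 0 < ρ₀ ∧ ρ₀ ≤ ρ₁ ∧ 10 * ρ₀ ≤ c₀ ∧
      120 * ρ₀ ≤ r₀ :=
    ⟨min ρ₁ (min (c₀ / 10) (r₀ / 120)), by positivity, min_le_left _ _, by
      linarith [(min_le_right ρ₁ _).trans (min_le_left (c₀ / 10) (r₀ / 120 : ℝ))], by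
      linarith [(min_le_right ρ₁ _).trans (min_le_right (c₀ / 10) (r₀ / 120 : ℝ))]⟩
  lift ρ₀ to ℝ≥0 using hρ₀.le
  -- The factor 2 is the loss in passing to Fourier–Taylor coefficients. The first condition makes
  -- the substitution estimates available, the second makes the unperturbed curve an admissible
  -- start.
  obtain ⟨δ, hδ, hδη, hδE⟩ : ∃ δ : ℝ, 0 < δ ∧ 2 * δ ≤ η ^ 2 / 1600 ∧
      5 * (2 * δ) ≤ η * Real.exp (-(40 * (K / ρ₀ ^ 5))) := by
    refine ⟨min (η ^ 2 / 3200) (η * Real.exp (-(40 * (K / ρ₀ ^ 5))) / 10), by positivity, ?_, ?_⟩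
    · linarith [min_le_left (η ^ 2 / 3200) (η * Real.exp (-(40 * (K / ρ₀ ^ 5))) / 10)]
    · linarith [min_le_right (η ^ 2 / 3200) (η * Real.exp (-(40 * (K / ρ₀ ^ 5))) / 10)]
  refine ⟨δ, hδ, fun γ₀ ω α _ hω hα f _ g _ hfr hgr hint hfg => ?_⟩
  have hfreq := hω.abs_le_one
  obtain ⟨a, har, hab, haf⟩ := WA.exists_realGerm_of_apNorm₂_lt hs₀ hη hηs hr₀ hδ.le
    (le_self_add.trans_lt hfg) hfr
  obtain ⟨b, hbr, hbb, hbg⟩ := WA.exists_realGerm_of_apNorm₂_lt hs₀ hη hηs hr₀ hδ.le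
    (le_add_self.trans_lt hfg) hgr
  have hsa : WA.SmallGerm a r₀ η := ⟨har, hab.summable, hab.le.trans hδη⟩
  have hsb : WA.SmallGerm b r₀ η := ⟨hbr, hbb.summable, hbb.le.trans hδη⟩
  have hhalf : ((r₀ / 2 : ℝ≥0) : ℝ) = r₀ / 2 := by simp
  have hηs' : η < s₀ := by linarith
  have D : WA.KamData ω α a b r₀ η c₀ (r₀ / 2) :=
    ⟨hfreq, hη, hη1, hsa, hsb, WA.crossing_of_intersection hfreq hη hsa hsb haf hbg hηs'
      (half_pos hr₀) hcη (by rw [hhalf]; linarith) hint, hc1, hcη⟩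
  obtain ⟨u, w, hur, hwr, hun, hwn, h1, h2⟩ := WA.exists_invariant_curve D hK hρ₀
    (fun ρ hρ hρ' => hloss ω α hα ρ hρ (hρ'.trans hρ₀₁)) hρ₀c (by rw [hhalf]; linarith)
    hab hbb hδE
  have hdom : WA.InDomain r₀ η u w :=
    ⟨by rw [hhalf]; linarith, hun.trans hcη, hwn.trans hcη⟩
  have hconj : ∀ ξ : ℝ, twistMap f g ((ξ : ℂ) + WA.toFun ω u ξ, α + WA.toFun ω w ξ) =
      (((ξ + α : ℝ) : ℂ) + WA.toFun ω u ((ξ + α : ℝ) : ℂ),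
        α + WA.toFun ω w ((ξ + α : ℝ) : ℂ)) := fun ξ => by
    have e1 := congrArg (WA.ev ω ξ (r₀ / 2)) h1
    have e2 := congrArg (WA.ev ω ξ (r₀ / 2)) h2
    simp only [WA.err₁, WA.err₂, map_add, map_sub, map_zero, WA.ev_tau,
      haf.ev_comp hsa hfreq hη hdom hur hwr, hbg.ev_comp hsb hfreq hη hdom hur hwr] at e1 e2
    simp only [twistMap, WA.toFun_ofReal, Prod.mk.injEq]
    push_cast
    constructor
    · linear_combination e1
    · linear_combination e2
  rw [← hhalf]
  refine ⟨WA.toFun ω u, WA.toFun_mem_AP hfreq u, fun z => α + WA.toFun ω w z,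
    ⟨_, WA.hasFourierSeries_const_add hfreq w α, ?_⟩, WA.realOnReals_toFun hur, fun ξ => ?_, ?_,
    fun ξ => ?_, ?_, hconj⟩
  · rw [WA.coeffNorm_eq]
    exact ENNReal.ofReal_lt_top
  · simp [WA.realOnReals_toFun hwr ξ]
  · simp only [add_sub_cancel_left]
    refine (add_le_add (WA.apNorm_toFun_le hfreq u) (WA.apNorm_toFun_le hfreq w)).trans_lt ?_
    rw [← ENNReal.ofReal_add (norm_nonneg _) (norm_nonneg _)]
    exact (ENNReal.ofReal_lt_ofReal_iff hε).2 (by linarith)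
  · rw [mem_ball_iff_norm, add_sub_cancel_left, WA.toFun_ofReal]
    exact (WA.norm_ev_le w).trans_lt (by linarith)
  · ext p
    constructor
    · rintro ⟨_, ⟨ξ, rfl⟩, rfl⟩
      exact ⟨ξ + α, (hconj ξ).symm⟩
    -- The rotation is onto, so each point of the curve is the image of the point with parameter ξ −
    -- α.
    · rintro ⟨ξ, rfl⟩
      refine ⟨_, ⟨ξ - α, rfl⟩, ?_⟩
      have h3 := hconj (ξ - α)
      rw [sub_add_cancel] at h3
      exact h3
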